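/- **Setting.** Let $\Omega\subset\mathbb R^d$ be a bounded domain of class $C^1$ with outer unit normal $n(x)$, $x\in\partial\Omega$; let $\partial\Omega_1\subset\partial\Omega$ be relatively open and $\partial\Omega_2=\partial\Omega\setminus\overline{\partial\Omega_1}$. Let $y\in C^1(\overline\Omega;\mathbb R^m)$ and $F(x)=\nabla y(x)$, $x\in\overline\Omega$. Let $W:\overline\Omega\times\mathbb R^{m\times d}\to\mathbb R$ be continuous, and suppose that there is an open set $\mathcal O\supset\{F(x):x\in\overline\Omega\}$ such that $W_F$ and $W_{FF}$ exist and are continuous on $\overline\Omega\times\mathcal O$. With the Frobenius norm and inner product on matrices, put $$W^\circ(x,A)=W(x,F(x)+A)-W(x,F(x))-(W_F(x,F(x)),A),\qquad \mathsf L(x)=W_{FF}(x,F(x)),$$ $$U(x,A)=\frac{W^\circ(x,A)-\frac12(\mathsf L(x)A,A)}{|A|^2}\ (A\ne0),\quad U(x,0)=0,\qquad \mathcal F(x,\alpha,G)=\frac{W^\circ(x,\alpha G)}{\alpha^2}\ (\alpha>0).$$ Let $v_n\rightharpoonup0$ weakly in $W^{1,2}(\Omega;\mathbb R^m)$, let $\alpha_n>0$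 be such that $\alpha_nv_n$ is bounded in $W^{1,\infty}(\Omega;\mathbb R^m)$, and let $\|\alpha_n\nabla v_n\|_\infty\le R$ for all $n$. Let $\tilde\pi$ be a finite Borel measure on $\overline\Omega$, and let $\{\tilde\mu_x\}$, $\{\tilde\lambda_x\}$ be measurable families of probability measures, $\tilde\mu_x$ carried by the closed ball $\overline{\mathcal B(0,R)}$ and $\tilde\lambda_x$ by the unit sphere $\mathcal S$ of $\mathbb R^{m\times d}$ for all $x\in\overline\Omega$, which are generated by the sequence $(\alpha_n,v_n)$: for every continuous $f:\overline\Omega\times\mathbb R^{m\times d}\to\mathbb R$, $$\int_\Omega f(x,\alpha_n\nabla v_n)\,|\nabla v_n|^2dx\to\int_{\overline\Omega}\int f(x,A)\,d\tilde\mu_x(A)\,d\tilde\pi(x),\qquad \int_\Omega f\Big(x,\frac{\nabla v_n}{|\nabla v_n|}\Big)|\nabla v_n|^2dx\to\int_{\overline\Omega}\int f(x,A)\,d\tilde\lambda_x(A)\,d\tilde\pi(x)$$ as $n\to\infty$ (the integrand of the second integral on the left being $0$ where $\nabla v_n=0$). Put $$\mathcal I(x,\mu,\lambda)=\int_{\overline{\mathcal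 B(0,R)}}U(x,A)\,d\mu(A)+\frac12\int_{\mathcal S}(\mathsf L(x)A,A)\,d\lambda(A).$$ **Blow-up.** For $x_0\in\partial\Omega_2$ write $B_\Omega(x_0,r)=B(x_0,r)\cap\overline\Omega$, $B_r^-=(B_\Omega(x_0,r)-x_0)/r$, $B^-=\{x\in B(0,1):(x,n(x_0))<0\}$ and $\hat B^-=\{x\in B(0,1):(x,n(x_0))\le0\}$. Let $f_r:\hat B^-\to B_r^-$ ($r>0$ small) be $C^1$ diffeomorphisms, where $C^1$ is understood up to the flat face, such that $f_r(x)-x$ and $\nabla f_r(x)-I$ tend to $0$ uniformly on $\hat B^-$, and $f_r^{-1}(y)-y$ and $\nabla f_r^{-1}(y)-I$ tend to $0$ uniformly on $B_r^-$, as $r\to0^+$. Put $$v_n^r(x)=\frac1r\Big(v_n(x_0+rf_r(x))-\frac1{|B^-|}\int_{B^-}v_n(x_0+rf_r(z))\,dz\Big),\qquad x\in B^-.$$ Let $\theta_k\in C_c^\infty(B(0,1))$ be real-valued and bounded uniformly in $k$, with $\theta_k\to\chi_{B(0,1)}$ pointwise, and let $\zeta_{n,k}^r=\theta_kv_n^r$.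 **Theorem 8.2 (localization at the free boundary).** For $\tilde\pi$-a.e. $x_0\in\partial\Omega_2$ the following holds for all such families $f_r$ and all such $\theta_k$. For all sufficiently small $r>0$ and all $n,k$ the function $\zeta_{n,k}^r$ belongs to $W^{1,\infty}(B^-;\mathbb R^m)$; for all sufficiently small $r>0$ the two inner limits below exist in $\mathbb R$; and $$\lim_{r\to0^+}\lim_{k\to\infty}\lim_{n\to\infty}\frac{r^d}{\tilde\pi(B_\Omega(x_0,r))}\int_{B^-}\mathcal F\big(x_0,\alpha_n,\nabla\zeta_{n,k}^r(x)\big)\,dx=\mathcal I(x_0,\tilde\mu_{x_0},\tilde\lambda_{x_0}).$$ -/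

import Mathlib

open Set Filter Topology MeasureTheory ProbabilityTheory Metric
open scoped ENNReal InnerProductSpace

noncomputable section

namespace FreeBoundary

/-- The space `ℝᵈ` with its Euclidean norm. -/
abbrev Vec (d : ℕ) : Type := EuclideanSpace ℝ (Fin d)

/-- The space of real `m × d` matrices; the Euclidean norm of the entries is the Frobenius norm. -/
abbrev Mat (m d : ℕ) : Type := EuclideanSpace ℝ (Fin m × Fin d)

variable {m d : ℕ}

/-! ### Domains of class `C¹` -/

/-- `ν` is the outer unit normal to `Ω` at `x`: near `x`, the set `Ω` is the sublevel set
`{ρ < 0}` of a `C¹` function `ρ` with `ρ x = 0` and `∇ρ(x) = ν`, `|ν| = 1`. -/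
def IsOuterUnitNormal (Ω : Set (Vec d)) (x ν : Vec d) : Prop :=
  ‖ν‖ = 1 ∧ ∃ (V : Set (Vec d)) (ρ : Vec d → ℝ), IsOpen V ∧ x ∈ V ∧ ContDiffOn ℝ 1 ρ V ∧
    ρ x = 0 ∧ HasGradientAt ρ ν x ∧ Ω ∩ V = {z ∈ V | ρ z < 0}

/-- Bounded domains (open, connected, non-empty sets) with boundary of class `C¹`. -/
structure IsBoundedC1Domain (Ω : Set (Vec d)) : Prop where
  isOpen : IsOpen Ω
  isConnected : IsConnected Ω
  isBounded : Bornology.IsBounded Ω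
  exists_normal : ∀ x ∈ frontier Ω, ∃ ν, IsOuterUnitNormal Ω x ν

/-! ### Sobolev functions -/

/-- `G` is a weak (distributional) gradient of `u` on the open set `S`:
`G_{ij} = ∂u_i / ∂x_j` when tested with `φ ∈ C_c^∞(S)`. -/
def HasWeakGradient (S : Set (Vec d)) (u : Vec d → Vec m) (G : Vec d → Mat m d) : Prop :=
  LocallyIntegrableOn u S volume ∧ LocallyIntegrableOn G S volume ∧
    ∀ φ : Vec d → ℝ, ContDiff ℝ (⊤ : ℕ∞) φ → HasCompactSupport φ → tsupport φ ⊆ S →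
      ∀ (i : Fin m) (j : Fin d),
        ∫ x in S, u x i * fderiv ℝ φ x (EuclideanSpace.single j 1) =
          -∫ x in S, G x (i, j) * φ x

open Classical in
/-- The weak gradient of `u` on `S` (unique up to null sets); it is set to `0` if there is none. -/
def weakGradient (S : Set (Vec d)) (u : Vec d → Vec m) : Vec d → Mat m d :=
  if h : ∃ G, HasWeakGradient S u G then h.choose else 0

/-- `u ∈ W^{1,p}(S; ℝᵐ)`. -/
structure MemW1p (p : ℝ≥0∞) (S : Set (Vec d)) (u : Vec d → Vec m) : Prop where
  exists_gradient : ∃ G, HasWeakGradient S u G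
  memLp : MemLp u p (volume.restrict S)
  memLp_gradient : MemLp (weakGradient S u) p (volume.restrict S)

/-- `v_n ⇀ 0` weakly in `W^{1,2}(Ω; ℝᵐ)`: the functions and their gradients converge
weakly to zero in `L²`. -/
structure WeaklyNullW12 (Ω : Set (Vec d)) (v : ℕ → Vec d → Vec m) : Prop where
  mem : ∀ n, MemW1p 2 Ω (v n)
  weak : ∀ φ : Vec d → Vec m, MemLp φ 2 (volume.restrict Ω) →
    Tendsto (fun n => ∫ x in Ω, ⟪φ x, v n x⟫_ℝ) atTop (𝓝 0)
  weak_gradient : ∀ Φ : Vec d → Mat m d, MemLp Φ 2 (volume.restrict Ω) →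
    Tendsto (fun n => ∫ x in Ω, ⟪Φ x, weakGradient Ω (v n) x⟫_ℝ) atTop (𝓝 0)

/-! ### The Lagrangian -/

/-- The matrix `(∂y_i / ∂x_j)` of classical partial derivatives. -/
def jacobian (y : Vec d → Vec m) (x : Vec d) : Mat m d :=
  WithLp.toLp 2 fun p => fderiv ℝ y x (EuclideanSpace.single p.2 1) p.1

/-- `y ∈ C¹(closure Ω; ℝᵐ)`, and `F` is the continuous extension of `∇y` to `closure Ω`. -/
structure IsC1UpToBoundary (Ω : Set (Vec d)) (y : Vec d → Vec m) (F : Vec d → Mat m d) :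
    Prop where
  differentiableAt : ∀ x ∈ Ω, DifferentiableAt ℝ y x
  gradient_eq : ∀ x ∈ Ω, F x = jacobian y x
  continuousOn : ContinuousOn y (closure Ω)
  continuousOn_gradient : ContinuousOn F (closure Ω)

/-- `W_F(x, A)`, as a linear form on matrices. -/
def lagD (W : Vec d → Mat m d → ℝ) (x : Vec d) (A : Mat m d) : Mat m d →L[ℝ] ℝ :=
  fderiv ℝ (W x) A

/-- `W_FF(x, A)`, as a bilinear form on matrices. -/
def lagD2 (W : Vec d → Mat m d → ℝ) (x : Vec d) (A : Mat m d) :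
    Mat m d →L[ℝ] Mat m d →L[ℝ] ℝ :=
  fderiv ℝ (lagD W x) A

/-- `W` is continuous on `closure Ω × ℝ^{m×d}` and there is an open set `O` containing
the range of `F = ∇y` such that `W`, `W_F`, `W_FF` exist and are continuous on
`closure Ω × O`. -/
structure IsAdmissibleLagrangian (Ω : Set (Vec d)) (F : Vec d → Mat m d)
    (W : Vec d → Mat m d → ℝ) : Prop where
  continuousOn : ContinuousOn (fun p : Vec d × Mat m d => W p.1 p.2) (closure Ω ×ˢ univ)
  smooth : ∃ O : Set (Mat m d), IsOpen O ∧ (∀ x ∈ closure Ω, F x ∈ O) ∧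
    (∀ x ∈ closure Ω, DifferentiableOn ℝ (W x) O) ∧
    (∀ x ∈ closure Ω, DifferentiableOn ℝ (lagD W x) O) ∧
    ContinuousOn (fun p : Vec d × Mat m d => lagD W p.1 p.2) (closure Ω ×ˢ O) ∧
    ContinuousOn (fun p : Vec d × Mat m d => lagD2 W p.1 p.2) (closure Ω ×ˢ O)

/-- The reduced Lagrangian
`W°(x, A) = W(x, F(x) + A) - W(x, F(x)) - (W_F(x, F(x)), A)`. -/
def reduced (W : Vec d → Mat m d → ℝ) (F : Vec d → Mat m d) (x : Vec d) (A : Mat m d) : ℝ :=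
  W x (F x + A) - W x (F x) - lagD W x (F x) A

/-- The quadratic form `(L(x) A, A)` with `L(x) = W_FF(x, F(x))`. -/
def quadForm (W : Vec d → Mat m d → ℝ) (F : Vec d → Mat m d) (x : Vec d) (A : Mat m d) : ℝ :=
  lagD2 W x (F x) A A

/-- `U(x, A) = |A|⁻² (W°(x, A) - ½ (L(x) A, A))`, with `U(x, 0) = 0`. -/
def remainder (W : Vec d → Mat m d → ℝ) (F : Vec d → Mat m d) (x : Vec d) (A : Mat m d) : ℝ :=
  (reduced W F x A - (1 / 2) * quadForm W F x A) / ‖A‖ ^ 2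

/-- `ℱ(x, α, G) = W°(x, α G) / α²`. -/
def scaledLag (W : Vec d → Mat m d → ℝ) (F : Vec d → Mat m d)
    (x : Vec d) (α : ℝ) (G : Mat m d) : ℝ :=
  reduced W F x (α • G) / α ^ 2

/-- `ℐ(x, μ, λ) = ∫_{|A| ≤ R} U(x, A) dμ(A) + ½ ∫_{|A| = 1} (L(x) A, A) dλ(A)`. -/
def actionLimit (W : Vec d → Mat m d → ℝ) (F : Vec d → Mat m d) (R : ℝ) (x : Vec d)
    (μ lam : Measure (Mat m d)) : ℝ :=
  (∫ A in closedBall 0 R, remainder W F x A ∂μ) +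
    (1 / 2) * ∫ A in sphere 0 1, quadForm W F x A ∂lam

/-! ### The limiting measures -/

/-- The measure `π` on `closure Ω`, the family `μ_x` on the closed ball of radius `R` and the
family `λ_x` on the unit sphere are generated by the gradients `G_n` and the numbers `α_n`:
`M = μ_x ⊗ π` is the weak-* limit of the images of `|G_n|² dx` under `x ↦ (x, α_n G_n(x))`,
and `Λ = λ_x ⊗ π` is the weak-* limit of the images of `|G_n|² dx` under
`x ↦ (x, G_n(x) / |G_n(x)|)`. -/
structure Generates (Ω : Set (Vec d)) (α : ℕ → ℝ) (G : ℕ → Vec d → Mat m d) (R : ℝ)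
    (π : Measure (Vec d)) (μ lam : Kernel (Vec d) (Mat m d)) : Prop where
  carrier : π (closure Ω)ᶜ = 0
  ball_carrier : ∀ x ∈ closure Ω, μ x (closedBall 0 R)ᶜ = 0
  sphere_carrier : ∀ x ∈ closure Ω, lam x (sphere 0 1)ᶜ = 0
  tendsto_M : ∀ f : Vec d × Mat m d → ℝ, Continuous f →
    Tendsto (fun n => ∫ x in Ω, f (x, α n • G n x) * ‖G n x‖ ^ 2) atTop
      (𝓝 (∫ x, ∫ A, f (x, A) ∂(μ x) ∂π))
  tendsto_Λ : ∀ f : Vec d × Mat m d → ℝ, Continuous f →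
    Tendsto (fun n => ∫ x in Ω, f (x, ‖G n x‖⁻¹ • G n x) * ‖G n x‖ ^ 2) atTop
      (𝓝 (∫ x, ∫ A, f (x, A) ∂(lam x) ∂π))

/-! ### Blow-up at a boundary point -/

/-- The open half-ball `{x ∈ B(0,1) : (x, ν) < 0}`. -/
def halfBall (ν : Vec d) : Set (Vec d) := {x ∈ ball 0 1 | ⟪x, ν⟫_ℝ < 0}

/-- The half-ball together with the flat part of its boundary. -/
def halfBallFlat (ν : Vec d) : Set (Vec d) := {x ∈ ball 0 1 | ⟪x, ν⟫_ℝ ≤ 0}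

/-- `B_Ω(x₀, r) = B(x₀, r) ∩ closure Ω`. -/
def relBall (Ω : Set (Vec d)) (x₀ : Vec d) (r : ℝ) : Set (Vec d) := ball x₀ r ∩ closure Ω

/-- `B_r⁻ = (B_Ω(x₀, r) - x₀) / r`. -/
def blowUp (Ω : Set (Vec d)) (x₀ : Vec d) (r : ℝ) : Set (Vec d) :=
  {y | x₀ + r • y ∈ relBall Ω x₀ r}

/-- A family of `C¹` diffeomorphisms `f_r` (for small `r > 0`, with inverses `g_r`) of the
half-ball, including its flat face, onto `B_r⁻`, with `f_r → id` and `g_r → id` uniformly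
together with their first derivatives as `r → 0`. -/
structure IsStraightening (Ω : Set (Vec d)) (x₀ ν : Vec d) (f g : ℝ → Vec d → Vec d) :
    Prop where
  bijOn : ∀ᶠ r in 𝓝[>] (0 : ℝ), BijOn (f r) (halfBallFlat ν) (blowUp Ω x₀ r)
  left_inv : ∀ᶠ r in 𝓝[>] (0 : ℝ), ∀ x ∈ halfBallFlat ν, g r (f r x) = x
  contDiffOn : ∀ᶠ r in 𝓝[>] (0 : ℝ), ContDiffOn ℝ 1 (f r) (halfBallFlat ν)
  contDiffOn_inv : ∀ᶠ r in 𝓝[>] (0 : ℝ), ContDiffOn ℝ 1 (g r) (blowUp Ω x₀ r)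
  close : ∀ ε > 0, ∀ᶠ r in 𝓝[>] (0 : ℝ), ∀ x ∈ halfBallFlat ν, ‖f r x - x‖ ≤ ε ∧
    ‖fderivWithin ℝ (f r) (halfBallFlat ν) x - ContinuousLinearMap.id ℝ (Vec d)‖ ≤ ε
  close_inv : ∀ ε > 0, ∀ᶠ r in 𝓝[>] (0 : ℝ), ∀ y ∈ blowUp Ω x₀ r, ‖g r y - y‖ ≤ ε ∧
    ‖fderivWithin ℝ (g r) (blowUp Ω x₀ r) y - ContinuousLinearMap.id ℝ (Vec d)‖ ≤ ε

/-- The blown-up function `v^r(x) = (v(x₀ + r f_r(x)) - C^r) / r` on the half-ball, where `C^r`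
is the mean value of `x ↦ v(x₀ + r f_r(x))` over the half-ball; here `fr` is the map `f_r`. -/
def rescaled (x₀ ν : Vec d) (fr : Vec d → Vec d) (r : ℝ) (v : Vec d → Vec m) (x : Vec d) :
    Vec m :=
  r⁻¹ • (v (x₀ + r • fr x) - ⨍ z in halfBall ν, v (x₀ + r • fr z))

/-- Cut-off functions `θ_k ∈ C_c^∞(B(0,1))`, uniformly bounded, with `θ_k → χ_{B(0,1)}`
pointwise. -/
structure IsCutoffSequence (θ : ℕ → Vec d → ℝ) : Prop where
  contDiff : ∀ k, ContDiff ℝ (⊤ : ℕ∞) (θ k)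
  hasCompactSupport : ∀ k, HasCompactSupport (θ k)
  tsupport_subset : ∀ k, tsupport (θ k) ⊆ ball 0 1
  bounded : ∃ C : ℝ, ∀ k x, |θ k x| ≤ C
  tendsto : ∀ x, Tendsto (fun k => θ k x) atTop
    (𝓝 ((ball (0 : Vec d) 1).indicator (fun _ => (1 : ℝ)) x))

/-- `lim_{r → 0+} lim_{k → ∞} lim_{n → ∞} a(r, k, n) = ℓ`, where the two inner limits exist
for all sufficiently small `r > 0`. -/
def HasIteratedLimit (a : ℝ → ℕ → ℕ → ℝ) (l : ℝ) : Prop :=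
  ∃ (b : ℝ → ℕ → ℝ) (c : ℝ → ℝ),
    (∀ᶠ r in 𝓝[>] (0 : ℝ), ∀ k, Tendsto (fun n => a r k n) atTop (𝓝 (b r k))) ∧
    (∀ᶠ r in 𝓝[>] (0 : ℝ), Tendsto (fun k => b r k) atTop (𝓝 (c r))) ∧
    Tendsto c (𝓝[>] (0 : ℝ)) (𝓝 l)

end FreeBoundary

end

open FreeBoundary

/-! ### Interior mollification of bounded scalar functions with bounded weak gradient. -/

noncomputable section

namespace FreeBoundary

variable {m d : ℕ}

/-! Fix `x₀` and a small `r`, and put `Φ = x₀ + r f_r`, `D = ∇f_r`. The gradient of `θ_k v_n^r` is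
`X + Y`, where `X = θ_k ∇v_n(Φ) D` and `Y = v_n^r ⊗ ∇θ_k` contains no gradient of `v_n`. Since `v_n
⇀ 0`, Rellich's theorem gives `Y → 0` in `L²` of the half-ball as `n → ∞`
(`BoundaryChart.tendsto_oscillation`). The products `α_n X` and `α_n Y` are only bounded, and `α_n`
need not be small, so `Y` is discarded by means of an estimate `|W°(X + Y) - W°(X)| ≤ ε|X|² + c|Y|²`
on bounded sets (`exists_perturbation_bound`, `tendsto_energy_difference`).

The energy of `X` is moved to `Ω` by a change of variables. The splitting `W° = U|A|² + ½(L A, A)`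
writes the new integrand as a function of `α_n ∇v_n` plus a function of `∇v_n/|∇v_n|`, both
multiplied by `|∇v_n|²` (`transported_add`). The first function is continuous because `U` vanishes
at `0` (`continuous_transported`). The cut-off makes both continuous on `closure Ω × ℝ^{m×d}` after
extension by zero (`BoundaryChart.continuousOn_localized`), so they are admissible in the
convergences that define the measures. This gives the limit in `n` as a pair of integrals against `π
⊗ μ` and `π ⊗ λ`. The limit in `k` is dominated convergence (`tendsto_integral_cutoff`). As `r → 0`
the map `D` tends to the identity and `x₀` is a Lebesgue point of both kernels, which leaves
integrals against `μ_{x₀}` and `λ_{x₀}` (`tendsto_average_transported`). The exceptional null set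
does not depend on `f_r` or `θ_k`, since the Lebesgue point property holds for all continuous test
functions at once (`ae_tendsto_average_kernel`).

Rellich's theorem is needed only on the half-ball, which is convex. There a function is compared
with its images under the homotheties with centre `z` in the set and ratio `1 - s`; averaging over
`z` produces integrals over fixed sets, which weak convergence sends to zero (`rellich_aux`).
Sobolev functions are handled by mollification throughout: each `v_n` and `∇v_n` is essentially
bounded, so uniform bounds and a.e. convergence of the approximants suffice. -/

/-- `g` is a distributional gradient of the scalar function `u` on `S`. -/
def HasWeakGrad (S : Set (Vec d)) (u : Vec d → ℝ) (g : Vec d → Vec d) : Prop :=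
  ∀ φ : Vec d → ℝ, ContDiff ℝ (⊤ : ℕ∞) φ → HasCompactSupport φ → tsupport φ ⊆ S →
    ∀ j : Fin d, ∫ x in S, u x * fderiv ℝ φ x (EuclideanSpace.single j 1) =
      -∫ x in S, g x j * φ x

open ContinuousLinearMap in
theorem norm_normed_convolution_le {E : Type*} [NormedAddCommGroup E] [NormedSpace ℝ E]
    (ρ : ContDiffBump (0 : Vec d)) {g : Vec d → E} {K : ℝ}
    (hK : ∀ x, ‖g x‖ ≤ K) (x : Vec d) :
    ‖convolution (ρ.normed volume) g (lsmul ℝ ℝ) volume x‖ ≤ K := by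
  have h1 : ∀ t, ‖ρ.normed volume t • g (x - t)‖ ≤ ρ.normed volume t * K := fun t => by
    rw [norm_smul, Real.norm_of_nonneg (ρ.nonneg_normed t)]
    exact mul_le_mul_of_nonneg_left (hK _) (ρ.nonneg_normed t)
  have h2 := norm_integral_le_of_norm_le (μ := volume)
    ((ρ.integrable_normed (μ := volume)).mul_const K) (Eventually.of_forall h1)
  rwa [integral_mul_const, ρ.integral_normed, one_mul] at h2

-- The function `t ↦ ρ(x - t)` is a legitimate test function as long as the ball of radius `rOut`
-- about `x` stays in `S`. Testing the weak gradient with it gives the derivative of the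
-- mollification, and the extension of `u` and `g` by zero is never seen.
open ContinuousLinearMap in
theorem fderiv_convolution_eq_of_hasWeakGrad {S : Set (Vec d)} (hS : IsOpen S)
    {u : Vec d → ℝ} {g : Vec d → Vec d} (h : HasWeakGrad S u g)
    (hu : LocallyIntegrable (S.indicator u)) (hg : LocallyIntegrable (S.indicator g))
    (ρ : ContDiffBump (0 : Vec d)) {x : Vec d} (hx : closedBall x ρ.rOut ⊆ S) (a : Vec d) :
    fderiv ℝ (convolution (ρ.normed volume) (S.indicator u) (lsmul ℝ ℝ) volume) x a =
      ⟪convolution (ρ.normed volume) (S.indicator g) (lsmul ℝ ℝ) volume x, a⟫_ℝ := by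
  have hρs : HasCompactSupport (ρ.normed volume) := ρ.hasCompactSupport_normed
  have hρc : ContDiff ℝ (⊤ : ℕ∞) (ρ.normed volume) := ρ.contDiff_normed
  have hρ1 : ContDiff ℝ 1 (ρ.normed volume) := ρ.contDiff_normed
  set φ : Vec d → ℝ := fun t => ρ.normed volume (x - t) with hφ
  have hφc : ContDiff ℝ (⊤ : ℕ∞) φ := hρc.comp (contDiff_const.sub contDiff_id)
  have hφt : tsupport φ ⊆ closedBall x ρ.rOut := by
    refine closure_minimal ?_ isClosed_closedBall
    intro t ht
    have : x - t ∈ Function.support (ρ.normed volume) := ht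
    rw [ρ.support_normed_eq, mem_ball_zero_iff] at this
    rw [mem_closedBall, dist_eq_norm, ← norm_neg, neg_sub]
    exact this.le
  have hφs : HasCompactSupport φ :=
    HasCompactSupport.of_support_subset_isCompact (isCompact_closedBall x ρ.rOut)
      (subset_closure.trans hφt)
  have hφd : ∀ t b, fderiv ℝ φ t b = - fderiv ℝ (ρ.normed volume) (x - t) b := by
    intro t b
    have h1 : HasFDerivAt φ ((fderiv ℝ (ρ.normed volume) (x - t)).comp
        (-(ContinuousLinearMap.id ℝ (Vec d)))) t := by
      refine HasFDerivAt.comp t (f := fun t => x - t)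
        ((hρ1.differentiable one_ne_zero) _).hasFDerivAt ?_
      exact (hasFDerivAt_id t).const_sub x
    rw [h1.fderiv]; simp
  have key : ∀ j : Fin d,
      fderiv ℝ (convolution (ρ.normed volume) (S.indicator u) (lsmul ℝ ℝ) volume) x
        (EuclideanSpace.single j 1) =
      (convolution (ρ.normed volume) (S.indicator g) (lsmul ℝ ℝ) volume x) j := by
    intro j
    have e1 : fderiv ℝ (convolution (ρ.normed volume) (S.indicator u) (lsmul ℝ ℝ) volume) x
        (EuclideanSpace.single j 1) =
        ∫ t in S, u t * fderiv ℝ (ρ.normed volume) (x - t) (EuclideanSpace.single j 1) := by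
      rw [← convolution_flip]
      rw [(hρs.hasFDerivAt_convolution_right _ hu hρ1 x).fderiv,
        convolution_precompR_apply _ hu (hρs.fderiv ℝ) (hρ1.continuous_fderiv one_ne_zero)]
      rw [convolution, ← integral_indicator hS.measurableSet]
      congr 1; ext t
      by_cases ht : t ∈ S <;> simp [ht, mul_comm]
    have e2 : (convolution (ρ.normed volume) (S.indicator g) (lsmul ℝ ℝ) volume x) j =
        ∫ t in S, g t j * φ t := by
      rw [← convolution_flip, convolution, ← integral_indicator hS.measurableSet]
      have hint : Integrable (fun t => ((lsmul ℝ ℝ).flip (S.indicator g t))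
          (ρ.normed volume (x - t))) volume :=
        (hρs.convolutionExists_right (lsmul ℝ ℝ).flip hg hρ1.continuous x)
      have := (EuclideanSpace.proj (𝕜 := ℝ) j : Vec d →L[ℝ] ℝ).integral_comp_comm hint
      simp only [EuclideanSpace.coe_proj] at this
      rw [← this]
      congr 1; ext t
      by_cases ht : t ∈ S <;> simp [ht, hφ, mul_comm]
    rw [e1, e2, ← neg_neg (∫ t in S, g t j * φ t), ← h φ hφc hφs (hφt.trans hx) j,
      ← integral_neg]
    congr 1; ext t; rw [hφd]; ring
  have ha : a = ∑ j, a j • EuclideanSpace.single j (1 : ℝ) := by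
    ext i; simp [Finset.sum_apply, Pi.single_apply]
  conv_lhs => rw [ha]
  rw [map_sum, PiLp.inner_apply]
  refine Finset.sum_congr rfl fun j _ => ?_
  rw [map_smul, key j]; simp

open ContinuousLinearMap in
/-- Interior smooth approximation of a bounded function with bounded weak gradient. -/
theorem HasWeakGrad.exists_approx {S : Set (Vec d)} (hS : IsOpen S) (hfin : volume S ≠ ∞)
    {u : Vec d → ℝ} {g : Vec d → Vec d} (h : HasWeakGrad S u g)
    (hum : AEStronglyMeasurable u (volume.restrict S))
    (hgm : AEStronglyMeasurable g (volume.restrict S)) {K R : ℝ} (hK0 : 0 ≤ K) (hR0 : 0 ≤ R)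
    (huK : ∀ᵐ x ∂(volume.restrict S), ‖u x‖ ≤ K) (hgR : ∀ᵐ x ∂(volume.restrict S), ‖g x‖ ≤ R) :
    ∃ (U : ℕ → Vec d → ℝ) (G : ℕ → Vec d → Vec d), (∀ k, ContDiff ℝ 1 (U k)) ∧
      (∀ k, Continuous (G k)) ∧ (∀ k x, ‖U k x‖ ≤ K) ∧ (∀ k x, ‖G k x‖ ≤ R) ∧
      (∀ᵐ x ∂(volume.restrict S), Tendsto (fun k => U k x) atTop (𝓝 (u x))) ∧
      (∀ᵐ x ∂(volume.restrict S), Tendsto (fun k => G k x) atTop (𝓝 (g x))) ∧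
      ∀ C ⊆ S, IsCompact C → ∀ᶠ k in atTop, ∀ x ∈ C, ∀ a,
        fderiv ℝ (U k) x a = ⟪G k x, a⟫_ℝ := by
  classical
  -- representatives which are bounded everywhere
  set P : Set (Vec d) := {x | ‖u x‖ ≤ K ∧ ‖g x‖ ≤ R} with hP
  set u' : Vec d → ℝ := fun x => if x ∈ P then u x else 0 with hu'
  set g' : Vec d → Vec d := fun x => if x ∈ P then g x else 0 with hg'
  have hPae : ∀ᵐ x ∂(volume.restrict S), x ∈ P := by
    filter_upwards [huK, hgR] with x h1 h2 using ⟨h1, h2⟩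
  have huu : u =ᵐ[volume.restrict S] u' := by
    filter_upwards [hPae] with x hx; simp [hu', hx]
  have hgg : g =ᵐ[volume.restrict S] g' := by
    filter_upwards [hPae] with x hx; simp [hg', hx]
  have hu'K : ∀ x, ‖u' x‖ ≤ K := fun x => by
    by_cases hx : x ∈ P
    · simpa [hu', hx] using hx.1
    · simpa [hu', hx] using hK0
  have hg'R : ∀ x, ‖g' x‖ ≤ R := fun x => by
    by_cases hx : x ∈ P
    · simpa [hg', hx] using hx.2
    · simpa [hg', hx] using hR0
  have h' : HasWeakGrad S u' g' := by
    intro φ h1 h2 h3 j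
    have e1 : ∫ x in S, u' x * fderiv ℝ φ x (EuclideanSpace.single j 1) =
        ∫ x in S, u x * fderiv ℝ φ x (EuclideanSpace.single j 1) := by
      refine integral_congr_ae ?_
      filter_upwards [huu] with x hx; rw [hx]
    have e2 : ∫ x in S, g' x j * φ x = ∫ x in S, g x j * φ x := by
      refine integral_congr_ae ?_
      filter_upwards [hgg] with x hx; rw [hx]
    rw [e1, e2, h φ h1 h2 h3 j]
  have hint : ∀ {E : Type} [NormedAddCommGroup E] {f : Vec d → E} {C : ℝ},
      AEStronglyMeasurable f (volume.restrict S) → (∀ x, ‖f x‖ ≤ C) →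
      LocallyIntegrable (S.indicator f) := by
    intro E _ f C hf hC
    have : IsFiniteMeasure (volume.restrict S) := isFiniteMeasure_restrict.2 hfin
    have : IntegrableOn f S := Integrable.of_bound hf C (Eventually.of_forall hC)
    exact (this.integrable_indicator hS.measurableSet).locallyIntegrable
  have hui : LocallyIntegrable (S.indicator u') := hint (hum.congr huu) hu'K
  have hgi : LocallyIntegrable (S.indicator g') := hint (hgm.congr hgg) hg'R
  -- The ratio `2` of outer to inner radius is fixed, as a.e. convergence of the mollifications at
  -- Lebesgue points requires it to be bounded.
  let ρ : ℕ → ContDiffBump (0 : Vec d) := fun k =>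
    ⟨1 / (k + 1 : ℝ), 2 * (1 / (k + 1 : ℝ)), by positivity, by
      have : 0 < 1 / (k + 1 : ℝ) := by positivity
      linarith⟩
  have hρ0 : Tendsto (fun k => (ρ k).rOut) atTop (𝓝 0) := by
    have := (tendsto_one_div_add_atTop_nhds_zero_nat (𝕜 := ℝ)).const_mul 2
    rwa [mul_zero] at this
  have hρr : ∀ᶠ k in atTop, (ρ k).rOut ≤ 2 * (ρ k).rIn := Eventually.of_forall fun k => le_rfl
  have hbu : ∀ x, ‖S.indicator u' x‖ ≤ K := fun x =>
    (norm_indicator_le_norm_self _ _).trans (hu'K x)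
  have hbg : ∀ x, ‖S.indicator g' x‖ ≤ R := fun x =>
    (norm_indicator_le_norm_self _ _).trans (hg'R x)
  refine ⟨fun k => convolution ((ρ k).normed volume) (S.indicator u') (lsmul ℝ ℝ) volume,
    fun k => convolution ((ρ k).normed volume) (S.indicator g') (lsmul ℝ ℝ) volume,
    fun k => ?_, fun k => ?_, fun k x => norm_normed_convolution_le _ hbu x,
    fun k x => norm_normed_convolution_le _ hbg x, ?_, ?_, ?_⟩
  · exact (ρ k).hasCompactSupport_normed.contDiff_convolution_left _ (n := 1)
      (ρ k).contDiff_normed hui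
  · exact (ρ k).hasCompactSupport_normed.continuous_convolution_left _
      (ρ k).continuous_normed hgi
  · have := ContDiffBump.ae_convolution_tendsto_right_of_locallyIntegrable hρ0 hρr hui
    filter_upwards [ae_restrict_of_ae this, ae_restrict_mem hS.measurableSet, huu]
      with x h1 h2 h3
    rwa [indicator_of_mem h2, ← h3] at h1
  · have := ContDiffBump.ae_convolution_tendsto_right_of_locallyIntegrable hρ0 hρr hgi
    filter_upwards [ae_restrict_of_ae this, ae_restrict_mem hS.measurableSet, hgg]
      with x h1 h2 h3
    rwa [indicator_of_mem h2, ← h3] at h1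
  · intro C hCS hC
    -- A compact subset of `S` has a closed neighbourhood of some radius `δ` inside `S`; the
    -- mollification is differentiable in the weak sense there once `rOut < δ`.
    obtain ⟨δ, hδ, hδS⟩ := hC.exists_cthickening_subset_open hS hCS
    filter_upwards [hρ0.eventually (gt_mem_nhds hδ)] with k hk x hx a
    refine fderiv_convolution_eq_of_hasWeakGrad hS h' hui hgi (ρ k) ?_ a
    refine (closedBall_subset_closedBall hk.le).trans ?_
    exact (closedBall_subset_cthickening hx δ).trans hδS

end FreeBoundary

end

/-! ### Change of variables and the chain rule for weak gradients under regular maps. -/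

noncomputable section

namespace FreeBoundary

variable {m d : ℕ}

/-- An injective `C¹` map between open sets with invertible derivative. -/
structure RegularMap (B S : Set (Vec d)) (Φ : Vec d → Vec d)
    (Φ' : Vec d → Vec d →L[ℝ] Vec d) : Prop where
  isOpen_source : IsOpen B
  isOpen_target : IsOpen S
  mapsTo : MapsTo Φ B S
  injOn : InjOn Φ B
  hasFDerivAt : ∀ x ∈ B, HasFDerivAt Φ (Φ' x) x
  continuousOn : ContinuousOn Φ' B
  det_ne : ∀ x ∈ B, (Φ' x).det ≠ 0

namespace RegularMap

variable {B S : Set (Vec d)} {Φ : Vec d → Vec d} {Φ' : Vec d → Vec d →L[ℝ] Vec d}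

theorem continuousOn_map (h : RegularMap B S Φ Φ') : ContinuousOn Φ B := fun x hx =>
  (h.hasFDerivAt x hx).continuousAt.continuousWithinAt

theorem aemeasurable (h : RegularMap B S Φ Φ') : AEMeasurable Φ (volume.restrict B) :=
  h.continuousOn_map.aemeasurable h.isOpen_source.measurableSet

/-- By the area formula `|det Φ'|` integrates to zero over the preimage of a null set, and it is
positive, so that preimage is null. This is what allows functions known only almost everywhere to be
composed with `Φ`. -/
theorem map_absolutelyContinuous (h : RegularMap B S Φ Φ') :
    (volume.restrict B).map Φ ≪ volume.restrict S := by
  refine Measure.AbsolutelyContinuous.mk fun N hN hN0 => ?_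
  rw [Measure.map_apply_of_aemeasurable h.aemeasurable hN]
  have hBm := h.isOpen_source.measurableSet
  -- `Φ` is only controlled on `B`, so the preimage is taken in the subtype `B` and pushed forward.
  have hBN : MeasurableSet (B ∩ Φ ⁻¹' N) := by
    have h1 : Measurable (B.domRestrict Φ) :=
      (continuousOn_iff_continuous_domRestrict.1 h.continuousOn_map).measurable
    have h2 := hBm.subtype_image (h1 hN)
    convert h2 using 1
    ext x
    simp only [mem_inter_iff, mem_preimage, mem_image, Subtype.exists, exists_and_right,
      exists_eq_right]
    exact ⟨fun ⟨a, b⟩ => ⟨a, b⟩, fun ⟨a, b⟩ => ⟨a, b⟩⟩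
  have h1 := lintegral_image_eq_lintegral_abs_det_fderiv_mul volume hBN
    (fun x hx => (h.hasFDerivAt x hx.1).hasFDerivWithinAt)
    (h.injOn.mono inter_subset_left) (fun _ => 1)
  have h2 : volume (Φ '' (B ∩ Φ ⁻¹' N)) = 0 := by
    refine measure_mono_null ?_ (by rwa [Measure.restrict_apply hN] at hN0 : volume (N ∩ S) = 0)
    rintro _ ⟨x, ⟨hx, hxN⟩, rfl⟩
    exact ⟨hxN, h.mapsTo hx⟩
  simp only [lintegral_const, one_mul, mul_one, Measure.restrict_apply MeasurableSet.univ,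
    univ_inter, h2] at h1
  have hm : AEMeasurable (fun x => ENNReal.ofReal |(Φ' x).det|)
      (volume.restrict (B ∩ Φ ⁻¹' N)) := by
    have : ContinuousOn (fun x => |(Φ' x).det|) (B ∩ Φ ⁻¹' N) :=
      (ContinuousLinearMap.continuous_det.comp_continuousOn
        (h.continuousOn.mono inter_subset_left)).abs
    exact (this.aemeasurable hBN).ennreal_ofReal
  have h3 := (lintegral_eq_zero_iff' hm).1 h1.symm
  have h4 : ∀ᵐ x ∂(volume.restrict (B ∩ Φ ⁻¹' N)), False := by
    filter_upwards [h3, ae_restrict_mem hBN] with x hx hxB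
    have : |(Φ' x).det| ≤ 0 := by simpa using hx
    exact h.det_ne x hxB.1 (abs_nonpos_iff.1 this)
  have h5 : volume.restrict (B ∩ Φ ⁻¹' N) = 0 := by
    rw [← ae_eq_bot]; exact (Filter.eventually_false_iff_eq_bot).1 h4
  rw [Measure.restrict_apply₀' hBm.nullMeasurableSet, inter_comm]
  exact Measure.restrict_eq_zero.1 h5

theorem ae_comp (h : RegularMap B S Φ Φ') {p : Vec d → Prop}
    (hp : ∀ᵐ y ∂(volume.restrict S), p y) : ∀ᵐ x ∂(volume.restrict B), p (Φ x) :=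
  ae_of_ae_map h.aemeasurable (h.map_absolutelyContinuous.ae_le hp)

theorem aestronglyMeasurable_comp (h : RegularMap B S Φ Φ') {E : Type*} [TopologicalSpace E]
    {u : Vec d → E} (hu : AEStronglyMeasurable u (volume.restrict S)) :
    AEStronglyMeasurable (fun x => u (Φ x)) (volume.restrict B) :=
  (hu.mono_ac h.map_absolutelyContinuous).comp_aemeasurable h.aemeasurable

theorem integral_eq (h : RegularMap B S Φ Φ') {γ : Vec d → Vec d}
    (hγ : ∀ x ∈ B, γ (Φ x) = x) (H : Vec d → ℝ) :
    ∫ x in B, H x = ∫ y in Φ '' B, |(Φ' (γ y)).det|⁻¹ * H (γ y) := by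
  rw [integral_image_eq_integral_abs_det_fderiv_smul volume h.isOpen_source.measurableSet
    (fun x hx => (h.hasFDerivAt x hx).hasFDerivWithinAt) h.injOn]
  refine setIntegral_congr_fun h.isOpen_source.measurableSet fun x hx => ?_
  have := abs_pos.2 (h.det_ne x hx)
  simp only [hγ x hx, smul_eq_mul]
  field_simp

/-- A `C¹` map is strictly differentiable, so the inverse function theorem applies at every point of
`B`. -/
theorem isOpen_image (h : RegularMap B S Φ Φ') : IsOpen (Φ '' B) := by
  rw [isOpen_iff_mem_nhds]
  rintro _ ⟨x, hx, rfl⟩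
  have hs : HasStrictFDerivAt Φ (Φ' x) x := by
    refine hasStrictFDerivAt_of_hasFDerivAt_of_continuousAt (f' := Φ') ?_
      (h.continuousOn.continuousAt (h.isOpen_source.mem_nhds hx))
    filter_upwards [h.isOpen_source.mem_nhds hx] with z hz using h.hasFDerivAt z hz
  let e := (Φ' x).toContinuousLinearEquivOfDetNeZero (h.det_ne x hx)
  have hs' : HasStrictFDerivAt Φ (e : Vec d →L[ℝ] Vec d) x := by
    convert hs using 1
    ext v; simp [e]
  rw [← hs'.map_nhds_eq_of_equiv]
  exact image_mem_map (h.isOpen_source.mem_nhds hx)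

/-- The chain rule is classical for the mollifications of `u`, and integration by parts takes place
on the whole space because the test function vanishes off a compact subset of `B`. Absolute
continuity of the image measure carries a.e. convergence over to `B`, and dominated convergence
passes to the limit on both sides. -/
theorem hasWeakGrad_comp (h : RegularMap B S Φ Φ') (hfin : volume S ≠ ∞) {c : ℝ}
    (hc : ∀ x ∈ B, ‖Φ' x‖ ≤ c)
    {u : Vec d → ℝ} {g : Vec d → Vec d} (hug : HasWeakGrad S u g)
    (hum : AEStronglyMeasurable u (volume.restrict S))
    (hgm : AEStronglyMeasurable g (volume.restrict S)) {K R : ℝ} (hK0 : 0 ≤ K) (hR0 : 0 ≤ R)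
    (huK : ∀ᵐ x ∂(volume.restrict S), ‖u x‖ ≤ K) (hgR : ∀ᵐ x ∂(volume.restrict S), ‖g x‖ ≤ R) :
    HasWeakGrad B (fun x => u (Φ x)) (fun x => (Φ' x).adjoint (g (Φ x))) := by
  obtain ⟨U, G, hU, hG, hUK, hGR, hUu, hGg, hUG⟩ :=
    hug.exists_approx h.isOpen_target hfin hum hgm hK0 hR0 huK hgR
  intro φ hφ hφs hφB j
  set e : Vec d := EuclideanSpace.single j 1
  have hBm := h.isOpen_source.measurableSet
  have hφ1 : ContDiff ℝ 1 φ := hφ.of_le (by exact_mod_cast le_top)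
  have hdφ : Continuous fun x => fderiv ℝ φ x e :=
    (hφ1.continuous_fderiv one_ne_zero).clm_apply continuous_const
  have hdφs : HasCompactSupport fun x => fderiv ℝ φ x e := hφs.fderiv_apply (𝕜 := ℝ) e
  have hdφ0 : ∀ x, x ∉ tsupport φ → fderiv ℝ φ x e = 0 := fun x hx => by
    have := image_eq_zero_of_notMem_tsupport (f := fderiv ℝ φ)
      (fun hx' => hx (tsupport_fderiv_subset ℝ hx'))
    simp [this]
  have hφ0 : ∀ x, x ∉ tsupport φ → φ x = 0 := fun x hx => image_eq_zero_of_notMem_tsupport hx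
  have hΦG : ContinuousOn (fun x => Φ' x e) B := h.continuousOn.clm_apply continuousOn_const
  have hev : ∀ᶠ k in atTop, ∫ x in B, U k (Φ x) * fderiv ℝ φ x e =
      -∫ x in B, ⟪G k (Φ x), Φ' x e⟫_ℝ * φ x := by
    -- The approximants have gradient `G k` only on compact subsets of `S` and for large `k`; the
    -- compact set that matters is the image of the support of `φ`.
    filter_upwards [hUG (Φ '' tsupport φ) ((image_mono hφB).trans h.mapsTo.image_subset)
      (hφs.isCompact.image_of_continuousOn (h.continuousOn_map.mono hφB))] with k hk
    have hUd : ∀ x ∈ B, HasFDerivAt (fun x => U k (Φ x))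
        ((fderiv ℝ (U k) (Φ x)).comp (Φ' x)) x := fun x hx =>
      HasFDerivAt.comp x ((hU k).differentiable one_ne_zero _).hasFDerivAt (h.hasFDerivAt x hx)
    have hint : ∀ f : Vec d → ℝ, ContinuousOn f B → (∀ x, x ∉ tsupport φ → f x = 0) →
        Integrable f := by
      intro f hf hf0
      rw [← integrableOn_iff_integrable_of_support_subset (s := tsupport φ)]
      · exact (hf.mono hφB).integrableOn_compact hφs
      · intro x hx; by_contra hx'; exact hx (hf0 x hx')
    have hUc : ContinuousOn (fun x => U k (Φ x)) B :=
      (hU k).continuous.comp_continuousOn h.continuousOn_map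
    have hDc : ContinuousOn (fun x => fderiv ℝ (U k) (Φ x) (Φ' x e)) B :=
      (((hU k).continuous_fderiv one_ne_zero).comp_continuousOn h.continuousOn_map).clm_apply hΦG
    have ibp := integral_bilinear_hasFDerivAt_right_eq_neg_left_of_integrable
      (μ := (volume : Measure (Vec d))) (f := fun x => U k (Φ x))
      (f' := fun x => (fderiv ℝ (U k) (Φ x)).comp (Φ' x)) (g := φ) (g' := fderiv ℝ φ) (v := e)
      (B := ContinuousLinearMap.mul ℝ ℝ)
      (hint _ (hDc.mul hφ.continuous.continuousOn) fun x hx => by simp [hφ0 x hx])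
      (hint _ (hUc.mul hdφ.continuousOn) fun x hx => by simp [hdφ0 x hx])
      (hint _ (hUc.mul hφ.continuous.continuousOn) fun x hx => by simp [hφ0 x hx])
      (fun x hx => hUd x (hφB hx))
      (fun x _ => ((hφ1.differentiable one_ne_zero) x).hasFDerivAt)
    simp only [ContinuousLinearMap.mul_apply', ContinuousLinearMap.comp_apply] at ibp
    rw [setIntegral_eq_integral_of_forall_compl_eq_zero fun x hx => by
        rw [hdφ0 x fun hx' => hx (hφB hx'), mul_zero],
      setIntegral_eq_integral_of_forall_compl_eq_zero fun x hx => by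
        rw [hφ0 x fun hx' => hx (hφB hx'), mul_zero], ibp]
    congr 1
    refine integral_congr_ae (Eventually.of_forall fun x => ?_)
    by_cases hx : x ∈ tsupport φ
    · simp only [hk _ (mem_image_of_mem Φ hx)]
    · simp [hφ0 x hx]
  have hL : Tendsto (fun k => ∫ x in B, U k (Φ x) * fderiv ℝ φ x e) atTop
      (𝓝 (∫ x in B, u (Φ x) * fderiv ℝ φ x e)) := by
    refine tendsto_integral_of_dominated_convergence (fun x => K * ‖fderiv ℝ φ x e‖)
      (fun k => ?_) ?_ (fun k => Eventually.of_forall fun x => ?_) ?_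
    · exact ((hU k).continuous.comp_aestronglyMeasurable
        h.aemeasurable.aestronglyMeasurable).mul hdφ.aestronglyMeasurable
    · exact ((hdφ.integrable_of_hasCompactSupport hdφs).norm.const_mul K).integrableOn
    · rw [norm_mul]; exact mul_le_mul_of_nonneg_right (hUK k _) (norm_nonneg _)
    · filter_upwards [h.ae_comp hUu] with x hx using hx.mul_const _
  have hR' : Tendsto (fun k => ∫ x in B, ⟪G k (Φ x), Φ' x e⟫_ℝ * φ x) atTop
      (𝓝 (∫ x in B, ⟪g (Φ x), Φ' x e⟫_ℝ * φ x)) := by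
    refine tendsto_integral_of_dominated_convergence (fun x => R * (c * ‖e‖) * ‖φ x‖)
      (fun k => ?_) ?_ (fun k => ?_) ?_
    · exact (((hG k).comp_aestronglyMeasurable
        h.aemeasurable.aestronglyMeasurable).inner (hΦG.aestronglyMeasurable hBm)).mul
        hφ.continuous.aestronglyMeasurable
    · exact ((hφ.continuous.integrable_of_hasCompactSupport hφs).norm.const_mul _).integrableOn
    · filter_upwards [ae_restrict_mem hBm] with x hx
      rw [norm_mul]
      refine mul_le_mul_of_nonneg_right ?_ (norm_nonneg _)
      refine (norm_inner_le_norm _ _).trans (mul_le_mul (hGR k _) ?_ (norm_nonneg _) hR0)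
      exact ((Φ' x).le_opNorm e).trans (mul_le_mul_of_nonneg_right (hc x hx) (norm_nonneg _))
    · filter_upwards [h.ae_comp hGg] with x hx using (hx.inner tendsto_const_nhds).mul_const _
  have := tendsto_nhds_unique (hL.congr' hev) hR'.neg
  rw [this]
  congr 1
  refine integral_congr_ae (Eventually.of_forall fun x => ?_)
  have : (Φ' x).adjoint (g (Φ x)) j = ⟪g (Φ x), Φ' x e⟫_ℝ := by
    rw [← ContinuousLinearMap.adjoint_inner_left, EuclideanSpace.inner_single_right]; simp
  simp only [this]

end RegularMap

end FreeBoundary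

end

/-! ### Homotheties of a convex set and their effect on Sobolev functions. -/

noncomputable section

namespace FreeBoundary

variable {m d : ℕ}

theorem det_smul_vec (c : ℝ) (A : Vec d →L[ℝ] Vec d) : (c • A).det = c ^ d * A.det := by
  change LinearMap.det (c • (A : Vec d →ₗ[ℝ] Vec d)) = c ^ d * LinearMap.det (A : Vec d →ₗ[ℝ] Vec d)
  rw [LinearMap.det_smul, finrank_euclideanSpace_fin]

theorem det_smul_id (c : ℝ) : (c • ContinuousLinearMap.id ℝ (Vec d)).det = c ^ d := by
  rw [det_smul_vec]
  change c ^ d * LinearMap.det (LinearMap.id : Vec d →ₗ[ℝ] Vec d) = c ^ d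
  rw [LinearMap.det_id, mul_one]

/-- The homothety of centre `z` and ratio `1 - s` as a regular self-map of a convex set. -/
theorem regularMap_contraction {C : Set (Vec d)} (hC : IsOpen C) (hconv : Convex ℝ C) {z : Vec d}
    (hz : z ∈ C) {s : ℝ} (h0 : 0 ≤ s) (h1 : s < 1) :
    RegularMap C C (fun x => (1 - s) • x + s • z)
      (fun _ => (1 - s) • ContinuousLinearMap.id ℝ (Vec d)) where
  isOpen_source := hC
  isOpen_target := hC
  mapsTo x hx := hconv hx hz (by linarith) h0 (by ring)
  injOn x _ y _ hxy := by
    have : (1 - s) • x = (1 - s) • y := by simpa using hxy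
    exact smul_right_injective _ (by linarith : (1 - s) ≠ 0) this
  hasFDerivAt x _ := by
    simpa using ((hasFDerivAt_id x).const_smul (1 - s)).add_const (s • z)
  continuousOn := continuousOn_const
  det_ne x _ := by rw [det_smul_id]; exact pow_ne_zero _ (by linarith)

/-- The image of `C` stays in `C` by convexity and the Jacobian is `(1 - s)^d ≥ 2^{-d}`; the
constant is therefore uniform in `s ≤ 1/2`. -/
theorem lintegral_contraction_le {C : Set (Vec d)} (hC : IsOpen C) (hconv : Convex ℝ C)
    {z : Vec d} (hz : z ∈ C) {s : ℝ} (h0 : 0 ≤ s) (h1 : s ≤ 1 / 2) (f : Vec d → ℝ≥0∞) :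
    ∫⁻ x in C, f ((1 - s) • x + s • z) ≤ ENNReal.ofReal (2 ^ d) * ∫⁻ x in C, f x := by
  have h := regularMap_contraction hC hconv hz h0 (by linarith : s < 1)
  have e := lintegral_image_eq_lintegral_abs_det_fderiv_mul volume hC.measurableSet
    (fun x hx => (h.hasFDerivAt x hx).hasFDerivWithinAt) h.injOn f
  simp only [det_smul_id] at e
  have hs : 0 < 1 - s := by linarith
  rw [lintegral_const_mul' _ _ ENNReal.ofReal_ne_top, abs_of_pos (pow_pos hs d)] at e
  have hle : ∫⁻ x in (fun x => (1 - s) • x + s • z) '' C, f x ≤ ∫⁻ x in C, f x :=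
    lintegral_mono_set h.mapsTo.image_subset
  rw [e] at hle
  calc ∫⁻ x in C, f ((1 - s) • x + s • z)
      ≤ ENNReal.ofReal (2 ^ d * (1 - s) ^ d) * ∫⁻ x in C, f ((1 - s) • x + s • z) := by
        refine le_mul_of_one_le_left zero_le ?_
        rw [ENNReal.one_le_ofReal, ← mul_pow]
        exact one_le_pow₀ (by linarith)
    _ = ENNReal.ofReal (2 ^ d) *
        (ENNReal.ofReal ((1 - s) ^ d) * ∫⁻ x in C, f ((1 - s) • x + s • z)) := by
        rw [ENNReal.ofReal_mul (by positivity), mul_assoc]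
    _ ≤ _ := mul_le_mul_right hle _

/-- Cauchy-Schwarz, in the form that the variance of `a` about its mean `A / s` is nonnegative. -/
theorem sq_intervalIntegral_le {a : ℝ → ℝ} (ha : Continuous a) {s : ℝ} (hs : 0 < s) :
    (∫ t in (0 : ℝ)..s, a t) ^ 2 ≤ s * ∫ t in (0 : ℝ)..s, a t ^ 2 := by
  set A := ∫ t in (0 : ℝ)..s, a t
  have h0 : 0 ≤ ∫ t in (0 : ℝ)..s, (a t - A / s) ^ 2 :=
    intervalIntegral.integral_nonneg hs.le fun t _ => sq_nonneg _
  have h1 : ∫ t in (0 : ℝ)..s, (a t - A / s) ^ 2 =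
      (∫ t in (0 : ℝ)..s, a t ^ 2) - A ^ 2 / s := by
    have : ∀ t, (a t - A / s) ^ 2 = a t ^ 2 - (2 * A / s) * a t + (A / s) ^ 2 := fun t => by ring
    simp only [this]
    rw [intervalIntegral.integral_add, intervalIntegral.integral_sub,
      intervalIntegral.integral_const_mul, intervalIntegral.integral_const]
    · simp only [sub_zero, smul_eq_mul]
      field_simp
      ring
    all_goals exact Continuous.intervalIntegrable (by fun_prop) _ _
  rw [h1, sub_nonneg, div_le_iff₀ hs] at h0
  linarith

/-- The difference between a Sobolev function on a convex set and its image under a contraction. -/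
theorem HasWeakGrad.lintegral_sub_contraction_le {C : Set (Vec d)} (hC : IsOpen C)
    (hconv : Convex ℝ C) (hfin : volume C ≠ ∞) {D : ℝ} (hD : ∀ x ∈ C, ∀ z ∈ C, ‖z - x‖ ≤ D)
    {w : Vec d → ℝ} {g : Vec d → Vec d} (hwg : HasWeakGrad C w g)
    (hwm : AEStronglyMeasurable w (volume.restrict C))
    (hgm : AEStronglyMeasurable g (volume.restrict C)) {K R : ℝ} (hK0 : 0 ≤ K) (hR0 : 0 ≤ R)
    (hwK : ∀ᵐ x ∂(volume.restrict C), ‖w x‖ ≤ K) (hgR : ∀ᵐ x ∂(volume.restrict C), ‖g x‖ ≤ R)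
    {z : Vec d} (hz : z ∈ C) {s : ℝ} (h0 : 0 < s) (h1 : s ≤ 1 / 2) :
    ∫⁻ x in C, ENNReal.ofReal ((w x - w ((1 - s) • x + s • z)) ^ 2) ≤
      ENNReal.ofReal (s ^ 2 * D ^ 2 * 2 ^ d) * ∫⁻ x in C, ENNReal.ofReal (‖g x‖ ^ 2) := by
  obtain ⟨U, G, hU, hG, hUK, hGR, hUw, hGg, hUG⟩ :=
    hwg.exists_approx hC hfin hwm hgm hK0 hR0 hwK hgR
  have hfm : IsFiniteMeasure (volume.restrict C) := isFiniteMeasure_restrict.2 hfin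
  have hD0 : 0 ≤ D := (norm_nonneg _).trans (hD z hz z hz)
  have hτ := regularMap_contraction hC hconv hz h0.le (by linarith : s < 1)
  -- The fundamental theorem of calculus along the segment from `x` towards `z`, followed by
  -- Cauchy-Schwarz in `t`, bounds the squared difference of the approximants by `b k x`.
  set b : ℕ → Vec d → ℝ≥0∞ := fun k x => ENNReal.ofReal (s * D ^ 2) *
    ∫⁻ t in Ioc 0 s, ENNReal.ofReal (‖G k ((1 - t) • x + t • z)‖ ^ 2) with hb
  -- the pointwise estimate for the approximations
  have hpt : ∀ x ∈ C, ∀ᶠ k in atTop,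
      ENNReal.ofReal ((U k x - U k ((1 - s) • x + s • z)) ^ 2) ≤ b k x := by
    intro x hx
    have hseg : segment ℝ x z ⊆ C := hconv.segment_subset hx hz
    filter_upwards [hUG _ hseg (by
      rw [segment_eq_image]
      exact isCompact_Icc.image (by fun_prop))] with k hk
    have hline : ∀ t : ℝ, HasDerivAt (fun t : ℝ => (1 - t) • x + t • z) (z - x) t := by
      intro t
      have := (((hasDerivAt_id' t).const_sub 1).smul_const x).add
        ((hasDerivAt_id' t).smul_const z)
      exact this.congr_deriv (by module)
    have hcont : Continuous fun t : ℝ => (1 - t) • x + t • z := by fun_prop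
    have hder : ∀ t ∈ uIcc 0 s, HasDerivAt (fun t : ℝ => U k ((1 - t) • x + t • z))
        ⟪G k ((1 - t) • x + t • z), z - x⟫_ℝ t := by
      intro t ht
      rw [uIcc_of_le h0.le] at ht
      have hmem : (1 - t) • x + t • z ∈ segment ℝ x z :=
        ⟨1 - t, t, by linarith [ht.2], ht.1, by ring, rfl⟩
      rw [← hk _ hmem]
      exact ((hU k).differentiable one_ne_zero _).hasFDerivAt.comp_hasDerivAt t (hline t)
    have hFTC := intervalIntegral.integral_eq_sub_of_hasDerivAt hder
      (Continuous.intervalIntegrable (((hG k).comp hcont).inner continuous_const) _ _)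
    simp only [sub_zero, one_smul, zero_smul, add_zero] at hFTC
    have hGc : Continuous fun t : ℝ => ‖G k ((1 - t) • x + t • z)‖ := ((hG k).comp hcont).norm
    have habs : |U k ((1 - s) • x + s • z) - U k x| ≤
        D * ∫ t in (0 : ℝ)..s, ‖G k ((1 - t) • x + t • z)‖ := by
      rw [← hFTC, ← intervalIntegral.integral_const_mul]
      refine (intervalIntegral.abs_integral_le_integral_abs h0.le).trans ?_
      refine intervalIntegral.integral_mono_on h0.le
        ((((hG k).comp hcont).inner continuous_const).abs.intervalIntegrable _ _)
        ((hGc.const_mul D).intervalIntegrable _ _) fun t _ => ?_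
      refine (abs_real_inner_le_norm _ _).trans ?_
      rw [mul_comm]
      exact mul_le_mul_of_nonneg_right (hD x hx z hz) (norm_nonneg _)
    have hsq : (U k x - U k ((1 - s) • x + s • z)) ^ 2 ≤
        s * D ^ 2 * ∫ t in (0 : ℝ)..s, ‖G k ((1 - t) • x + t • z)‖ ^ 2 := by
      calc (U k x - U k ((1 - s) • x + s • z)) ^ 2
          = |U k ((1 - s) • x + s • z) - U k x| ^ 2 := by rw [sq_abs]; ring
        _ ≤ (D * ∫ t in (0 : ℝ)..s, ‖G k ((1 - t) • x + t • z)‖) ^ 2 :=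
            pow_le_pow_left₀ (abs_nonneg _) habs 2
        _ = D ^ 2 * (∫ t in (0 : ℝ)..s, ‖G k ((1 - t) • x + t • z)‖) ^ 2 := by ring
        _ ≤ D ^ 2 * (s * ∫ t in (0 : ℝ)..s, ‖G k ((1 - t) • x + t • z)‖ ^ 2) :=
            mul_le_mul_of_nonneg_left (sq_intervalIntegral_le hGc h0) (sq_nonneg _)
        _ = _ := by ring
    refine (ENNReal.ofReal_le_ofReal hsq).trans (le_of_eq ?_)
    rw [ENNReal.ofReal_mul (by positivity), intervalIntegral.integral_of_le h0.le,
      ofReal_integral_eq_lintegral_ofReal]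
    · exact (((hGc.pow 2).integrableOn_Icc).mono_set Ioc_subset_Icc_self)
    · exact Eventually.of_forall fun t => by positivity
  have hbm : ∀ k, Measurable (Function.uncurry fun (x : Vec d) (t : ℝ) =>
      ENNReal.ofReal (‖G k ((1 - t) • x + t • z)‖ ^ 2)) := by
    intro k
    have : Continuous (Function.uncurry fun (x : Vec d) (t : ℝ) =>
        ‖G k ((1 - t) • x + t • z)‖ ^ 2) := by
      have := hG k
      simp only [Function.uncurry_def]
      fun_prop
    exact this.measurable.ennreal_ofReal
  have hble : ∀ k, ∫⁻ x in C, b k x ≤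
      ENNReal.ofReal (s ^ 2 * D ^ 2 * 2 ^ d) * ∫⁻ x in C, ENNReal.ofReal (‖G k x‖ ^ 2) := by
    intro k
    rw [lintegral_const_mul' _ _ ENNReal.ofReal_ne_top,
      lintegral_lintegral_swap (hbm k).aemeasurable]
    calc ENNReal.ofReal (s * D ^ 2) * ∫⁻ t in Ioc 0 s, ∫⁻ x in C,
          ENNReal.ofReal (‖G k ((1 - t) • x + t • z)‖ ^ 2)
        ≤ ENNReal.ofReal (s * D ^ 2) * ∫⁻ t in Ioc 0 s, ENNReal.ofReal (2 ^ d) *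
          ∫⁻ x in C, ENNReal.ofReal (‖G k x‖ ^ 2) := by
          refine mul_le_mul_right (setLIntegral_mono' measurableSet_Ioc fun t ht => ?_) _
          exact lintegral_contraction_le hC hconv hz ht.1.le (ht.2.trans h1)
            (fun x => ENNReal.ofReal (‖G k x‖ ^ 2))
      _ = _ := by
          rw [setLIntegral_const, Real.volume_Ioc, sub_zero,
            show s ^ 2 * D ^ 2 * 2 ^ d = (s * D ^ 2) * (2 ^ d * s) by ring,
            ENNReal.ofReal_mul (p := s * D ^ 2) (by positivity),
            ENNReal.ofReal_mul (p := 2 ^ d) (by positivity)]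
          ring
  have hlim : Tendsto (fun k => ∫⁻ x in C, ENNReal.ofReal (‖G k x‖ ^ 2)) atTop
      (𝓝 (∫⁻ x in C, ENNReal.ofReal (‖g x‖ ^ 2))) := by
    refine tendsto_lintegral_of_dominated_convergence (fun _ => ENNReal.ofReal (R ^ 2))
      (fun k => ((hG k).norm.pow 2).measurable.ennreal_ofReal) (fun k => ?_) ?_ ?_
    · exact Eventually.of_forall fun x => ENNReal.ofReal_le_ofReal
        (pow_le_pow_left₀ (norm_nonneg _) (hGR k x) 2)
    · simp only [lintegral_const]
      exact ENNReal.mul_ne_top ENNReal.ofReal_ne_top (measure_ne_top _ _)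
    · filter_upwards [hGg] with x hx
      exact (ENNReal.continuous_ofReal.tendsto _).comp (hx.norm.pow 2)
  -- The index from which the estimate by `b k x` holds depends on the segment, hence on `x`.
  -- Comparing with the lower limit and applying Fatou's lemma makes uniformity unnecessary.
  calc ∫⁻ x in C, ENNReal.ofReal ((w x - w ((1 - s) • x + s • z)) ^ 2)
      ≤ ∫⁻ x in C, liminf (fun k => b k x) atTop := by
        refine lintegral_mono_ae ?_
        filter_upwards [hUw, hτ.ae_comp hUw, ae_restrict_mem hC.measurableSet] with x h2 h3 h4
        have : Tendsto (fun k => ENNReal.ofReal ((U k x - U k ((1 - s) • x + s • z)) ^ 2)) atTop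
            (𝓝 (ENNReal.ofReal ((w x - w ((1 - s) • x + s • z)) ^ 2))) :=
          (ENNReal.continuous_ofReal.tendsto _).comp ((h2.sub h3).pow 2)
        rw [← this.liminf_eq]
        exact liminf_le_liminf (hpt x h4)
    _ ≤ liminf (fun k => ∫⁻ x in C, b k x) atTop :=
        lintegral_liminf_le fun k => (Measurable.lintegral_prod_right (hbm k)).const_mul _
    _ ≤ liminf (fun k => ENNReal.ofReal (s ^ 2 * D ^ 2 * 2 ^ d) *
          ∫⁻ x in C, ENNReal.ofReal (‖G k x‖ ^ 2)) atTop :=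
        liminf_le_liminf (Eventually.of_forall hble)
    _ = _ := (ENNReal.Tendsto.const_mul hlim (Or.inr ENNReal.ofReal_ne_top)).liminf_eq

end FreeBoundary

end

/-! ### Rellich's theorem on bounded convex open sets. -/

noncomputable section

namespace FreeBoundary

variable {m d : ℕ}

/-- Here the centre `z` is the variable, and the map is a homothety of ratio `s`. For fixed `x` and
`s` the average over centres is an integral over a fixed set, a quantity controlled by weak
convergence. -/
theorem average_contraction_eq {C : Set (Vec d)} (hC : IsOpen C) {x : Vec d} (w : Vec d → ℝ)
    {s : ℝ} (h0 : 0 < s) :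
    ∫ z in C, w ((1 - s) • x + s • z) =
      (s ^ d)⁻¹ * ∫ y in (fun z => (1 - s) • x + s • z) '' C, w y := by
  have hd : ∀ z ∈ C, HasFDerivWithinAt (fun z => (1 - s) • x + s • z)
      (s • ContinuousLinearMap.id ℝ (Vec d)) C z := fun z _ => by
    simpa using (((hasFDerivAt_id z).const_smul s).const_add ((1 - s) • x)).hasFDerivWithinAt
  have hi : InjOn (fun z : Vec d => (1 - s) • x + s • z) C := fun a _ b _ hab => by
    have : s • a = s • b := by simpa using hab
    exact smul_right_injective _ h0.ne' this
  rw [integral_image_eq_integral_abs_det_fderiv_smul volume hC.measurableSet hd hi]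
  simp only [det_smul_id, smul_eq_mul, abs_of_pos (pow_pos h0 d)]
  rw [integral_const_mul, ← mul_assoc, inv_mul_cancel₀ (pow_pos h0 d).ne', one_mul]

-- Composition with the homothety of centre `z` and ratio `1 - s` moves `w n` by `O(s)` in `L²`,
-- uniformly in `n` and `z`, so `⟨w, w ∘ τ_z⟩ ≥ ‖w‖² - s c`. Averaging over `z` gives `V ‖w‖² ≤ V s
-- c + ⟨w, I⟩`, where `I` is the integral of `w ∘ τ_z` over the centres. For fixed `s` these `I`
-- tend to zero pointwise, by weak convergence, and boundedly, hence in `L²`. Choosing `s` first and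
-- `n` afterwards finishes the argument without extracting subsequences.
open scoped Pointwise in
theorem rellich_aux {C : Set (Vec d)} (hC : IsOpen C) (hconv : Convex ℝ C)
    (hne : C.Nonempty) (hfin : volume C ≠ ∞) {D : ℝ} (hD : ∀ x ∈ C, ∀ z ∈ C, ‖z - x‖ ≤ D)
    {w : ℕ → Vec d → ℝ} {g : ℕ → Vec d → Vec d} (hwg : ∀ n, HasWeakGrad C (w n) (g n))
    (hwm : ∀ n, StronglyMeasurable (w n))
    (hgm : ∀ n, AEStronglyMeasurable (g n) (volume.restrict C))
    (hwK : ∀ n, ∃ K : ℝ, 0 ≤ K ∧ ∀ x, ‖w n x‖ ≤ K)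
    (hgR : ∀ n, ∃ R : ℝ, 0 ≤ R ∧ ∀ᵐ x ∂(volume.restrict C), ‖g n x‖ ≤ R)
    {A M : ℝ} (hA : ∀ n, ∫ x in C, ‖g n x‖ ^ 2 ≤ A) (hM : ∀ n, ∫ x in C, w n x ^ 2 ≤ M)
    (hnull : ∀ E ⊆ C, MeasurableSet E → Tendsto (fun n => ∫ x in E, w n x) atTop (𝓝 0)) :
    Tendsto (fun n => ∫ x in C, w n x ^ 2) atTop (𝓝 0) := by
  have hfm : IsFiniteMeasure (volume.restrict C) := isFiniteMeasure_restrict.2 hfin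
  have hbdd : ∀ {f : Vec d → ℝ} {k : ℝ}, StronglyMeasurable f → (∀ x, ‖f x‖ ≤ k) →
      Integrable f (volume.restrict C) := fun hf hk =>
    Integrable.of_bound hf.aestronglyMeasurable _ (Eventually.of_forall hk)
  have hwint : ∀ n, Integrable (w n) (volume.restrict C) := fun n => by
    obtain ⟨K, _, hK⟩ := hwK n
    exact hbdd (hwm n) hK
  have hw2int : ∀ n, Integrable (fun x => w n x ^ 2) (volume.restrict C) := fun n => by
    obtain ⟨K, _, hK⟩ := hwK n
    refine hbdd ((hwm n).pow 2) (k := K ^ 2) fun x => ?_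
    rw [norm_pow]; exact pow_le_pow_left₀ (norm_nonneg _) (hK x) 2
  set V : ℝ := volume.real C with hV
  have hVpos : 0 < V := by
    rw [hV, Measure.real]
    exact ENNReal.toReal_pos (hC.measure_pos volume hne).ne' hfin
  have hM0 : 0 ≤ M := (integral_nonneg fun x => sq_nonneg _).trans (hM 0)
  have hA0 : 0 ≤ A := (integral_nonneg fun x => sq_nonneg _).trans (hA 0)
  -- Young's inequality with weight `s` yields the error `(s/2) M + (2s)⁻¹ s² D² 2^d A`, which is `s
  -- * c`.
  set c : ℝ := (M + D ^ 2 * 2 ^ d * A) / 2 with hc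
  set I : ℝ → ℕ → Vec d → ℝ := fun s n x => ∫ z in C, w n ((1 - s) • x + s • z) with hI
  -- Cauchy-Schwarz for one contraction
  have hdiff : ∀ n, ∀ s : ℝ, 0 < s → s ≤ 1 / 2 → ∀ z ∈ C,
      (∫ x in C, w n x ^ 2) - s * c ≤ ∫ x in C, w n x * w n ((1 - s) • x + s • z) := by
    intro n s h0 h1 z hz
    obtain ⟨K, hK0, hK⟩ := hwK n
    obtain ⟨R, hR0, hR⟩ := hgR n
    have hτm : Measurable fun x : Vec d => (1 - s) • x + s • z := by fun_prop
    have hwτm : StronglyMeasurable fun x => w n ((1 - s) • x + s • z) :=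
      (hwm n).comp_measurable hτm
    have hsq : Integrable (fun x => (w n x - w n ((1 - s) • x + s • z)) ^ 2)
        (volume.restrict C) := by
      refine hbdd (((hwm n).sub hwτm).pow 2) (k := (K + K) ^ 2) fun x => ?_
      rw [norm_pow]
      exact pow_le_pow_left₀ (norm_nonneg _)
        ((norm_sub_le _ _).trans (add_le_add (hK _) (hK _))) 2
    have hgint : Integrable (fun x => ‖g n x‖ ^ 2) (volume.restrict C) := by
      refine Integrable.of_bound ((hgm n).norm.pow 2) (R ^ 2) ?_
      filter_upwards [hR] with x hx
      rw [norm_pow, norm_norm]; exact pow_le_pow_left₀ (norm_nonneg _) hx 2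
    have hL : ∫ x in C, (w n x - w n ((1 - s) • x + s • z)) ^ 2 ≤
        s ^ 2 * D ^ 2 * 2 ^ d * A := by
      have hlin := (hwg n).lintegral_sub_contraction_le hC hconv hfin hD
        (hwm n).aestronglyMeasurable (hgm n) hK0 hR0 (Eventually.of_forall hK) hR hz h0 h1
      rw [← ofReal_integral_eq_lintegral_ofReal hsq (Eventually.of_forall fun x => sq_nonneg _),
        ← ofReal_integral_eq_lintegral_ofReal hgint (Eventually.of_forall fun x => sq_nonneg _),
        ← ENNReal.ofReal_mul (by positivity)] at hlin
      have h2 := (ENNReal.ofReal_le_ofReal_iff (mul_nonneg (by positivity)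
        (integral_nonneg fun x => sq_nonneg _))).1 hlin
      exact h2.trans (mul_le_mul_of_nonneg_left (hA n) (by positivity))
    have hprod : Integrable (fun x => w n x * w n ((1 - s) • x + s • z))
        (volume.restrict C) := by
      refine hbdd ((hwm n).mul hwτm) (k := K * K) fun x => ?_
      rw [norm_mul]; exact mul_le_mul (hK _) (hK _) (norm_nonneg _) hK0
    have hpt : ∀ x, w n x ^ 2 - w n x * w n ((1 - s) • x + s • z) ≤
        s / 2 * w n x ^ 2 + (2 * s)⁻¹ * (w n x - w n ((1 - s) • x + s • z)) ^ 2 := by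
      intro x
      have h2 : 0 ≤ (2 * s)⁻¹ * (s * w n x - (w n x - w n ((1 - s) • x + s • z))) ^ 2 := by
        positivity
      have h3 : (2 * s)⁻¹ * (s * w n x - (w n x - w n ((1 - s) • x + s • z))) ^ 2 =
          s / 2 * w n x ^ 2 + (2 * s)⁻¹ * (w n x - w n ((1 - s) • x + s • z)) ^ 2 -
          w n x * (w n x - w n ((1 - s) • x + s • z)) := by
        field_simp; ring
      rw [h3] at h2
      linarith
    have h4 := integral_mono ((hw2int n).sub hprod)
      (((hw2int n).const_mul (s / 2)).add (hsq.const_mul (2 * s)⁻¹)) hpt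
    simp only [Pi.sub_apply, Pi.add_apply] at h4
    rw [integral_sub (hw2int n) hprod, integral_add ((hw2int n).const_mul (s / 2))
      (hsq.const_mul (2 * s)⁻¹), integral_const_mul, integral_const_mul] at h4
    have h5 : s / 2 * ∫ x in C, w n x ^ 2 ≤ s / 2 * M :=
      mul_le_mul_of_nonneg_left (hM n) (by positivity)
    have h6 := mul_le_mul_of_nonneg_left hL (by positivity : 0 ≤ (2 * s)⁻¹)
    have h7 : (2 * s)⁻¹ * (s ^ 2 * D ^ 2 * 2 ^ d * A) = s * (D ^ 2 * 2 ^ d * A / 2) := by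
      field_simp
    rw [h7] at h6
    have : s * c = s / 2 * M + s * (D ^ 2 * 2 ^ d * A / 2) := by rw [hc]; ring
    linarith
  have hprodm : ∀ (s : ℝ) n, StronglyMeasurable (Function.uncurry fun (z x : Vec d) =>
      w n ((1 - s) • x + s • z)) := by
    intro s n
    refine (hwm n).comp_measurable ?_
    have : Continuous fun p : Vec d × Vec d => (1 - s) • p.2 + s • p.1 := by fun_prop
    exact this.measurable
  have hIm : ∀ s n, StronglyMeasurable (I s n) := fun s n =>
    StronglyMeasurable.integral_prod_left (μ := volume.restrict C) (hprodm s n)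
  have hImul : ∀ (s : ℝ) n, ∫ x in C, w n x * I s n x =
      ∫ z in C, ∫ x in C, w n x * w n ((1 - s) • x + s • z) := by
    intro s n
    obtain ⟨K, hK0, hK⟩ := hwK n
    rw [integral_integral_swap]
    · simp only [hI, integral_const_mul]
    · refine Integrable.of_bound (C := K * K) ?_ (Eventually.of_forall fun p => ?_)
      · exact ((((hwm n).comp_measurable measurable_snd).mul (hprodm s n))).aestronglyMeasurable
      · simp only [Function.uncurry]
        rw [norm_mul]; exact mul_le_mul (hK _) (hK _) (norm_nonneg _) hK0
  have hmain : ∀ n, ∀ s : ℝ, 0 < s → s ≤ 1 / 2 →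
      V * (∫ x in C, w n x ^ 2) ≤ V * (s * c) + ∫ x in C, w n x * I s n x := by
    intro n s h0 h1
    obtain ⟨K, hK0, hK⟩ := hwK n
    rw [hImul]
    have hzm : StronglyMeasurable fun z => ∫ x in C, w n x * w n ((1 - s) • x + s • z) :=
      StronglyMeasurable.integral_prod_right (ν := volume.restrict C)
        (f := fun (z x : Vec d) => w n x * w n ((1 - s) • x + s • z))
        (((hwm n).comp_measurable measurable_snd).mul (hprodm s n))
    have h2 : ∫ z in C, ((∫ x in C, w n x ^ 2) - s * c) ≤
        ∫ z in C, ∫ x in C, w n x * w n ((1 - s) • x + s • z) := by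
      refine setIntegral_mono_on (integrable_const _) ?_ hC.measurableSet
        fun z hz => hdiff n s h0 h1 z hz
      refine hbdd hzm (k := K * K * V) fun z => ?_
      have hb : ∀ x, ‖w n x * w n ((1 - s) • x + s • z)‖ ≤ K * K := fun x => by
        rw [norm_mul]; exact mul_le_mul (hK _) (hK _) (norm_nonneg _) hK0
      have := norm_integral_le_of_norm_le_const (μ := volume.restrict C) (Eventually.of_forall hb)
      simpa [hV, Measure.real] using this
    rw [setIntegral_const, smul_eq_mul] at h2
    nlinarith [h2]
  -- the averages tend to zero
  have hI2 : ∀ s : ℝ, 0 < s → s ≤ 1 / 2 →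
      Tendsto (fun n => ∫ x in C, I s n x ^ 2) atTop (𝓝 0) := by
    intro s h0 h1
    -- From `|w| ≤ (1 + w²)/2` the `L¹` norm of `w n` on `C` is at most `(V + M)/2`. This bound is
    -- uniform in `n`, unlike the sup bounds `K`.
    set Q : ℝ := (s ^ d)⁻¹ * ((V + M) / 2) with hQ
    have hIQ : ∀ n, ∀ x ∈ C, ‖I s n x‖ ≤ Q := by
      intro n x hx
      have hsub : (fun z => (1 - s) • x + s • z) '' C ⊆ C := by
        rintro _ ⟨z, hz, rfl⟩
        exact hconv hx hz (by linarith) h0.le (by ring)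
      simp only [hI]
      rw [average_contraction_eq hC _ h0, norm_mul, norm_inv, norm_pow,
        Real.norm_of_nonneg h0.le]
      refine mul_le_mul_of_nonneg_left ?_ (by positivity)
      calc ‖∫ y in (fun z => (1 - s) • x + s • z) '' C, w n y‖
          ≤ ∫ y in (fun z => (1 - s) • x + s • z) '' C, ‖w n y‖ := norm_integral_le_integral_norm _
        _ ≤ ∫ y in C, ‖w n y‖ := setIntegral_mono_set (hwint n).norm
            (Eventually.of_forall fun _ => norm_nonneg _) hsub.eventuallyLE
        _ ≤ ∫ y in C, (1 / 2 + 1 / 2 * w n y ^ 2) := by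
            refine integral_mono (hwint n).norm
              ((integrable_const _).add ((hw2int n).const_mul _)) fun y => ?_
            have := sq_nonneg (‖w n y‖ - 1)
            simp only [Real.norm_eq_abs] at this ⊢
            nlinarith [sq_abs (w n y)]
        _ ≤ (V + M) / 2 := by
            rw [integral_add (integrable_const _) ((hw2int n).const_mul _), setIntegral_const,
              integral_const_mul, smul_eq_mul]
            have := hM n
            linarith
    have := tendsto_integral_of_dominated_convergence (μ := volume.restrict C)
      (F := fun n x => I s n x ^ 2) (f := fun _ => (0 : ℝ)) (fun _ => Q ^ 2)
      (fun n => ((hIm s n).pow 2).aestronglyMeasurable) (integrable_const _)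
      (fun n => ?_) ?_
    · simpa using this
    · filter_upwards [ae_restrict_mem hC.measurableSet] with x hx
      rw [norm_pow]; exact pow_le_pow_left₀ (norm_nonneg _) (hIQ n x hx) 2
    · filter_upwards [ae_restrict_mem hC.measurableSet] with x hx
      have hopen : IsOpen ((fun z => (1 - s) • x + s • z) '' C) := by
        have : (fun z => (1 - s) • x + s • z) '' C = (fun y => (1 - s) • x + y) '' (s • C) := by
          rw [← image_smul, image_image]
        rw [this]
        exact isOpenMap_add_left _ _ (hC.smul₀ h0.ne')
      have hsub : (fun z => (1 - s) • x + s • z) '' C ⊆ C := by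
        rintro _ ⟨z, hz, rfl⟩
        exact hconv hx hz (by linarith) h0.le (by ring)
      have h3 := ((hnull _ hsub hopen.measurableSet).const_mul (s ^ d)⁻¹).pow 2
      simp only [hI]
      simp only [average_contraction_eq hC _ h0]
      simpa using h3
  rw [Metric.tendsto_atTop']
  intro ε hε
  have hcM : 0 ≤ c := by positivity
  -- `V s c` comes from the comparison with the homotheties and `s M / 2` from Young's inequality
  -- for `⟨w, I⟩`; the remaining term `(2s)⁻¹ ‖I‖²` is small for large `n`.
  obtain ⟨s, h0, h1, hs⟩ : ∃ s : ℝ, 0 < s ∧ s ≤ 1 / 2 ∧ s * (V * c + M / 2) < V * ε / 2 := by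
    have ht : Tendsto (fun s : ℝ => s * (V * c + M / 2)) (𝓝[>] 0) (𝓝 0) := by
      have : Tendsto (fun s : ℝ => s * (V * c + M / 2)) (𝓝 0) (𝓝 (0 * (V * c + M / 2))) :=
        tendsto_id.mul_const _
      rw [zero_mul] at this
      exact this.mono_left nhdsWithin_le_nhds
    have e1 := ht.eventually (gt_mem_nhds (by positivity : 0 < V * ε / 2))
    have e2 : ∀ᶠ s : ℝ in 𝓝[>] 0, s ∈ Ioo (0 : ℝ) (1 / 2) :=
      Ioo_mem_nhdsGT (by norm_num)
    obtain ⟨s, hs1, hs2⟩ := (e1.and e2).exists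
    exact ⟨s, hs2.1, hs2.2.le, hs1⟩
  have hev := ((hI2 s h0 h1).const_mul (2 * s)⁻¹).eventually
    (gt_mem_nhds (show (2 * s)⁻¹ * 0 < V * ε / 2 by rw [mul_zero]; positivity))
  obtain ⟨N, hN⟩ := eventually_atTop.1 hev
  refine ⟨N, fun n hn => ?_⟩
  obtain ⟨K, hK0, hK⟩ := hwK n
  have hIbd : ∀ x, ‖I s n x‖ ≤ K * V := fun x => by
    have := norm_integral_le_of_norm_le_const (μ := volume.restrict C)
      (Eventually.of_forall fun z => hK ((1 - s) • x + s • z))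
    simpa [hI, hV, Measure.real] using this
  have hI2int : Integrable (fun x => I s n x ^ 2) (volume.restrict C) := by
    refine hbdd ((hIm s n).pow 2) (k := (K * V) ^ 2) fun x => ?_
    rw [norm_pow]; exact pow_le_pow_left₀ (norm_nonneg _) (hIbd x) 2
  have hwI : Integrable (fun x => w n x * I s n x) (volume.restrict C) := by
    refine hbdd ((hwm n).mul (hIm s n)) (k := K * (K * V)) fun x => ?_
    rw [norm_mul]; exact mul_le_mul (hK _) (hIbd x) (norm_nonneg _) hK0
  have h3 : ∫ x in C, w n x * I s n x ≤
      s / 2 * (∫ x in C, w n x ^ 2) + (2 * s)⁻¹ * ∫ x in C, I s n x ^ 2 := by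
    rw [← integral_const_mul, ← integral_const_mul,
      ← integral_add ((hw2int n).const_mul _) (hI2int.const_mul _)]
    refine integral_mono hwI (((hw2int n).const_mul _).add (hI2int.const_mul _)) fun x => ?_
    have h4 : 0 ≤ (2 * s)⁻¹ * (s * w n x - I s n x) ^ 2 := by positivity
    have h5 : (2 * s)⁻¹ * (s * w n x - I s n x) ^ 2 =
        s / 2 * w n x ^ 2 + (2 * s)⁻¹ * I s n x ^ 2 - w n x * I s n x := by
      field_simp; ring
    rw [h5] at h4
    linarith
  have h6 := hmain n s h0 h1
  have h7 : s / 2 * (∫ x in C, w n x ^ 2) ≤ s / 2 * M :=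
    mul_le_mul_of_nonneg_left (hM n) (by positivity)
  have h8 := hN n hn.le
  have h9 : V * (∫ x in C, w n x ^ 2) < V * ε := by nlinarith
  have h10 := lt_of_mul_lt_mul_left h9 hVpos.le
  rw [Real.dist_eq, sub_zero, abs_of_nonneg (integral_nonneg fun x => sq_nonneg _)]
  exact h10

/-- Rellich's theorem for weakly null sequences on a bounded convex open set. -/
theorem rellich {C : Set (Vec d)} (hC : IsOpen C) (hconv : Convex ℝ C)
    (hne : C.Nonempty) (hbd : Bornology.IsBounded C)
    {w : ℕ → Vec d → ℝ} {g : ℕ → Vec d → Vec d} (hwg : ∀ n, HasWeakGrad C (w n) (g n))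
    (hwm : ∀ n, AEStronglyMeasurable (w n) (volume.restrict C))
    (hgm : ∀ n, AEStronglyMeasurable (g n) (volume.restrict C))
    (hwK : ∀ n, ∃ K : ℝ, 0 ≤ K ∧ ∀ᵐ x ∂(volume.restrict C), ‖w n x‖ ≤ K)
    (hgR : ∀ n, ∃ R : ℝ, 0 ≤ R ∧ ∀ᵐ x ∂(volume.restrict C), ‖g n x‖ ≤ R)
    {A M : ℝ} (hA : ∀ n, ∫ x in C, ‖g n x‖ ^ 2 ≤ A) (hM : ∀ n, ∫ x in C, w n x ^ 2 ≤ M)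
    (hnull : ∀ E ⊆ C, MeasurableSet E → Tendsto (fun n => ∫ x in E, w n x) atTop (𝓝 0)) :
    Tendsto (fun n => ∫ x in C, w n x ^ 2) atTop (𝓝 0) := by
  choose K hK0 hK using hwK
  -- Truncating a measurable representative at `± K n` changes `w n` on a null set only and makes it
  -- bounded everywhere, which the Fubini arguments of `rellich_aux` use.
  set w' : ℕ → Vec d → ℝ := fun n x => max (-K n) (min (K n) ((hwm n).mk _ x)) with hw'
  have hww : ∀ n, w n =ᵐ[volume.restrict C] w' n := fun n => by
    filter_upwards [(hwm n).ae_eq_mk, hK n] with x h1 h2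
    rw [Real.norm_eq_abs, abs_le] at h2
    simp only [hw', ← h1, min_eq_right h2.2, max_eq_right h2.1]
  have hE : ∀ n, ∀ E ⊆ C, ∫ x in E, w n x = ∫ x in E, w' n x := fun n E hE =>
    integral_congr_ae (ae_restrict_of_ae_restrict_of_subset hE (hww n))
  have h2 : ∀ n, ∫ x in C, w n x ^ 2 = ∫ x in C, w' n x ^ 2 := fun n => by
    refine integral_congr_ae ?_
    filter_upwards [hww n] with x hx; rw [hx]
  simp only [h2] at hM ⊢
  refine rellich_aux hC hconv hne hbd.measure_lt_top.ne (D := diam C) (fun x hx z hz => ?_)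
    (fun n => ?_) (fun n => ?_) hgm (fun n => ⟨K n, hK0 n, fun x => ?_⟩) hgR hA hM
    (fun E hEC hEm => ?_)
  · rw [← dist_eq_norm]; exact dist_le_diam_of_mem hbd hz hx
  · intro φ a b c j
    rw [← hwg n φ a b c j]
    refine integral_congr_ae ?_
    filter_upwards [hww n] with x hx; rw [hx]
  · exact stronglyMeasurable_const.sup (stronglyMeasurable_const.inf (hwm n).stronglyMeasurable_mk)
  · rw [Real.norm_eq_abs, abs_le]
    exact ⟨le_max_left _ _, max_le (by linarith [hK0 n]) (min_le_left _ _)⟩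
  · simpa only [hE _ E hEC] using hnull E hEC hEm

end FreeBoundary

end

noncomputable section

namespace FreeBoundary

variable {m d : ℕ}

/-! ### Matrices -/

/-- The `i`-th row of a matrix. -/
def row (A : Mat m d) (i : Fin m) : Vec d := WithLp.toLp 2 fun j => A (i, j)

@[simp] theorem row_apply (A : Mat m d) (i : Fin m) (j : Fin d) : row A i j = A (i, j) := rfl

/-- The product of a matrix and an endomorphism of `ℝᵈ`. -/
def matComp (A : Mat m d) (D : Vec d →L[ℝ] Vec d) : Mat m d :=
  WithLp.toLp 2 fun p => D.adjoint (row A p.1) p.2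

theorem row_matComp (A : Mat m d) (D : Vec d →L[ℝ] Vec d) (i : Fin m) :
    row (matComp A D) i = D.adjoint (row A i) := rfl

/-- The dyadic product of two vectors. -/
def outer (b : Vec m) (a : Vec d) : Mat m d := WithLp.toLp 2 fun p => b p.1 * a p.2

theorem row_outer (b : Vec m) (a : Vec d) (i : Fin m) : row (outer b a) i = b i • a := by
  ext j; simp [outer]

theorem row_add (A B : Mat m d) (i : Fin m) : row (A + B) i = row A i + row B i := rfl

theorem row_smul (c : ℝ) (A : Mat m d) (i : Fin m) : row (c • A) i = c • row A i := rfl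

theorem ext_row {A B : Mat m d} (h : ∀ i, row A i = row B i) : A = B := by
  ext p
  exact congrArg (fun v : Vec d => v p.2) (h p.1)

theorem norm_sq_eq_sum_row (A : Mat m d) : ‖A‖ ^ 2 = ∑ i, ‖row A i‖ ^ 2 := by
  simp only [EuclideanSpace.norm_sq_eq]
  rw [Fintype.sum_prod_type]
  rfl

theorem norm_row_le (A : Mat m d) (i : Fin m) : ‖row A i‖ ≤ ‖A‖ := by
  refine le_of_sq_le_sq ?_ (norm_nonneg _)
  rw [norm_sq_eq_sum_row A]
  exact Finset.single_le_sum (f := fun i => ‖row A i‖ ^ 2) (fun _ _ => sq_nonneg _)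
    (Finset.mem_univ i)

theorem norm_matComp_le (A : Mat m d) (D : Vec d →L[ℝ] Vec d) :
    ‖matComp A D‖ ≤ ‖A‖ * ‖D‖ := by
  refine le_of_sq_le_sq ?_ (by positivity)
  rw [mul_pow, norm_sq_eq_sum_row, norm_sq_eq_sum_row A, Finset.sum_mul]
  refine Finset.sum_le_sum fun i _ => ?_
  rw [row_matComp, ← mul_pow]
  refine pow_le_pow_left₀ (norm_nonneg _) ?_ 2
  refine (D.adjoint.le_opNorm _).trans (le_of_eq ?_)
  rw [LinearIsometryEquiv.norm_map, mul_comm]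

theorem norm_outer (b : Vec m) (a : Vec d) : ‖outer b a‖ = ‖b‖ * ‖a‖ := by
  rw [← sq_eq_sq₀ (norm_nonneg _) (by positivity), norm_sq_eq_sum_row, mul_pow,
    EuclideanSpace.norm_sq_eq b, Finset.sum_mul]
  refine Finset.sum_congr rfl fun i _ => ?_
  rw [row_outer, norm_smul, mul_pow]

theorem matComp_id (A : Mat m d) : matComp A (ContinuousLinearMap.id ℝ (Vec d)) = A :=
  ext_row fun i => by
    rw [row_matComp]
    refine ext_inner_right ℝ fun v => ?_
    rw [ContinuousLinearMap.adjoint_inner_left, ContinuousLinearMap.id_apply]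

theorem matComp_smul (A : Mat m d) (c : ℝ) (D : Vec d →L[ℝ] Vec d) :
    matComp A (c • D) = c • matComp A D :=
  ext_row fun i => by rw [row_smul, row_matComp, row_matComp]; simp

theorem smul_matComp (A : Mat m d) (c : ℝ) (D : Vec d →L[ℝ] Vec d) :
    matComp (c • A) D = c • matComp A D :=
  ext_row fun i => by rw [row_smul, row_matComp, row_matComp, row_smul, map_smul]

theorem continuous_row (i : Fin m) : Continuous fun A : Mat m d => row A i := by
  refine (PiLp.continuous_toLp 2 _).comp (continuous_pi fun j => ?_)
  exact (EuclideanSpace.proj (𝕜 := ℝ) (i, j)).continuous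

theorem continuous_of_row {X : Type*} [TopologicalSpace X] {f : X → Mat m d}
    (h : ∀ i, Continuous fun x => row (f x) i) : Continuous f := by
  have h1 : Continuous fun x => (WithLp.ofLp (f x) : Fin m × Fin d → ℝ) :=
    continuous_pi fun p => (EuclideanSpace.proj (𝕜 := ℝ) p.2).continuous.comp (h p.1)
  exact (PiLp.continuous_toLp 2 _).comp h1

theorem _root_.Continuous.matComp {X : Type*} [TopologicalSpace X] {f : X → Mat m d}
    {D : X → Vec d →L[ℝ] Vec d} (hf : Continuous f) (hD : Continuous D) :
    Continuous fun x => matComp (f x) (D x) := by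
  refine continuous_of_row fun i => ?_
  simp only [row_matComp]
  exact ((ContinuousLinearMap.adjoint (𝕜 := ℝ) (E := Vec d) (F := Vec d)).continuous.comp
    hD).clm_apply ((continuous_row i).comp hf)

theorem _root_.Continuous.outer {X : Type*} [TopologicalSpace X] {b : X → Vec m} {a : X → Vec d}
    (hb : Continuous b) (ha : Continuous a) : Continuous fun x => outer (b x) (a x) := by
  refine continuous_of_row fun i => ?_
  simp only [row_outer]
  exact ((EuclideanSpace.proj (𝕜 := ℝ) i).continuous.comp hb).smul ha

/-- The gradient of a scalar function as a vector of partial derivatives. -/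
def partials (θ : Vec d → ℝ) (x : Vec d) : Vec d :=
  WithLp.toLp 2 fun j => fderiv ℝ θ x (EuclideanSpace.single j 1)

@[simp] theorem partials_apply (θ : Vec d → ℝ) (x : Vec d) (j : Fin d) :
    partials θ x j = fderiv ℝ θ x (EuclideanSpace.single j 1) := rfl

theorem continuous_partials {θ : Vec d → ℝ} (hθ : ContDiff ℝ 1 θ) : Continuous (partials θ) :=
  (PiLp.continuous_toLp 2 _).comp (continuous_pi fun _ =>
    (hθ.continuous_fderiv one_ne_zero).clm_apply continuous_const)

theorem hasCompactSupport_partials {θ : Vec d → ℝ} (hθ : HasCompactSupport θ) :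
    HasCompactSupport (partials θ) := by
  refine (hθ.fderiv ℝ).mono fun x hx => ?_
  rw [Function.mem_support] at hx ⊢
  intro h
  apply hx
  ext j; simp [h]

/-! ### Scalar weak gradients -/

theorem integrable_mul_of_hasCompactSupport {μ : Measure (Vec d)} {w f : Vec d → ℝ}
    (hw : Integrable w μ) (hf : Continuous f) (hfs : HasCompactSupport f) :
    Integrable (fun x => w x * f x) μ := by
  obtain ⟨c, hc⟩ := hfs.exists_bound_of_continuous hf
  exact hw.mul_bdd (c := c) hf.aestronglyMeasurable (Eventually.of_forall hc)

theorem integral_fderiv_eq_zero {φ : Vec d → ℝ} (hφ : ContDiff ℝ 1 φ)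
    (hφs : HasCompactSupport φ) (e : Vec d) : ∫ x, fderiv ℝ φ x e = 0 := by
  have hd : Continuous fun x => fderiv ℝ φ x e :=
    (hφ.continuous_fderiv one_ne_zero).clm_apply continuous_const
  have := integral_bilinear_hasFDerivAt_right_eq_neg_left_of_integrable
    (μ := (volume : Measure (Vec d))) (f := fun _ => (1 : ℝ)) (f' := fun _ => 0) (g := φ)
    (g' := fderiv ℝ φ) (v := e) (B := ContinuousLinearMap.mul ℝ ℝ)
    (by simp) (by simpa using hd.integrable_of_hasCompactSupport (hφs.fderiv_apply (𝕜 := ℝ) e))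
    (by simpa using hφ.continuous.integrable_of_hasCompactSupport hφs)
    (fun x _ => hasFDerivAt_const _ _) (fun x _ => (hφ.differentiable one_ne_zero x).hasFDerivAt)
  simpa using this

theorem HasWeakGrad.sub_const {S : Set (Vec d)} {w : Vec d → ℝ} {g : Vec d → Vec d}
    (h : HasWeakGrad S w g) (hw : IntegrableOn w S) (c : ℝ) :
    HasWeakGrad S (fun x => w x - c) g := by
  intro φ hφ hφs hφS j
  have hφ1 : ContDiff ℝ 1 φ := hφ.of_le (by exact_mod_cast le_top)
  set e : Vec d := EuclideanSpace.single j 1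
  have hd : Continuous fun x => fderiv ℝ φ x e :=
    (hφ1.continuous_fderiv one_ne_zero).clm_apply continuous_const
  have hds : HasCompactSupport fun x => fderiv ℝ φ x e := hφs.fderiv_apply (𝕜 := ℝ) e
  have h0 : ∫ x in S, fderiv ℝ φ x e = 0 := by
    rw [setIntegral_eq_integral_of_forall_compl_eq_zero, integral_fderiv_eq_zero hφ1 hφs]
    intro x hx
    have := image_eq_zero_of_notMem_tsupport (f := fderiv ℝ φ)
      (fun hx' => hx (hφS (tsupport_fderiv_subset ℝ hx')))
    simp [this]
  simp only [sub_mul]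
  rw [integral_sub (integrable_mul_of_hasCompactSupport hw hd hds)
    ((hd.integrable_of_hasCompactSupport hds).integrableOn.const_mul c), integral_const_mul, h0,
    mul_zero, sub_zero, h φ hφ hφs hφS j]

theorem HasWeakGrad.const_mul {S : Set (Vec d)} {w : Vec d → ℝ} {g : Vec d → Vec d}
    (h : HasWeakGrad S w g) (c : ℝ) : HasWeakGrad S (fun x => c * w x) (fun x => c • g x) := by
  intro φ hφ hφs hφS j
  have := h φ hφ hφs hφS j
  simp only [mul_assoc, integral_const_mul, this, PiLp.smul_apply, smul_eq_mul, mul_neg]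

/-- The weak gradient of `w` is tested with the product `θ φ`, whose support is contained in that of
`φ`. -/
theorem HasWeakGrad.mul {S : Set (Vec d)} {w : Vec d → ℝ} {g : Vec d → Vec d}
    (h : HasWeakGrad S w g) (hw : IntegrableOn w S) (hg : IntegrableOn g S) {θ : Vec d → ℝ}
    (hθ : ContDiff ℝ (⊤ : ℕ∞) θ) :
    HasWeakGrad S (fun x => θ x * w x) (fun x => θ x • g x + w x • partials θ x) := by
  intro φ hφ hφs hφS j
  have hφ1 : ContDiff ℝ 1 φ := hφ.of_le (by exact_mod_cast le_top)
  have hθ1 : ContDiff ℝ 1 θ := hθ.of_le (by exact_mod_cast le_top)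
  set e : Vec d := EuclideanSpace.single j 1 with he
  have hd : Continuous fun x => fderiv ℝ φ x e :=
    (hφ1.continuous_fderiv one_ne_zero).clm_apply continuous_const
  have hds : HasCompactSupport fun x => fderiv ℝ φ x e := hφs.fderiv_apply (𝕜 := ℝ) e
  have hdθ : Continuous fun x => fderiv ℝ θ x e :=
    (hθ1.continuous_fderiv one_ne_zero).clm_apply continuous_const
  have key := h (fun x => θ x * φ x) (hθ.mul hφ) hφs.mul_left
    ((tsupport_mul_subset_right).trans hφS) j
  have hprod : ∀ x, fderiv ℝ (fun x => θ x * φ x) x e =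
      θ x * fderiv ℝ φ x e + φ x * fderiv ℝ θ x e := by
    intro x
    rw [fderiv_fun_mul (hθ1.differentiable one_ne_zero x) (hφ1.differentiable one_ne_zero x)]
    simp
  have hgj : IntegrableOn (fun x => g x j) S := by
    have := (EuclideanSpace.proj (𝕜 := ℝ) j : Vec d →L[ℝ] ℝ).integrable_comp hg
    exact this
  have i1 : IntegrableOn (fun x => w x * (θ x * fderiv ℝ φ x e)) S :=
    integrable_mul_of_hasCompactSupport hw (hθ1.continuous.mul hd) hds.mul_left
  have i2 : IntegrableOn (fun x => w x * (φ x * fderiv ℝ θ x e)) S :=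
    integrable_mul_of_hasCompactSupport hw (hφ1.continuous.mul hdθ) hφs.mul_right
  have i3 : IntegrableOn (fun x => g x j * (θ x * φ x)) S :=
    integrable_mul_of_hasCompactSupport hgj (hθ1.continuous.mul hφ1.continuous) hφs.mul_left
  simp only [← he] at key
  simp only [hprod, mul_add] at key
  rw [integral_add i1 i2] at key
  have e1 : ∫ x in S, θ x * w x * fderiv ℝ φ x e = ∫ x in S, w x * (θ x * fderiv ℝ φ x e) := by
    congr 1; ext x; ring
  have e2 : ∫ x in S, (θ x • g x + w x • partials θ x) j * φ x =
      (∫ x in S, g x j * (θ x * φ x)) + ∫ x in S, w x * (φ x * fderiv ℝ θ x e) := by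
    rw [← integral_add i3 i2]
    congr 1; ext x
    simp only [PiLp.add_apply, PiLp.smul_apply, smul_eq_mul, partials_apply, ← he]
    ring
  rw [e1, e2]
  linarith

/-! ### Weak gradients of vector-valued functions -/

theorem HasWeakGradient.hasWeakGrad {S : Set (Vec d)} {u : Vec d → Vec m} {G : Vec d → Mat m d}
    (h : HasWeakGradient S u G) (i : Fin m) :
    HasWeakGrad S (fun x => u x i) (fun x => row (G x) i) :=
  fun φ h1 h2 h3 j => h.2.2 φ h1 h2 h3 i j

theorem HasWeakGradient.of_row {S : Set (Vec d)} {u : Vec d → Vec m} {G : Vec d → Mat m d}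
    (hu : IntegrableOn u S) (hG : IntegrableOn G S)
    (h : ∀ i, HasWeakGrad S (fun x => u x i) (fun x => row (G x) i)) : HasWeakGradient S u G :=
  ⟨hu.locallyIntegrableOn, hG.locallyIntegrableOn, fun φ h1 h2 h3 i j => h i φ h1 h2 h3 j⟩

theorem hasWeakGradient_weakGradient {S : Set (Vec d)} {u : Vec d → Vec m}
    (h : ∃ G, HasWeakGradient S u G) : HasWeakGradient S u (weakGradient S u) := by
  rw [weakGradient, dif_pos h]; exact h.choose_spec

/-- `weakGradient` is an arbitrary choice among all weak gradients. This uniqueness, which is the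
fundamental lemma of the calculus of variations applied to each entry, allows an explicitly computed
gradient to replace it under integrals. -/
theorem HasWeakGradient.ae_eq {S : Set (Vec d)} (hS : IsOpen S) {u : Vec d → Vec m}
    {G G' : Vec d → Mat m d} (h : HasWeakGradient S u G) (h' : HasWeakGradient S u G') :
    G =ᵐ[volume.restrict S] G' := by
  have hcomp : ∀ {H : Vec d → Mat m d}, LocallyIntegrableOn H S volume → ∀ p,
      LocallyIntegrableOn (fun x => H x p) S volume := by
    intro H hH p x hx
    obtain ⟨t, ht, hi⟩ := hH x hx
    refine ⟨t, ht, ?_⟩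
    have := (EuclideanSpace.proj (𝕜 := ℝ) p : Mat m d →L[ℝ] ℝ).integrable_comp hi
    exact this
  have hp : ∀ p : Fin m × Fin d, ∀ᵐ x, x ∈ S → G x p - G' x p = 0 := by
    intro p
    have hl := hcomp h.2.1 p
    have hl' := hcomp h'.2.1 p
    refine hS.ae_eq_zero_of_integral_contDiff_smul_eq_zero (fun x hx => (hl x hx).sub (hl' x hx))
      fun φ h1 h2 h3 => ?_
    have hint : ∀ {f : Vec d → ℝ}, LocallyIntegrableOn f S volume →
        Integrable (fun x => φ x * f x) := by
      intro f hf
      have hK := hf.integrableOn_compact_subset h3 h2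
      obtain ⟨c, hc⟩ := h2.exists_bound_of_continuous h1.continuous
      have := hK.bdd_mul (c := c) h1.continuous.aestronglyMeasurable (Eventually.of_forall hc)
      refine (integrableOn_iff_integrable_of_support_subset fun x hx => ?_).1 this
      by_contra hx'
      exact hx (by simp [image_eq_zero_of_notMem_tsupport hx'])
    have hset : ∀ H : Vec d → Mat m d, ∫ x in S, H x (p.1, p.2) * φ x = ∫ x, φ x * H x p := by
      intro H
      rw [setIntegral_eq_integral_of_forall_compl_eq_zero]
      · simp only [mul_comm]
      · intro x hx
        rw [image_eq_zero_of_notMem_tsupport fun hx' => hx (h3 hx'), mul_zero]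
    have e := (h.2.2 φ h1 h2 h3 p.1 p.2).symm.trans (h'.2.2 φ h1 h2 h3 p.1 p.2)
    rw [neg_inj, hset, hset] at e
    simp only [smul_eq_mul, mul_sub]
    rw [integral_sub (hint hl) (hint hl'), e, sub_self]
  rw [Filter.EventuallyEq, ae_restrict_iff' hS.measurableSet]
  filter_upwards [ae_all_iff.2 hp] with x hx hxS
  ext p
  exact sub_eq_zero.1 (hx p hxS)

theorem HasWeakGradient.aestronglyMeasurable {S : Set (Vec d)} {u : Vec d → Vec m}
    {G : Vec d → Mat m d} (h : HasWeakGradient S u G) :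
    AEStronglyMeasurable u (volume.restrict S) ∧ AEStronglyMeasurable G (volume.restrict S) :=
  ⟨h.1.aestronglyMeasurable, h.2.1.aestronglyMeasurable⟩

/-- A bounded function with a bounded weak gradient belongs to `W^{1,∞}`. -/
theorem memW1p_top_of_bound {S : Set (Vec d)} (hS : IsOpen S) {u : Vec d → Vec m}
    {G : Vec d → Mat m d} (h : HasWeakGradient S u G) {K R : ℝ}
    (hu : ∀ᵐ x ∂(volume.restrict S), ‖u x‖ ≤ K) (hG : ∀ᵐ x ∂(volume.restrict S), ‖G x‖ ≤ R) :
    MemW1p ⊤ S u where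
  exists_gradient := ⟨G, h⟩
  memLp := memLp_top_of_bound h.aestronglyMeasurable.1 K hu
  memLp_gradient := by
    have h' := hasWeakGradient_weakGradient ⟨G, h⟩
    refine memLp_top_of_bound h'.aestronglyMeasurable.2 R ?_
    filter_upwards [hG, h.ae_eq hS h'] with x h1 h2
    rwa [← h2]

end FreeBoundary

end

noncomputable section

namespace FreeBoundary

variable {m d : ℕ}

/-! ### The Lagrangian at a fixed point -/

section Lagrangian

variable {Ω : Set (Vec d)} {F : Vec d → Mat m d} {W : Vec d → Mat m d → ℝ}

theorem IsAdmissibleLagrangian.continuous_apply (hW : IsAdmissibleLagrangian Ω F W) {x : Vec d}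
    (hx : x ∈ closure Ω) : Continuous (W x) :=
  hW.continuousOn.comp_continuous (.prodMk_right x) fun _ => ⟨hx, mem_univ _⟩

theorem IsAdmissibleLagrangian.continuous_reduced (hW : IsAdmissibleLagrangian Ω F W) {x : Vec d}
    (hx : x ∈ closure Ω) : Continuous (reduced W F x) := by
  have := hW.continuous_apply hx
  unfold reduced
  fun_prop

theorem continuous_quadForm (x : Vec d) : Continuous (quadForm W F x) := by
  unfold quadForm
  fun_prop

theorem reduced_zero (x : Vec d) : reduced W F x 0 = 0 := by simp [reduced]

theorem quadForm_zero (x : Vec d) : quadForm W F x 0 = 0 := by simp [quadForm]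

theorem quadForm_smul (x : Vec d) (c : ℝ) (A : Mat m d) :
    quadForm W F x (c • A) = c ^ 2 * quadForm W F x A := by
  simp [quadForm]; ring

theorem remainder_zero (x : Vec d) : remainder W F x 0 = 0 := by simp [remainder]

theorem reduced_eq (x : Vec d) (A : Mat m d) :
    reduced W F x A = remainder W F x A * ‖A‖ ^ 2 + 1 / 2 * quadForm W F x A := by
  by_cases hA : A = 0
  · simp [hA, reduced_zero, quadForm_zero]
  · have : ‖A‖ ^ 2 ≠ 0 := pow_ne_zero _ (norm_ne_zero_iff.2 hA)
    rw [remainder, div_mul_cancel₀ _ this]; ring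

/-- The derivative of `W° - ½ (L ·, ·)` at `B` is `W_F(F + B) - W_F(F) - W_FF(F) B`, which is
`o(|B|)` by differentiability of `W_F` at `F(x)`. The mean value inequality on the ball of radius
`‖A‖` then gives the quadratic bound. -/
theorem IsAdmissibleLagrangian.exists_taylor_bound (hW : IsAdmissibleLagrangian Ω F W)
    {x : Vec d} (hx : x ∈ closure Ω) {ε : ℝ} (hε : 0 < ε) :
    ∃ δ > 0, ∀ A : Mat m d, ‖A‖ < δ →
      |reduced W F x A - 1 / 2 * quadForm W F x A| ≤ ε * ‖A‖ ^ 2 := by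
  obtain ⟨O, hO, hFO, hd1, hd2, -, -⟩ := hW.smooth
  have hf : ∀ᶠ Y in 𝓝 (F x), HasFDerivAt (W x) (lagD W x Y) Y := by
    filter_upwards [hO.mem_nhds (hFO x hx)] with Y hY
    exact ((hd1 x hx).differentiableAt (hO.mem_nhds hY)).hasFDerivAt
  have hf2 : HasFDerivAt (lagD W x) (lagD2 W x (F x)) (F x) :=
    ((hd2 x hx).differentiableAt (hO.mem_nhds (hFO x hx))).hasFDerivAt
  -- Symmetry of the second derivative identifies the derivative of `½ (L B, B)` with `L B`.
  have hsymm : ∀ A B, lagD2 W x (F x) A B = lagD2 W x (F x) B A := fun A B =>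
    second_derivative_symmetric_of_eventually hf hf2 A B
  have hlo := hf2.isLittleO.def hε
  have hev := hf.and hlo
  have htr : Tendsto (fun A : Mat m d => F x + A) (𝓝 0) (𝓝 (F x)) := by
    have : Continuous fun A : Mat m d => F x + A := by fun_prop
    simpa using this.tendsto 0
  obtain ⟨δ, hδ, hball⟩ := Metric.eventually_nhds_iff.1 (htr.eventually hev)
  refine ⟨δ, hδ, fun A hA => ?_⟩
  have hder : ∀ B ∈ closedBall (0 : Mat m d) ‖A‖, HasFDerivWithinAt
      (fun B => reduced W F x B - 1 / 2 * quadForm W F x B)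
      (lagD W x (F x + B) - lagD W x (F x) - lagD2 W x (F x) B) (closedBall 0 ‖A‖) B := by
    intro B hB
    have hB' : dist B 0 < δ := lt_of_le_of_lt hB hA
    have e1 : HasFDerivAt (fun B => W x (F x + B)) (lagD W x (F x + B)) B := by
      have := (hball hB').1.comp B ((hasFDerivAt_id B).const_add (F x))
      rw [ContinuousLinearMap.comp_id] at this
      exact this
    have e2 : HasFDerivAt (fun B => lagD2 W x (F x) B B)
        ((lagD2 W x (F x)).flip B + lagD2 W x (F x) B) B := by
      have := (lagD2 W x (F x)).hasFDerivAt (x := B) |>.clm_apply (hasFDerivAt_id B)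
      refine this.congr_fderiv ?_
      ext C; simp [add_comm]
    have e3 := ((e1.sub_const (W x (F x))).sub (lagD W x (F x)).hasFDerivAt).sub
      (e2.const_mul (1 / 2))
    refine (e3.congr_fderiv ?_).hasFDerivWithinAt
    ext C
    simp only [sub_apply, smul_apply, add_apply, ContinuousLinearMap.flip_apply, hsymm C B, smul_eq_mul]
    ring
  have hbound : ∀ B ∈ closedBall (0 : Mat m d) ‖A‖,
      ‖lagD W x (F x + B) - lagD W x (F x) - lagD2 W x (F x) B‖ ≤ ε * ‖A‖ := by
    intro B hB
    have hB' : dist B 0 < δ := lt_of_le_of_lt hB hA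
    have := (hball hB').2
    rw [add_sub_cancel_left] at this
    refine this.trans (mul_le_mul_of_nonneg_left ?_ hε.le)
    simpa using hB
  have := (convex_closedBall (0 : Mat m d) ‖A‖).norm_image_sub_le_of_norm_hasFDerivWithin_le
    hder hbound (mem_closedBall_self (norm_nonneg _)) (by simp : A ∈ closedBall 0 ‖A‖)
  rw [reduced_zero, quadForm_zero, sub_zero, mul_zero, sub_zero, sub_zero, Real.norm_eq_abs] at this
  rw [pow_two, ← mul_assoc]; exact this

/-- Away from `0` this is a quotient of continuous functions. At `0`, where division by zero
supplies the value `0`, it is exactly the Taylor estimate. -/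
theorem IsAdmissibleLagrangian.continuous_remainder (hW : IsAdmissibleLagrangian Ω F W)
    {x : Vec d} (hx : x ∈ closure Ω) : Continuous (remainder W F x) := by
  have hT := hW.continuous_reduced hx
  have hQ : Continuous (quadForm W F x) := continuous_quadForm x
  rw [continuous_iff_continuousAt]
  intro A
  by_cases hA : A = 0
  · subst hA
    rw [Metric.continuousAt_iff]
    intro ε hε
    obtain ⟨δ, hδ, h⟩ := hW.exists_taylor_bound hx (half_pos hε)
    refine ⟨δ, hδ, fun B hB => ?_⟩
    rw [remainder_zero, Real.dist_eq, sub_zero, remainder, abs_div, abs_of_nonneg (sq_nonneg ‖B‖)]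
    rw [dist_zero_right] at hB
    by_cases hB0 : B = 0
    · simpa [hB0] using hε
    · have : 0 < ‖B‖ ^ 2 := by positivity
      refine lt_of_le_of_lt ((div_le_iff₀ this).2 (h B hB)) (half_lt_self hε)
  · have : ‖A‖ ^ 2 ≠ 0 := pow_ne_zero _ (norm_ne_zero_iff.2 hA)
    exact ContinuousAt.div (by fun_prop) (by fun_prop) this

theorem exists_bound_on_closedBall {E : Type*} [NormedAddCommGroup E] [ProperSpace E]
    {f : E → ℝ} (hf : Continuous f) (C : ℝ) : ∃ M, 0 ≤ M ∧ ∀ X, ‖X‖ ≤ C → |f X| ≤ M := by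
  obtain ⟨M, hM⟩ := (isCompact_closedBall (0 : E) C).exists_bound_of_continuousOn hf.continuousOn
  refine ⟨max M 0, le_max_right _ _, fun X hX => (hM X (by simpa using hX)).trans (le_max_left _ _)⟩

/-- On bounded sets, perturbations of the argument change `W°` by a quadratic error. -/
theorem IsAdmissibleLagrangian.exists_perturbation_bound (hW : IsAdmissibleLagrangian Ω F W)
    {x : Vec d} (hx : x ∈ closure Ω) (C : ℝ) {ε : ℝ} (hε : 0 < ε) :
    ∃ c, 0 ≤ c ∧ ∀ X Y, ‖X‖ ≤ C → ‖Y‖ ≤ C →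
      |reduced W F x (X + Y) - reduced W F x X| ≤ ε * ‖X‖ ^ 2 + c * ‖Y‖ ^ 2 := by
  have hU := hW.continuous_remainder hx
  obtain ⟨M, hM0, hM⟩ := exists_bound_on_closedBall hU (C + C)
  set L := ‖lagD2 W x (F x)‖ with hL
  have huc : UniformContinuousOn (remainder W F x) (closedBall 0 (C + C)) :=
    (isCompact_closedBall 0 (C + C)).uniformContinuousOn_of_continuous hU.continuousOn
  -- If `‖Y‖ < δ`, uniform continuity makes the variation of `U` at most `ε/2`. If `‖Y‖ ≥ δ`, then
  -- `‖X‖² ≤ (C²/δ²) ‖Y‖²`, so the crude bound `2M` on the variation is absorbed into the term with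
  -- `‖Y‖²`.
  obtain ⟨δ, hδ, hδU⟩ := Metric.uniformContinuousOn_iff.1 huc (ε / 2) (half_pos hε)
  set N := M + L with hN
  have hL0 : 0 ≤ L := by rw [hL]; positivity
  -- The first summand serves the case `‖Y‖ ≥ δ`; `N` multiplies the pure `‖Y‖²` terms; and `2 * N ^
  -- 2 / ε` comes from Young's inequality for `2 * N * ‖X‖ * ‖Y‖`.
  refine ⟨2 * M * C ^ 2 / δ ^ 2 + (N + 2 * N ^ 2 / ε), by positivity, fun X Y hX hY => ?_⟩
  have hC0 : 0 ≤ C := (norm_nonneg _).trans hX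
  have hX2 : ‖X‖ ≤ C + C := by linarith
  have hXY : ‖X + Y‖ ≤ C + C := (norm_add_le _ _).trans (add_le_add hX hY)
  set U := remainder W F x
  have hQ : quadForm W F x (X + Y) - quadForm W F x X =
      lagD2 W x (F x) X Y + lagD2 W x (F x) Y X + lagD2 W x (F x) Y Y := by
    simp only [quadForm, map_add, add_apply]; ring
  have hb : ∀ A B, |lagD2 W x (F x) A B| ≤ L * ‖A‖ * ‖B‖ := fun A B =>
    (lagD2 W x (F x)).le_opNorm₂ A B
  have hQb : |1 / 2 * (quadForm W F x (X + Y) - quadForm W F x X)| ≤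
      L * (‖X‖ * ‖Y‖ + ‖Y‖ ^ 2) := by
    rw [hQ, abs_mul, show |(1 / 2 : ℝ)| = 1 / 2 by norm_num]
    have := abs_add_three (lagD2 W x (F x) X Y) (lagD2 W x (F x) Y X) (lagD2 W x (F x) Y Y)
    have h1 := hb X Y
    have h2 := hb Y X
    have h3 := hb Y Y
    nlinarith [mul_nonneg hL0 (sq_nonneg ‖Y‖)]
  have hsq : |‖X + Y‖ ^ 2 - ‖X‖ ^ 2| ≤ 2 * ‖X‖ * ‖Y‖ + ‖Y‖ ^ 2 := by
    rw [abs_le]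
    have h1 := norm_add_le X Y
    have h2 : ‖X‖ ≤ ‖X + Y‖ + ‖Y‖ := by simpa using norm_sub_le (X + Y) Y
    constructor
    · nlinarith [norm_nonneg X, norm_nonneg Y, norm_nonneg (X + Y)]
    · nlinarith [norm_nonneg X, norm_nonneg Y, norm_nonneg (X + Y)]
  have h1 : |U (X + Y) * (‖X + Y‖ ^ 2 - ‖X‖ ^ 2)| ≤ M * (2 * ‖X‖ * ‖Y‖ + ‖Y‖ ^ 2) := by
    rw [abs_mul]; exact mul_le_mul (hM _ hXY) hsq (abs_nonneg _) hM0
  have h2 : |(U (X + Y) - U X) * ‖X‖ ^ 2| ≤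
      ε / 2 * ‖X‖ ^ 2 + 2 * M * C ^ 2 / δ ^ 2 * ‖Y‖ ^ 2 := by
    rw [abs_mul, abs_of_nonneg (sq_nonneg ‖X‖)]
    by_cases hYδ : ‖Y‖ < δ
    · have := hδU (X + Y) (by simpa using hXY) X (by simpa using hX2) (by simpa using hYδ)
      rw [Real.dist_eq] at this
      have h3 := mul_le_mul_of_nonneg_right this.le (sq_nonneg ‖X‖)
      have : 0 ≤ 2 * M * C ^ 2 / δ ^ 2 * ‖Y‖ ^ 2 := by positivity
      linarith
    · push Not at hYδ
      have h3 : |U (X + Y) - U X| ≤ 2 * M := by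
        have := abs_sub (U (X + Y)) (U X)
        linarith [hM _ hXY, hM _ hX2]
      have h4 : ‖X‖ ^ 2 ≤ C ^ 2 / δ ^ 2 * ‖Y‖ ^ 2 := by
        rw [div_mul_eq_mul_div, le_div_iff₀ (by positivity)]
        exact mul_le_mul (pow_le_pow_left₀ (norm_nonneg _) hX 2)
          (pow_le_pow_left₀ hδ.le hYδ 2) (sq_nonneg _) (sq_nonneg _)
      have h5 := mul_le_mul h3 h4 (sq_nonneg _) (by positivity)
      have h6 : 2 * M * (C ^ 2 / δ ^ 2 * ‖Y‖ ^ 2) = 2 * M * C ^ 2 / δ ^ 2 * ‖Y‖ ^ 2 := by ring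
      have : 0 ≤ ε / 2 * ‖X‖ ^ 2 := by positivity
      linarith
  have h3 : 2 * N * ‖X‖ * ‖Y‖ ≤ ε / 2 * ‖X‖ ^ 2 + 2 * N ^ 2 / ε * ‖Y‖ ^ 2 := by
    have h4 : 0 ≤ (2 * ε)⁻¹ * (ε * ‖X‖ - 2 * N * ‖Y‖) ^ 2 := by positivity
    have h5 : (2 * ε)⁻¹ * (ε * ‖X‖ - 2 * N * ‖Y‖) ^ 2 =
        ε / 2 * ‖X‖ ^ 2 + 2 * N ^ 2 / ε * ‖Y‖ ^ 2 - 2 * N * ‖X‖ * ‖Y‖ := by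
      field_simp; ring
    rw [h5] at h4; linarith
  have hdec : reduced W F x (X + Y) - reduced W F x X =
      U (X + Y) * (‖X + Y‖ ^ 2 - ‖X‖ ^ 2) + (U (X + Y) - U X) * ‖X‖ ^ 2 +
        1 / 2 * (quadForm W F x (X + Y) - quadForm W F x X) := by
    rw [reduced_eq, reduced_eq]; ring
  rw [hdec]
  refine (abs_add_three _ _ _).trans ?_
  have h7 : 0 ≤ L * (‖X‖ * ‖Y‖) := by positivity
  calc _ ≤ M * (2 * ‖X‖ * ‖Y‖ + ‖Y‖ ^ 2) +
        (ε / 2 * ‖X‖ ^ 2 + 2 * M * C ^ 2 / δ ^ 2 * ‖Y‖ ^ 2) + L * (‖X‖ * ‖Y‖ + ‖Y‖ ^ 2) :=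
        add_le_add (add_le_add h1 h2) hQb
    _ ≤ 2 * N * ‖X‖ * ‖Y‖ + ε / 2 * ‖X‖ ^ 2 + 2 * M * C ^ 2 / δ ^ 2 * ‖Y‖ ^ 2 +
        N * ‖Y‖ ^ 2 := by rw [hN]; nlinarith
    _ ≤ _ := by nlinarith

end Lagrangian

/-! ### Transported integrands -/

/-- The quotient `|A D|² / |A|²` is bounded by `|D|²` but in general has no limit at `A = 0`; the
factor `U`, which vanishes there, restores continuity. The quadratic part has no such factor, which
is why it is treated separately, through the directions `∇v/|∇v|` and the kernel `λ`. -/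
theorem continuous_transported {U : Mat m d → ℝ} (hU : Continuous U) (hU0 : U 0 = 0) :
    Continuous fun p : (Vec d →L[ℝ] Vec d) × Mat m d =>
      U (matComp p.2 p.1) * ‖matComp p.2 p.1‖ ^ 2 / ‖p.2‖ ^ 2 := by
  have hmc : Continuous fun p : (Vec d →L[ℝ] Vec d) × Mat m d => matComp p.2 p.1 :=
    continuous_snd.matComp continuous_fst
  rw [continuous_iff_continuousAt]
  rintro ⟨P, A⟩
  by_cases hA : A = 0
  · subst hA
    have hz : matComp (0 : Mat m d) P = 0 := by
      have := norm_matComp_le (0 : Mat m d) P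
      rw [norm_zero, zero_mul] at this
      exact norm_le_zero_iff.1 this
    rw [ContinuousAt]
    simp only [hz, hU0, zero_mul, zero_div]
    have hlim : Tendsto (fun p : (Vec d →L[ℝ] Vec d) × Mat m d =>
        |U (matComp p.2 p.1)| * ‖p.1‖ ^ 2) (𝓝 (P, 0)) (𝓝 0) := by
      have hc : Continuous fun p : (Vec d →L[ℝ] Vec d) × Mat m d =>
          |U (matComp p.2 p.1)| * ‖p.1‖ ^ 2 :=
        (hU.comp hmc).abs.mul (continuous_fst.norm.pow 2)
      have := hc.tendsto (P, 0)
      simpa [hz, hU0] using this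
    refine squeeze_zero_norm (fun p => ?_) hlim
    rw [Real.norm_eq_abs, abs_div, abs_mul, abs_of_nonneg (sq_nonneg ‖matComp p.2 p.1‖),
      abs_of_nonneg (sq_nonneg ‖p.2‖)]
    refine div_le_of_le_mul₀ (sq_nonneg _) (by positivity) ?_
    rw [mul_assoc]
    refine mul_le_mul_of_nonneg_left ?_ (abs_nonneg _)
    rw [← mul_pow, mul_comm]
    exact pow_le_pow_left₀ (norm_nonneg _) (norm_matComp_le _ _) 2
  · have : ‖A‖ ^ 2 ≠ 0 := pow_ne_zero _ (norm_ne_zero_iff.2 hA)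
    refine ContinuousAt.div ?_ ?_ this
    · exact ((hU.comp hmc).mul (hmc.norm.pow 2)).continuousAt
    · exact (continuous_snd.norm.pow 2).continuousAt

end FreeBoundary

end

noncomputable section

namespace FreeBoundary

variable {m d : ℕ}

/-! ### Lebesgue points of a kernel -/

section Lebesgue

variable {X : Set (Vec d)} {ρ : ℝ} {π : Measure (Vec d)} {κ : Kernel (Vec d) (Mat m d)}

/-- Differentiation of measures through the Besicovitch covering theorem concerns closed balls. An
open ball is an increasing union of closed ones, so its average is a limit of closed-ball averages
at smaller radii and inherits their bound. -/
theorem tendsto_average_ball {π : Measure (Vec d)} [IsFiniteMeasure π] {f : Vec d → ℝ}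
    (hf : Integrable f π) {x : Vec d} (hpos : ∀ r > 0, 0 < π.real (ball x r)) {a : ℝ}
    (h : Tendsto (fun r => (π.real (closedBall x r))⁻¹ * ∫ y in closedBall x r, f y ∂π)
      (𝓝[>] 0) (𝓝 a)) :
    Tendsto (fun r => (π.real (ball x r))⁻¹ * ∫ y in ball x r, f y ∂π) (𝓝[>] 0) (𝓝 a) := by
  rw [Metric.tendsto_nhds] at h ⊢
  intro ε hε
  obtain ⟨δ, hδ, hball⟩ := mem_nhdsGT_iff_exists_Ioo_subset.1 (h (ε / 2) (half_pos hε))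
  filter_upwards [Ioo_mem_nhdsGT hδ] with r hr
  -- The shift by `2` keeps every radius strictly between `0` and `r`, already for `n = 0`.
  set s : ℕ → ℝ := fun n => r - r / (n + 2) with hs
  have hs0 : ∀ n, s n ∈ Ioo 0 r := fun n => by
    have h2 : (0 : ℝ) < n + 2 := by positivity
    have h3 : r / (n + 2) < r := by
      rw [div_lt_iff₀ h2]
      nlinarith [hr.1, (Nat.cast_nonneg n : (0 : ℝ) ≤ n)]
    have h4 : 0 < r / (n + 2) := div_pos hr.1 h2
    simp only [hs, mem_Ioo]
    constructor <;> linarith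
  have hmono : Monotone fun n => closedBall x (s n) := fun n k hnk => by
    refine closedBall_subset_closedBall ?_
    have : r / (k + 2 : ℝ) ≤ r / (n + 2) := by
      refine div_le_div_of_nonneg_left hr.1.le (by positivity) ?_
      have : (n : ℝ) ≤ k := by exact_mod_cast hnk
      linarith
    simp only [hs]; linarith
  have hlim : Tendsto s atTop (𝓝 r) := by
    have h1 : Tendsto (fun n : ℕ => r / ((n + 2 : ℕ) : ℝ)) atTop (𝓝 0) :=
      (tendsto_const_div_atTop_nhds_zero_nat r).comp (tendsto_add_atTop_nat 2)
    have h2 := h1.const_sub r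
    simp only [sub_zero] at h2
    refine h2.congr fun n => ?_
    simp [hs]
  have hU : ⋃ n, closedBall x (s n) = ball x r := by
    ext y
    simp only [mem_iUnion, mem_closedBall, mem_ball]
    constructor
    · rintro ⟨n, hn⟩; exact hn.trans_lt (hs0 n).2
    · intro hy
      obtain ⟨n, hn⟩ := (hlim.eventually (lt_mem_nhds hy)).exists
      exact ⟨n, hn.le⟩
  have h1 := tendsto_setIntegral_of_monotone (μ := π) (f := f)
    (fun n => (isClosed_closedBall (x := x) (ε := s n)).measurableSet) hmono hf.integrableOn
  have h2 : Tendsto (fun n => π.real (closedBall x (s n))) atTop (𝓝 (π.real (ball x r))) := by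
    have := tendsto_measure_iUnion_atTop (μ := π) hmono
    rw [hU] at this
    exact (ENNReal.tendsto_toReal (measure_ne_top _ _)).comp this
  rw [hU] at h1
  have h3 := (h2.inv₀ (hpos r hr.1).ne').mul h1
  have h4 := (h3.dist (tendsto_const_nhds (x := a)))
  refine lt_of_le_of_lt (le_of_tendsto h4 (Eventually.of_forall fun n => ?_)) (half_lt_self hε)
  exact (hball ⟨(hs0 n).1, (hs0 n).2.trans hr.2⟩).le

theorem ae_mem_of_measure_compl {α : Type*} [MeasurableSpace α] {μ : Measure α} {s : Set α}
    (h : μ sᶜ = 0) : ∀ᵐ x ∂μ, x ∈ s := by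
  rw [ae_iff]; exact h

theorem abs_integral_sub_le_of_carrier {ν : Measure (Mat m d)} [IsProbabilityMeasure ν]
    (hν : ν (closedBall 0 ρ)ᶜ = 0) {φ ψ : Mat m d → ℝ} (hφ : Continuous φ) (hψ : Continuous ψ)
    {ε : ℝ} (h : ∀ A, ‖A‖ ≤ ρ → |φ A - ψ A| ≤ ε) :
    |(∫ A, φ A ∂ν) - ∫ A, ψ A ∂ν| ≤ ε := by
  have hae : ∀ᵐ A ∂ν, ‖A‖ ≤ ρ := by
    filter_upwards [ae_mem_of_measure_compl hν] with A hA using by simpa using hA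
  have hint : ∀ {f : Mat m d → ℝ}, Continuous f → Integrable f ν := by
    intro f hf
    obtain ⟨M, -, hM⟩ := exists_bound_on_closedBall hf ρ
    refine Integrable.of_bound hf.aestronglyMeasurable M ?_
    filter_upwards [hae] with A hA using hM A hA
  rw [← integral_sub (hint hφ) (hint hψ)]
  have := norm_integral_le_of_norm_le_const (μ := ν) (f := fun A => φ A - ψ A) (C := ε) (by
    filter_upwards [hae] with A hA using h A hA)
  simpa using this

theorem integrable_integral_kernel [IsFiniteMeasure π] [IsMarkovKernel κ] (hπ : π Xᶜ = 0)
    (hκ : ∀ x ∈ X, κ x (closedBall 0 ρ)ᶜ = 0) {φ : Mat m d → ℝ} (hφ : Continuous φ) :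
    Integrable (fun y => ∫ A, φ A ∂(κ y)) π := by
  obtain ⟨M, -, hM⟩ := exists_bound_on_closedBall hφ ρ
  refine Integrable.of_bound
    (StronglyMeasurable.integral_kernel hφ.stronglyMeasurable).aestronglyMeasurable M ?_
  filter_upwards [ae_mem_of_measure_compl hπ] with y hy
  have := abs_integral_sub_le_of_carrier (hκ y hy) hφ continuous_zero (ε := M)
    fun A hA => by simpa using hM A hA
  simpa using this

/-- Almost every point is a Lebesgue point of a kernel with bounded carrier, simultaneously
for all continuous test functions. -/
theorem ae_tendsto_average_kernel [IsFiniteMeasure π] [IsMarkovKernel κ] (hπ : π Xᶜ = 0)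
    (hκ : ∀ x ∈ X, κ x (closedBall 0 ρ)ᶜ = 0) :
    ∀ᵐ x ∂π, (∀ r > 0, 0 < π.real (ball x r)) ∧ ∀ φ : Mat m d → ℝ, Continuous φ →
      Tendsto (fun r => (π.real (ball x r))⁻¹ * ∫ y in ball x r, ∫ A, φ A ∂(κ y) ∂π)
        (𝓝[>] 0) (𝓝 (∫ A, φ A ∂(κ x))) := by
  -- A sequence dense for the compact-open topology reduces all continuous test functions to
  -- countably many, hence to one null set.
  set ψ : ℕ → C(Mat m d, ℝ) := TopologicalSpace.denseSeq C(Mat m d, ℝ)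
  have hae := ae_all_iff.2 fun i => (Besicovitch.vitaliFamily π).ae_tendsto_average
    (integrable_integral_kernel hπ hκ (ψ i).continuous).locallyIntegrable
  filter_upwards [hae, Measure.support_mem_ae (μ := π), ae_mem_of_measure_compl hπ]
    with x hx hsupp hxX
  -- Almost every point lies in the support of `π`, so every ball about it has positive mass.
  have hpos : ∀ r > 0, 0 < π.real (ball x r) := fun r hr =>
    ENNReal.toReal_pos ((Measure.mem_support_iff_forall x).1 hsupp _ (ball_mem_nhds x hr)).ne'
      (measure_ne_top _ _)
  refine ⟨hpos, fun φ hφ => ?_⟩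
  have hψ : ∀ i, Tendsto (fun r => (π.real (ball x r))⁻¹ *
      ∫ y in ball x r, ∫ A, ψ i A ∂(κ y) ∂π) (𝓝[>] 0) (𝓝 (∫ A, ψ i A ∂(κ x))) := by
    intro i
    refine tendsto_average_ball (integrable_integral_kernel hπ hκ (ψ i).continuous) hpos ?_
    have := (hx i).comp (Besicovitch.tendsto_filterAt π x)
    refine this.congr fun r => ?_
    rw [Function.comp_apply, setAverage_eq, smul_eq_mul]
  rw [Metric.tendsto_nhds]
  intro ε hε
  -- Approximation on the closed ball of radius `ρ` is enough, because the kernel measures at points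
  -- of `X` are carried by it.
  obtain ⟨i, hi⟩ : ∃ i, ∀ A, ‖A‖ ≤ ρ → |φ A - ψ i A| ≤ ε / 3 := by
    have hopen : IsOpen {f : C(Mat m d, ℝ) |
        MapsTo (f - (⟨φ, hφ⟩ : C(Mat m d, ℝ))) (closedBall 0 ρ) (ball 0 (ε / 3))} :=
      (ContinuousMap.isOpen_setOfPred_mapsTo (isCompact_closedBall 0 ρ) isOpen_ball).preimage
        (continuous_sub_right _)
    obtain ⟨i, hf⟩ := (TopologicalSpace.denseRange_denseSeq
      C(Mat m d, ℝ)).exists_mem_open hopen ⟨⟨φ, hφ⟩, fun A _ => by simpa using hε⟩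
    refine ⟨i, fun A hA => ?_⟩
    have := hf (by simpa using hA : A ∈ closedBall 0 ρ)
    rw [mem_ball_zero_iff, Real.norm_eq_abs] at this
    rw [abs_sub_comm]
    exact this.le
  filter_upwards [Metric.tendsto_nhds.1 (hψ i) (ε / 3) (by positivity), self_mem_nhdsWithin]
    with r hr hr0
  have hr0' : 0 < r := hr0
  have h1 : |(π.real (ball x r))⁻¹ * (∫ y in ball x r, ∫ A, φ A ∂(κ y) ∂π) -
      (π.real (ball x r))⁻¹ * ∫ y in ball x r, ∫ A, ψ i A ∂(κ y) ∂π| ≤ ε / 3 := by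
    rw [← mul_sub, abs_mul, abs_of_nonneg (inv_nonneg.2 (hpos r hr0').le),
      ← integral_sub (integrable_integral_kernel hπ hκ hφ).integrableOn
        (integrable_integral_kernel hπ hκ (ψ i).continuous).integrableOn,
      inv_mul_le_iff₀ (hpos r hr0')]
    have := norm_integral_le_of_norm_le_const (μ := π.restrict (ball x r))
      (f := fun y => (∫ A, φ A ∂(κ y)) - ∫ A, ψ i A ∂(κ y)) (C := ε / 3) (by
        filter_upwards [ae_restrict_of_ae (ae_mem_of_measure_compl hπ)] with y hy using
          abs_integral_sub_le_of_carrier (hκ y hy) hφ (ψ i).continuous hi)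
    rw [mul_comm]
    simpa using this
  have h2 := abs_integral_sub_le_of_carrier (hκ x hxX) hφ (ψ i).continuous hi
  rw [Real.dist_eq] at hr ⊢
  rw [abs_le] at h1 h2
  rw [abs_lt] at hr ⊢
  constructor <;> linarith [h1.1, h1.2, h2.1, h2.2, hr.1, hr.2]

/-! ### Limits of the localized integrals -/

theorem ae_compProd_carrier [IsFiniteMeasure π] [IsMarkovKernel κ] (hX : IsClosed X)
    (hπ : π Xᶜ = 0) (hκ : ∀ x ∈ X, κ x (closedBall 0 ρ)ᶜ = 0) :
    ∀ᵐ p ∂(π ⊗ₘ κ), p.1 ∈ X ∧ ‖p.2‖ ≤ ρ := by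
  refine Measure.ae_compProd_of_ae_ae ?_ ?_
  · exact (hX.measurableSet.preimage measurable_fst).inter
      (measurableSet_le measurable_snd.norm measurable_const)
  · filter_upwards [ae_mem_of_measure_compl hπ] with y hy
    filter_upwards [ae_mem_of_measure_compl (hκ y hy)] with A hA
    exact ⟨hy, by simpa using hA⟩

/-- Removing the cut-off functions. -/
theorem tendsto_integral_cutoff [IsFiniteMeasure π] [IsMarkovKernel κ] (hX : IsClosed X)
    (hπ : π Xᶜ = 0) (hκ : ∀ x ∈ X, κ x (closedBall 0 ρ)ᶜ = 0)
    {q : ℝ × (Vec d →L[ℝ] Vec d) × Mat m d → ℝ}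
    (hq : ContinuousOn q {p | p.2.1.det ≠ 0}) {𝒦 : Set (Vec d →L[ℝ] Vec d)} (h𝒦 : IsCompact 𝒦)
    (hdet : ∀ D ∈ 𝒦, D.det ≠ 0) {B : Set (Vec d)} (hB : MeasurableSet B)
    {γ : Vec d → Vec d} (hγ : ContinuousOn γ B) (hγB : ∀ y ∈ B, γ y ∈ ball 0 1)
    {P : Vec d → Vec d →L[ℝ] Vec d} (hP : ContinuousOn P B) (hPB : ∀ y ∈ B, P y ∈ 𝒦)
    {θ : ℕ → Vec d → ℝ} (hθ : IsCutoffSequence θ) :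
    Tendsto (fun k => ∫ p in B ×ˢ univ, q (θ k (γ p.1), P p.1, p.2) ∂(π ⊗ₘ κ)) atTop
      (𝓝 (∫ p in B ×ˢ univ, q (1, P p.1, p.2) ∂(π ⊗ₘ κ))) := by
  obtain ⟨C, hC⟩ := hθ.bounded
  -- Almost all arguments of `q` lie in this compact set, independently of `k`, which provides the
  -- constant dominating function.
  have hcomp : IsCompact (Icc (-C) C ×ˢ 𝒦 ×ˢ closedBall (0 : Mat m d) ρ) :=
    isCompact_Icc.prod (h𝒦.prod (isCompact_closedBall _ _))
  obtain ⟨M, hM⟩ := hcomp.exists_bound_of_continuousOn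
    (hq.mono fun p hp => hdet _ hp.2.1)
  have hBm : MeasurableSet (B ×ˢ (univ : Set (Mat m d))) := hB.prod MeasurableSet.univ
  refine tendsto_integral_of_dominated_convergence (fun _ => M) (fun k => ?_)
    (integrable_const M) (fun k => ?_) ?_
  · refine ContinuousOn.aestronglyMeasurable ?_ hBm
    refine hq.comp (t := {p : ℝ × (Vec d →L[ℝ] Vec d) × Mat m d | p.2.1.det ≠ 0})
      (f := fun p : Vec d × Mat m d => (θ k (γ p.1), P p.1, p.2)) ?_
      fun p hp => hdet _ (hPB _ hp.1)
    have hfst : MapsTo (Prod.fst : Vec d × Mat m d → Vec d) (B ×ˢ univ) B := fun p hp => hp.1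
    exact ((hθ.contDiff k).continuous.comp_continuousOn
      (hγ.comp continuousOn_fst hfst)).prodMk
      ((hP.comp continuousOn_fst hfst).prodMk continuousOn_snd)
  · filter_upwards [ae_restrict_mem hBm, ae_restrict_of_ae (ae_compProd_carrier hX hπ hκ)]
      with p hp hp'
    refine hM _ ⟨abs_le.1 (hC k _), hPB _ hp.1, by simpa using hp'.2⟩
  · filter_upwards [ae_restrict_mem hBm] with p hp
    have h1 : ContinuousAt q (1, P p.1, p.2) := by
      refine hq.continuousAt (IsOpen.mem_nhds ?_ (hdet _ (hPB _ hp.1)))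
      exact isOpen_ne.preimage
        (ContinuousLinearMap.continuous_det.comp (continuous_fst.comp continuous_snd))
    refine h1.tendsto.comp (Tendsto.prodMk_nhds ?_ tendsto_const_nhds)
    have := hθ.tendsto (γ p.1)
    rwa [indicator_of_mem (hγB _ hp.1)] at this

/-- Concentration at a Lebesgue point. -/
theorem tendsto_average_transported [IsFiniteMeasure π] [IsMarkovKernel κ] (hX : IsClosed X)
    (hπ : π Xᶜ = 0) (hκ : ∀ x ∈ X, κ x (closedBall 0 ρ)ᶜ = 0)
    {q : (Vec d →L[ℝ] Vec d) × Mat m d → ℝ} (hq : ContinuousOn q {p | p.1.det ≠ 0})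
    {x : Vec d} (hpos : ∀ r > 0, 0 < π.real (ball x r))
    (hx : ∀ φ : Mat m d → ℝ, Continuous φ →
      Tendsto (fun r => (π.real (ball x r))⁻¹ * ∫ y in ball x r, ∫ A, φ A ∂(κ y) ∂π)
        (𝓝[>] 0) (𝓝 (∫ A, φ A ∂(κ x))))
    {P : ℝ → Vec d → Vec d →L[ℝ] Vec d} (hP : ∀ᶠ r in 𝓝[>] (0 : ℝ), ContinuousOn (P r) (ball x r ∩ X))
    (hPid : ∀ ε > 0, ∀ᶠ r in 𝓝[>] (0 : ℝ), ∀ y ∈ ball x r ∩ X,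
      ‖P r y - ContinuousLinearMap.id ℝ (Vec d)‖ ≤ ε) :
    Tendsto (fun r => (π.real (ball x r ∩ X))⁻¹ *
        ∫ p in (ball x r ∩ X) ×ˢ univ, q (P r p.1, p.2) ∂(π ⊗ₘ κ)) (𝓝[>] 0)
      (𝓝 (∫ A, q (ContinuousLinearMap.id ℝ (Vec d), A) ∂(κ x))) := by
  set I := ContinuousLinearMap.id ℝ (Vec d) with hI
  have hdetI : I.det ≠ 0 := by
    have := det_smul_id (d := d) 1
    rw [one_smul, one_pow] at this
    rw [hI, this]; exact one_ne_zero
  have hopen : IsOpen {p : (Vec d →L[ℝ] Vec d) × Mat m d | p.1.det ≠ 0} :=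
    isOpen_ne.preimage (ContinuousLinearMap.continuous_det.comp continuous_fst)
  have hφ : Continuous fun A : Mat m d => q (I, A) :=
    hq.comp_continuous (.prodMk_right I) fun _ => hdetI
  have hBX : ∀ r, (ball x r ∩ X : Set (Vec d)) =ᵐ[π] (ball x r : Set (Vec d)) := fun r => by
    filter_upwards [ae_mem_of_measure_compl hπ] with y hy
    exact propext ⟨fun h => h.1, fun h => ⟨h, hy⟩⟩
  have hreal : ∀ r, π.real (ball x r ∩ X) = π.real (ball x r) := fun r =>
    measureReal_congr (hBX r)
  have hBm : ∀ r, MeasurableSet (ball x r ∩ X) := fun r =>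
    isOpen_ball.measurableSet.inter hX.measurableSet
  have hBm' : ∀ r, MeasurableSet ((ball x r ∩ X) ×ˢ (univ : Set (Mat m d))) := fun r =>
    (hBm r).prod MeasurableSet.univ
  have hcar := ae_compProd_carrier hX hπ hκ
  obtain ⟨M, -, hM⟩ := exists_bound_on_closedBall hφ ρ
  have hint : Integrable (fun p : Vec d × Mat m d => q (I, p.2)) (π ⊗ₘ κ) := by
    refine Integrable.of_bound (hφ.comp continuous_snd).aestronglyMeasurable M ?_
    filter_upwards [hcar] with p hp using hM _ hp.2
  have hmain : ∀ r, ∫ p in (ball x r ∩ X) ×ˢ univ, q (I, p.2) ∂(π ⊗ₘ κ) =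
      ∫ y in ball x r, ∫ A, q (I, A) ∂(κ y) ∂π := fun r => by
    rw [Measure.setIntegral_compProd (hBm r) MeasurableSet.univ hint.integrableOn,
      setIntegral_congr_set (hBX r)]
    simp only [Measure.restrict_univ]
  have hlim := hx _ hφ
  rw [Metric.tendsto_nhds] at hlim ⊢
  intro ε hε
  -- Compactness of the ball makes `q(D, ·)` uniformly close to `q(I, ·)` for `D` near the identity.
  -- The averages may thus be computed with `P r` replaced by the identity, where the Lebesgue point
  -- property applies.
  have hunif : ∀ᶠ D in 𝓝 I, ∀ A ∈ closedBall (0 : Mat m d) ρ, |q (D, A) - q (I, A)| ≤ ε / 4 := by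
    refine (isCompact_closedBall (0 : Mat m d) ρ).eventually_forall_of_forall_eventually
      (P := fun D A => |q (D, A) - q (I, A)| ≤ ε / 4) fun A _ => ?_
    have h1 : ContinuousAt q (I, A) := hq.continuousAt (hopen.mem_nhds hdetI)
    have h2 : ContinuousAt (fun z : (Vec d →L[ℝ] Vec d) × Mat m d => |q (z.1, z.2) - q (I, z.2)|)
        (I, A) := (h1.sub (hφ.comp continuous_snd).continuousAt).abs
    have h3 := h2.tendsto.eventually
      (gt_mem_nhds (show |q (I, A) - q (I, A)| < ε / 4 by simpa using hε))
    filter_upwards [h3] with z hz using hz.le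
  obtain ⟨δ, hδ, hδq⟩ := Metric.eventually_nhds_iff.1
    (hunif.and ((isOpen_ne.preimage ContinuousLinearMap.continuous_det).mem_nhds hdetI))
  filter_upwards [hlim (ε / 2) (half_pos hε), hP, hPid (δ / 2) (half_pos hδ),
    self_mem_nhdsWithin] with r hr hPr hPr' hr0
  have hr0' : 0 < r := hr0
  have hδP : ∀ y ∈ ball x r ∩ X, dist (P r y) I < δ := fun y hy => by
    rw [dist_eq_norm]
    exact (hPr' _ hy).trans_lt (half_lt_self hδ)
  have hd : ∀ᵐ p ∂((π ⊗ₘ κ).restrict ((ball x r ∩ X) ×ˢ univ)),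
      |q (P r p.1, p.2) - q (I, p.2)| ≤ ε / 4 := by
    filter_upwards [ae_restrict_mem (hBm' r), ae_restrict_of_ae hcar] with p hp hp'
    exact (hδq (hδP _ hp.1)).1 _ (by simpa using hp'.2)
  have hm1 : AEStronglyMeasurable (fun p : Vec d × Mat m d => q (P r p.1, p.2))
      ((π ⊗ₘ κ).restrict ((ball x r ∩ X) ×ˢ univ)) := by
    refine ContinuousOn.aestronglyMeasurable ?_ (hBm' r)
    refine hq.comp (t := {p : (Vec d →L[ℝ] Vec d) × Mat m d | p.1.det ≠ 0})
      (f := fun p : Vec d × Mat m d => (P r p.1, p.2)) ?_ fun p hp => (hδq (hδP _ hp.1)).2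
    exact (hPr.comp continuousOn_fst fun p hp => hp.1).prodMk continuousOn_snd
  have hint1 : IntegrableOn (fun p : Vec d × Mat m d => q (P r p.1, p.2))
      ((ball x r ∩ X) ×ˢ univ) (π ⊗ₘ κ) := by
    have h1 : Integrable (fun p : Vec d × Mat m d => q (P r p.1, p.2) - q (I, p.2))
        ((π ⊗ₘ κ).restrict ((ball x r ∩ X) ×ˢ univ)) :=
      Integrable.of_bound (hm1.sub hint.aestronglyMeasurable.restrict) (ε / 4) hd
    exact (h1.add hint.integrableOn).congr (Eventually.of_forall fun p => by simp)
  have hreal' : (π ⊗ₘ κ).real ((ball x r ∩ X) ×ˢ univ) = π.real (ball x r) := by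
    rw [← hreal, Measure.real, Measure.real, Measure.compProd_apply_prod (hBm r) MeasurableSet.univ]
    simp
  have hle := norm_integral_le_of_norm_le_const
    (f := fun p : Vec d × Mat m d => q (P r p.1, p.2) - q (I, p.2)) hd
  rw [integral_sub hint1 hint.integrableOn, hmain, measureReal_restrict_apply_univ, hreal',
    Real.norm_eq_abs] at hle
  have hclose : |(π.real (ball x r))⁻¹ *
      (∫ p in (ball x r ∩ X) ×ˢ univ, q (P r p.1, p.2) ∂(π ⊗ₘ κ)) -
      (π.real (ball x r))⁻¹ * ∫ y in ball x r, ∫ A, q (I, A) ∂(κ y) ∂π| ≤ ε / 4 := by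
    rw [← mul_sub, abs_mul, abs_of_nonneg (inv_nonneg.2 (hpos r hr0').le),
      inv_mul_le_iff₀ (hpos r hr0'), mul_comm]
    exact hle
  rw [hreal]
  rw [Real.dist_eq] at hr ⊢
  rw [abs_le] at hclose
  rw [abs_lt] at hr ⊢
  constructor <;> linarith [hclose.1, hclose.2, hr.1, hr.2]

end Lebesgue

end FreeBoundary

end

noncomputable section

namespace FreeBoundary

variable {m d : ℕ}

/-! ### Half-balls -/

theorem isOpen_halfBall (ν : Vec d) : IsOpen (halfBall ν) := by
  have h : IsOpen {x : Vec d | ⟪x, ν⟫_ℝ < 0} := isOpen_lt (by fun_prop) continuous_const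
  exact isOpen_ball.inter h

theorem convex_halfBall (ν : Vec d) : Convex ℝ (halfBall ν) := by
  refine (convex_ball 0 1).inter ?_
  have : IsLinearMap ℝ fun x : Vec d => ⟪x, ν⟫_ℝ :=
    ⟨fun x y => inner_add_left x y ν, fun c x => real_inner_smul_left x ν c⟩
  exact convex_halfSpace_lt this 0

theorem convex_halfBallFlat (ν : Vec d) : Convex ℝ (halfBallFlat ν) := by
  refine (convex_ball 0 1).inter ?_
  have : IsLinearMap ℝ fun x : Vec d => ⟪x, ν⟫_ℝ :=
    ⟨fun x y => inner_add_left x y ν, fun c x => real_inner_smul_left x ν c⟩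
  exact convex_halfSpace_le this 0

theorem halfBall_subset_flat (ν : Vec d) : halfBall ν ⊆ halfBallFlat ν :=
  fun _ hx => ⟨hx.1, hx.2.le⟩

theorem isBounded_halfBall (ν : Vec d) : Bornology.IsBounded (halfBall ν) :=
  isBounded_ball.subset fun _ hx => hx.1

theorem nonempty_halfBall {ν : Vec d} (hν : ‖ν‖ = 1) : (halfBall ν).Nonempty := by
  refine ⟨-(1 / 2 : ℝ) • ν, ?_, ?_⟩
  · rw [mem_ball_zero_iff, norm_smul, hν]; norm_num
  · rw [real_inner_smul_left, real_inner_self_eq_norm_sq, hν]; norm_num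

theorem uniqueDiffOn_halfBallFlat {ν : Vec d} (hν : ‖ν‖ = 1) : UniqueDiffOn ℝ (halfBallFlat ν) :=
  uniqueDiffOn_convex (convex_halfBallFlat ν) ((nonempty_halfBall hν).mono
    (interior_maximal (halfBall_subset_flat ν) (isOpen_halfBall ν)))

theorem volume_flat_face {ν : Vec d} (hν : ‖ν‖ = 1) : volume (halfBallFlat ν \ halfBall ν) = 0 := by
  have hsub : halfBallFlat ν \ halfBall ν ⊆ (ℝ ∙ ν)ᗮ := by
    rintro x ⟨hx, hx'⟩
    rw [SetLike.mem_coe, Submodule.mem_orthogonal_singleton_iff_inner_left]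
    by_contra h
    exact hx' ⟨hx.1, lt_of_le_of_ne hx.2 h⟩
  refine measure_mono_null hsub (Measure.addHaar_submodule _ _ fun h => ?_)
  have h1 : ν ∈ (ℝ ∙ ν)ᗮ := h ▸ Submodule.mem_top
  rw [Submodule.mem_orthogonal_singleton_iff_inner_left, real_inner_self_eq_norm_sq, hν] at h1
  norm_num at h1

/-! ### Domains of class `C¹` are regular open sets -/

/-- At a boundary point the defining function is positive a little way along the outer normal. Near
such points there is nothing of `Ω`, so a boundary point is never interior to the closure. -/
theorem IsBoundedC1Domain.interior_closure_subset {Ω : Set (Vec d)} (hΩ : IsBoundedC1Domain Ω) :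
    interior (closure Ω) ⊆ Ω := by
  intro x hx
  by_contra hxΩ
  have hfr : x ∈ frontier Ω := ⟨interior_subset hx, by rwa [hΩ.isOpen.interior_eq]⟩
  obtain ⟨ν, hν, V, ρ, hV, hxV, hρ, hρx, hgrad, hΩV⟩ := hΩ.exists_normal x hfr
  have hlo := hgrad.hasFDerivAt.isLittleO.def (show (0 : ℝ) < 1 / 2 by norm_num)
  have hline : Tendsto (fun t : ℝ => x + t • ν) (𝓝[>] 0) (𝓝 x) := by
    have : Continuous fun t : ℝ => x + t • ν := by fun_prop
    have := this.tendsto 0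
    rw [zero_smul, add_zero] at this
    exact this.mono_left nhdsWithin_le_nhds
  have hev := hline.eventually ((hlo.and (hV.mem_nhds hxV)).and
    (isOpen_interior.mem_nhds hx))
  obtain ⟨t, ⟨⟨h1, h2⟩, h3⟩, ht⟩ := (hev.and self_mem_nhdsWithin).exists
  have ht0 : 0 < t := ht
  have hpos : 0 < ρ (x + t • ν) := by
    rw [add_sub_cancel_left, hρx, sub_zero, InnerProductSpace.toDual_apply_apply,
      real_inner_smul_right, real_inner_self_eq_norm_sq, norm_smul, hν, Real.norm_eq_abs,
      Real.norm_eq_abs, abs_of_pos ht0] at h1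
    have := (abs_le.1 h1).1
    linarith
  have hcont : ContinuousAt ρ (x + t • ν) :=
    hρ.continuousOn.continuousAt (hV.mem_nhds h2)
  have hnear : ∀ᶠ z in 𝓝 (x + t • ν), 0 < ρ z ∧ z ∈ V :=
    (hcont.tendsto.eventually (lt_mem_nhds hpos)).and (hV.mem_nhds h2)
  obtain ⟨z, hz, hzΩ⟩ := mem_closure_iff_nhds.1 (interior_subset h3) _ hnear
  have : z ∈ Ω ∩ V := ⟨hzΩ, hz.2⟩
  rw [hΩV] at this
  exact lt_asymm this.2 hz.1

/-! ### Boundary charts -/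

/-- The map `x ↦ x₀ + r f_r(x)` at a fixed scale `r`, with its derivative `r D` and inverse `γ`. -/
structure BoundaryChart (Ω : Set (Vec d)) (x₀ ν : Vec d) (r δ : ℝ) (Φ : Vec d → Vec d)
    (D : Vec d → Vec d →L[ℝ] Vec d) (γ : Vec d → Vec d) : Prop where
  pos : 0 < r
  regular : RegularMap (halfBall ν) Ω Φ fun x => r • D x
  bijOn : BijOn Φ (halfBallFlat ν) (relBall Ω x₀ r)
  continuousOn_map : ContinuousOn Φ (halfBallFlat ν)
  continuousOn_deriv : ContinuousOn D (halfBallFlat ν)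
  deriv_close : ∀ x ∈ halfBallFlat ν, ‖D x - ContinuousLinearMap.id ℝ (Vec d)‖ ≤ δ
  continuousOn_inv : ContinuousOn γ (relBall Ω x₀ r)
  left_inv : ∀ x ∈ halfBallFlat ν, γ (Φ x) = x
  null : volume ((Ω ∩ ball x₀ r) \ Φ '' halfBall ν) = 0

theorem exists_det_ne_zero : ∃ δ > 0, δ ≤ (1 : ℝ) ∧ ∀ D : Vec d →L[ℝ] Vec d,
    ‖D - ContinuousLinearMap.id ℝ (Vec d)‖ ≤ δ → D.det ≠ 0 := by
  have hI : (ContinuousLinearMap.id ℝ (Vec d)).det ≠ 0 := by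
    have := det_smul_id (d := d) 1
    rw [one_smul, one_pow] at this
    rw [this]; exact one_ne_zero
  obtain ⟨ε, hε, h⟩ := Metric.mem_nhds_iff.1
    ((isOpen_ne.preimage ContinuousLinearMap.continuous_det).mem_nhds hI)
  refine ⟨min (ε / 2) 1, by positivity, min_le_right _ _, fun D hD => h ?_⟩
  rw [mem_ball, dist_eq_norm]
  exact (hD.trans (min_le_left _ _)).trans_lt (half_lt_self hε)

/-- A straightening only relates the half-ball with its flat face to a piece of `closure Ω`. That
the open half-ball is mapped into `Ω` itself follows since its image is open, by the inverse
function theorem, and `Ω` is the interior of its closure. -/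
theorem IsStraightening.eventually_boundaryChart {Ω : Set (Vec d)} (hΩ : IsBoundedC1Domain Ω)
    {x₀ ν : Vec d} (hν : ‖ν‖ = 1) {f g : ℝ → Vec d → Vec d} (h : IsStraightening Ω x₀ ν f g)
    {δ : ℝ} (hδ : 0 < δ) (hdet : ∀ D : Vec d →L[ℝ] Vec d,
      ‖D - ContinuousLinearMap.id ℝ (Vec d)‖ ≤ δ → D.det ≠ 0) :
    ∀ᶠ r in 𝓝[>] (0 : ℝ), BoundaryChart Ω x₀ ν r δ (fun x => x₀ + r • f r x)
      (fun x => fderivWithin ℝ (f r) (halfBallFlat ν) x) (fun y => g r (r⁻¹ • (y - x₀))) := by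
  filter_upwards [h.bijOn, h.left_inv, h.contDiffOn, h.contDiffOn_inv, h.close δ hδ,
    self_mem_nhdsWithin] with r hbij hleft hC hCinv hclose hr
  have hr0 : 0 < r := hr
  have hud := uniqueDiffOn_halfBallFlat hν
  have hDc : ContinuousOn (fun x => fderivWithin ℝ (f r) (halfBallFlat ν) x) (halfBallFlat ν) :=
    hC.continuousOn_fderivWithin hud le_rfl
  have hdiff : DifferentiableOn ℝ (f r) (halfBallFlat ν) := hC.differentiableOn one_ne_zero
  have hΦbij : BijOn (fun x => x₀ + r • f r x) (halfBallFlat ν) (relBall Ω x₀ r) := by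
    refine ⟨fun x hx => hbij.mapsTo hx, fun x hx y hy hxy => hbij.injOn hx hy ?_, fun y hy => ?_⟩
    · exact smul_right_injective _ hr0.ne' (add_left_cancel hxy)
    · have : r⁻¹ • (y - x₀) ∈ blowUp Ω x₀ r := by
        change x₀ + r • (r⁻¹ • (y - x₀)) ∈ relBall Ω x₀ r
        rw [smul_inv_smul₀ hr0.ne', add_sub_cancel]; exact hy
      obtain ⟨x, hx, hxy⟩ := hbij.surjOn this
      refine ⟨x, hx, ?_⟩
      simp only [hxy, smul_inv_smul₀ hr0.ne', add_sub_cancel]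
  have hΦd : DifferentiableOn ℝ (fun x => x₀ + r • f r x) (halfBallFlat ν) :=
    (hdiff.const_smul r).const_add x₀
  have hreg : ∀ S : Set (Vec d), IsOpen S → MapsTo (fun x => x₀ + r • f r x) (halfBall ν) S →
      RegularMap (halfBall ν) S (fun x => x₀ + r • f r x)
        (fun x => r • fderivWithin ℝ (f r) (halfBallFlat ν) x) := fun S hS hmaps =>
    { isOpen_source := isOpen_halfBall ν
      isOpen_target := hS
      mapsTo := hmaps
      injOn := hΦbij.injOn.mono (halfBall_subset_flat ν)
      hasFDerivAt := fun x hx => by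
        have hnhds : halfBallFlat ν ∈ 𝓝 x :=
          mem_of_superset ((isOpen_halfBall ν).mem_nhds hx) (halfBall_subset_flat ν)
        have h1 := (hdiff x (halfBall_subset_flat ν hx)).hasFDerivWithinAt.hasFDerivAt hnhds
        exact (h1.const_smul r).const_add x₀
      continuousOn := (hDc.mono (halfBall_subset_flat ν)).const_smul r
      det_ne := fun x hx => by
        rw [det_smul_vec]
        exact mul_ne_zero (pow_ne_zero _ hr0.ne')
          (hdet _ (hclose x (halfBall_subset_flat ν hx)).2) }
  have hmapsΩ : MapsTo (fun x => x₀ + r • f r x) (halfBall ν) Ω := by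
    have h1 := (hreg univ isOpen_univ (mapsTo_univ _ _)).isOpen_image
    have h2 : (fun x => x₀ + r • f r x) '' halfBall ν ⊆ closure Ω := by
      rintro _ ⟨x, hx, rfl⟩
      exact (hΦbij.mapsTo (halfBall_subset_flat ν hx)).2
    exact fun x hx => hΩ.interior_closure_subset (interior_maximal h2 h1 (mem_image_of_mem _ hx))
  have hγ : ∀ x ∈ halfBallFlat ν, g r (r⁻¹ • (x₀ + r • f r x - x₀)) = x := fun x hx => by
    rw [add_sub_cancel_left, inv_smul_smul₀ hr0.ne', hleft x hx]
  refine ⟨hr0, hreg Ω hΩ.isOpen hmapsΩ, hΦbij, hΦd.continuousOn, hDc,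
    fun x hx => (hclose x hx).2, ?_, hγ, ?_⟩
  · refine hCinv.continuousOn.comp (by fun_prop) fun y hy => ?_
    change x₀ + r • (r⁻¹ • (y - x₀)) ∈ relBall Ω x₀ r
    rw [smul_inv_smul₀ hr0.ne', add_sub_cancel]; exact hy
  -- What the open half-ball misses in `Ω ∩ ball x₀ r` comes from the flat face, a null set, and
  -- differentiable maps preserve null sets.
  · refine measure_mono_null (t := (fun x => x₀ + r • f r x) '' (halfBallFlat ν \ halfBall ν)) ?_
      (addHaar_image_eq_zero_of_differentiableOn_of_addHaar_eq_zero _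
        (hΦd.mono sdiff_subset) (volume_flat_face hν))
    rintro y ⟨⟨hyΩ, hyb⟩, hy⟩
    obtain ⟨x, hx, rfl⟩ := hΦbij.surjOn (⟨hyb, subset_closure hyΩ⟩ : y ∈ relBall Ω x₀ r)
    exact ⟨x, ⟨hx, fun hx' => hy (mem_image_of_mem _ hx')⟩, rfl⟩

namespace BoundaryChart

variable {Ω : Set (Vec d)} {x₀ ν : Vec d} {r δ : ℝ} {Φ : Vec d → Vec d}
  {D : Vec d → Vec d →L[ℝ] Vec d} {γ : Vec d → Vec d}

theorem inv_mem (h : BoundaryChart Ω x₀ ν r δ Φ D γ) {y : Vec d} (hy : y ∈ relBall Ω x₀ r) :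
    γ y ∈ halfBallFlat ν := by
  obtain ⟨x, hx, rfl⟩ := h.bijOn.surjOn hy
  rwa [h.left_inv x hx]

theorem right_inv (h : BoundaryChart Ω x₀ ν r δ Φ D γ) {y : Vec d} (hy : y ∈ relBall Ω x₀ r) :
    Φ (γ y) = y := by
  obtain ⟨x, hx, rfl⟩ := h.bijOn.surjOn hy
  rw [h.left_inv x hx]

theorem continuousOn_deriv_inv (h : BoundaryChart Ω x₀ ν r δ Φ D γ) :
    ContinuousOn (fun y => D (γ y)) (relBall Ω x₀ r) :=
  h.continuousOn_deriv.comp h.continuousOn_inv fun _ hy => h.inv_mem hy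

theorem norm_deriv_le (h : BoundaryChart Ω x₀ ν r δ Φ D γ) (hδ : δ ≤ 1) {x : Vec d}
    (hx : x ∈ halfBallFlat ν) : ‖D x‖ ≤ 2 := by
  have h1 := norm_add_le (D x - ContinuousLinearMap.id ℝ (Vec d)) (ContinuousLinearMap.id ℝ (Vec d))
  rw [sub_add_cancel] at h1
  have h2 := h.deriv_close x hx
  have h3 : ‖ContinuousLinearMap.id ℝ (Vec d)‖ ≤ 1 := ContinuousLinearMap.norm_id_le
  linarith

/-- Change of variables in a boundary chart. -/
theorem pow_mul_integral_eq (h : BoundaryChart Ω x₀ ν r δ Φ D γ) (H : Vec d → ℝ)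
    {h' : Vec d → ℝ} (h0 : ∀ y, y ∉ relBall Ω x₀ r → h' y = 0)
    (hH : ∀ y ∈ relBall Ω x₀ r, h' y = |(D (γ y)).det|⁻¹ * H (γ y)) :
    r ^ d * ∫ x in halfBall ν, H x = ∫ y in Ω, h' y := by
  rw [h.regular.integral_eq (γ := γ) (fun x hx => h.left_inv x (halfBall_subset_flat ν hx)),
    ← integral_const_mul]
  have hsub : Φ '' halfBall ν ⊆ relBall Ω x₀ r := by
    rintro _ ⟨x, hx, rfl⟩; exact h.bijOn.mapsTo (halfBall_subset_flat ν hx)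
  have e1 : ∫ y in Φ '' halfBall ν, r ^ d * (|(r • D (γ y)).det|⁻¹ * H (γ y)) =
      ∫ y in Φ '' halfBall ν, h' y := by
    refine setIntegral_congr_fun h.regular.isOpen_image.measurableSet fun y hy => ?_
    have hrd : 0 < r ^ d := pow_pos h.pos d
    change r ^ d * (|(r • D (γ y)).det|⁻¹ * H (γ y)) = h' y
    rw [hH y (hsub hy), det_smul_vec, abs_mul, abs_of_pos hrd, mul_inv]
    field_simp
  rw [e1, eq_comm]
  have hΩsub : Φ '' halfBall ν ⊆ Ω := h.regular.mapsTo.image_subset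
  -- Off the image of the half-ball the integrand vanishes outside `relBall Ω x₀ r`, and only a null
  -- part of `Ω` is left inside.
  refine setIntegral_eq_of_subset_of_ae_sdiff_eq_zero
    h.regular.isOpen_target.measurableSet.nullMeasurableSet hΩsub ?_
  have hn : ∀ᵐ y, y ∉ (Ω ∩ ball x₀ r) \ Φ '' halfBall ν := measure_eq_zero_iff_ae_notMem.1 h.null
  filter_upwards [hn] with y hy hy'
  refine h0 y fun hyr => hy ⟨⟨hy'.1, hyr.1⟩, hy'.2⟩

end BoundaryChart

end FreeBoundary

end

noncomputable section

namespace FreeBoundary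

variable {m d : ℕ}

/-! ### Test functions which are continuous on a compact set only -/

/-- Tietze's theorem. The generating property is stated for globally continuous test functions,
while the localized integrands are continuous only over the closure of the domain; values elsewhere
do not matter. -/
theorem exists_continuous_extension {X : Set (Vec d)} (hX : IsClosed X)
    {h : Vec d × Mat m d → ℝ} (hh : ContinuousOn h (X ×ˢ univ)) :
    ∃ H : Vec d × Mat m d → ℝ, Continuous H ∧ ∀ x ∈ X, ∀ A, H (x, A) = h (x, A) := by
  obtain ⟨H, hH⟩ := ContinuousMap.exists_restrict_eq (hX.prod isClosed_univ)
    (⟨(X ×ˢ univ).domRestrict h, hh.domRestrict⟩ : C(X ×ˢ (univ : Set (Mat m d)), ℝ))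
  refine ⟨H, H.continuous, fun x hx A => ?_⟩
  exact DFunLike.congr_fun hH (⟨(x, A), hx, mem_univ A⟩ : X ×ˢ (univ : Set (Mat m d)))

theorem exists_bound_on_prod {X : Set (Vec d)} (hX : IsCompact X) {H : Vec d × Mat m d → ℝ}
    (hH : Continuous H) (ρ : ℝ) : ∃ M, ∀ x ∈ X, ∀ A, ‖A‖ ≤ ρ → ‖H (x, A)‖ ≤ M := by
  obtain ⟨M, hM⟩ := (hX.prod (isCompact_closedBall (0 : Mat m d) ρ)).exists_bound_of_continuousOn
    hH.continuousOn
  exact ⟨M, fun x hx A hA => hM _ ⟨hx, by simpa using hA⟩⟩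

theorem integrable_test_mul {Ω : Set (Vec d)} (hΩ : IsOpen Ω) (hX : IsCompact (closure Ω))
    {h : Vec d × Mat m d → ℝ} (hh : ContinuousOn h (closure Ω ×ˢ univ)) {ρ : ℝ}
    {Z : Vec d → Mat m d} (hZ : AEStronglyMeasurable Z (volume.restrict Ω))
    (hZρ : ∀ᵐ x ∂(volume.restrict Ω), ‖Z x‖ ≤ ρ) {p : Vec d → ℝ}
    (hp : IntegrableOn p Ω) : IntegrableOn (fun x => h (x, Z x) * p x) Ω := by
  obtain ⟨H, hH, hHh⟩ := exists_continuous_extension isClosed_closure hh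
  obtain ⟨M, hM⟩ := exists_bound_on_prod hX hH ρ
  have h1 : IntegrableOn (fun x => H (x, Z x) * p x) Ω := by
    refine hp.bdd_mul (c := M)
      (hH.comp_aestronglyMeasurable (aestronglyMeasurable_id.prodMk hZ)) ?_
    filter_upwards [ae_restrict_mem hΩ.measurableSet, hZρ] with x hx hx'
      using hM x (subset_closure hx) _ hx'
  refine h1.congr_fun (fun x hx => ?_) hΩ.measurableSet
  simp only [hHh x (subset_closure hx)]

theorem tendsto_integral_test {Ω : Set (Vec d)} (hΩ : IsOpen Ω) (hX : IsCompact (closure Ω))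
    {ρ : ℝ} {π : Measure (Vec d)} {κ : Kernel (Vec d) (Mat m d)} [IsFiniteMeasure π]
    [IsMarkovKernel κ] (hπ : π (closure Ω)ᶜ = 0)
    (hκ : ∀ x ∈ closure Ω, κ x (closedBall 0 ρ)ᶜ = 0) {Z : ℕ → Vec d → Mat m d}
    {p : ℕ → Vec d → ℝ}
    (hgen : ∀ f : Vec d × Mat m d → ℝ, Continuous f →
      Tendsto (fun n => ∫ x in Ω, f (x, Z n x) * p n x) atTop
        (𝓝 (∫ x, ∫ A, f (x, A) ∂(κ x) ∂π)))
    {h : Vec d × Mat m d → ℝ} (hh : ContinuousOn h (closure Ω ×ˢ univ)) :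
    Tendsto (fun n => ∫ x in Ω, h (x, Z n x) * p n x) atTop (𝓝 (∫ z, h z ∂(π ⊗ₘ κ))) := by
  obtain ⟨H, hH, hHh⟩ := exists_continuous_extension isClosed_closure hh
  obtain ⟨M, hM⟩ := exists_bound_on_prod hX hH ρ
  have hcar := ae_compProd_carrier isClosed_closure hπ hκ
  have hint : Integrable H (π ⊗ₘ κ) := by
    refine Integrable.of_bound hH.aestronglyMeasurable M ?_
    filter_upwards [hcar] with z hz using hM z.1 hz.1 z.2 hz.2
  have e : ∫ z, h z ∂(π ⊗ₘ κ) = ∫ x, ∫ A, H (x, A) ∂(κ x) ∂π := by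
    rw [← Measure.integral_compProd hint]
    refine integral_congr_ae ?_
    filter_upwards [hcar] with z hz using (hHh z.1 hz.1 z.2).symm
  rw [e]
  refine (hgen H hH).congr fun n => setIntegral_congr_fun hΩ.measurableSet fun x hx => ?_
  simp only [hHh x (subset_closure hx)]

/-! ### Localization of integrands -/

/-- The integrand `q(θ(γ y), P y, A)` for `y ∈ B`, extended by zero. -/
def localized (q : ℝ × (Vec d →L[ℝ] Vec d) × Mat m d → ℝ) (θ : Vec d → ℝ) (B : Set (Vec d))
    (γ : Vec d → Vec d) (P : Vec d → Vec d →L[ℝ] Vec d) : Vec d × Mat m d → ℝ :=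
  (B ×ˢ univ).indicator fun p => q (θ (γ p.1), P p.1, p.2)

theorem localized_of_mem {q : ℝ × (Vec d →L[ℝ] Vec d) × Mat m d → ℝ} {θ : Vec d → ℝ}
    {B : Set (Vec d)} {γ : Vec d → Vec d} {P : Vec d → Vec d →L[ℝ] Vec d} {y : Vec d}
    (hy : y ∈ B) (A : Mat m d) : localized q θ B γ P (y, A) = q (θ (γ y), P y, A) :=
  indicator_of_mem (show (y, A) ∈ B ×ˢ (univ : Set (Mat m d)) from ⟨hy, mem_univ A⟩) _

theorem localized_of_notMem {q : ℝ × (Vec d →L[ℝ] Vec d) × Mat m d → ℝ} {θ : Vec d → ℝ}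
    {B : Set (Vec d)} {γ : Vec d → Vec d} {P : Vec d → Vec d →L[ℝ] Vec d} {y : Vec d}
    (hy : y ∉ B) (A : Mat m d) : localized q θ B γ P (y, A) = 0 :=
  indicator_of_notMem (fun h : (y, A) ∈ B ×ˢ (univ : Set (Mat m d)) => hy h.1) _

/-- Since `q` vanishes for `θ = 0`, the integrand is supported over the image of `tsupport θ` in the
half-ball with its flat face. This image is compact and stays away from the sphere `|y - x₀| = r`,
so extension by zero is continuous there. The flat face needs no cut-off: continuity is required
relative to `closure Ω` only. -/
theorem BoundaryChart.continuousOn_localized {Ω : Set (Vec d)} {x₀ ν : Vec d} {r δ : ℝ}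
    {Φ : Vec d → Vec d} {D : Vec d → Vec d →L[ℝ] Vec d} {γ : Vec d → Vec d}
    (h : BoundaryChart Ω x₀ ν r δ Φ D γ)
    (hdet : ∀ D : Vec d →L[ℝ] Vec d, ‖D - ContinuousLinearMap.id ℝ (Vec d)‖ ≤ δ → D.det ≠ 0)
    {q : ℝ × (Vec d →L[ℝ] Vec d) × Mat m d → ℝ} (hq : ContinuousOn q {p | p.2.1.det ≠ 0})
    (hq0 : ∀ D A, q (0, D, A) = 0) {θ : Vec d → ℝ} (hθ : Continuous θ)
    (hθs : HasCompactSupport θ) (hθB : tsupport θ ⊆ ball 0 1) :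
    ContinuousOn (localized q θ (relBall Ω x₀ r) γ fun y => D (γ y)) (closure Ω ×ˢ univ) := by
  set L := localized q θ (relBall Ω x₀ r) γ fun y => D (γ y) with hL
  have hcont : ContinuousOn L (relBall Ω x₀ r ×ˢ univ) := by
    have h1 : ContinuousOn (fun p : Vec d × Mat m d => q (θ (γ p.1), D (γ p.1), p.2))
        (relBall Ω x₀ r ×ˢ univ) := by
      have hfst : MapsTo (Prod.fst : Vec d × Mat m d → Vec d) (relBall Ω x₀ r ×ˢ univ)
          (relBall Ω x₀ r) := fun p hp => hp.1
      refine hq.comp (t := {p : ℝ × (Vec d →L[ℝ] Vec d) × Mat m d | p.2.1.det ≠ 0})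
        (f := fun p : Vec d × Mat m d => (θ (γ p.1), D (γ p.1), p.2)) ?_
        fun p hp => hdet _ (h.deriv_close _ (h.inv_mem hp.1))
      exact (hθ.comp_continuousOn (h.continuousOn_inv.comp continuousOn_fst hfst)).prodMk
        ((h.continuousOn_deriv_inv.comp continuousOn_fst hfst).prodMk continuousOn_snd)
    exact h1.congr fun p hp => indicator_of_mem hp _
  set K : Set (Vec d) := Φ '' (tsupport θ ∩ halfBallFlat ν) with hK
  have hKc : IsCompact K := by
    -- Because `tsupport θ` lies in the open unit ball, the intersection is that of a compact set
    -- with a closed half-space.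
    have e : tsupport θ ∩ halfBallFlat ν = tsupport θ ∩ {x | ⟪x, ν⟫_ℝ ≤ 0} := by
      ext x
      exact ⟨fun hx => ⟨hx.1, hx.2.2⟩, fun hx => ⟨hx.1, hθB hx.1, hx.2⟩⟩
    have hcl : IsClosed {x : Vec d | ⟪x, ν⟫_ℝ ≤ 0} := isClosed_le (by fun_prop) continuous_const
    refine IsCompact.image_of_continuousOn ?_ (h.continuousOn_map.mono inter_subset_right)
    rw [e]
    exact hθs.isCompact.inter_right hcl
  have hKB : K ⊆ relBall Ω x₀ r := by
    rintro _ ⟨x, hx, rfl⟩; exact h.bijOn.mapsTo hx.2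
  have hzero : ∀ p : Vec d × Mat m d, p.1 ∉ K → L p = 0 := by
    rintro ⟨y, A⟩ hy
    by_cases hyB : y ∈ relBall Ω x₀ r
    · rw [hL, localized_of_mem hyB, image_eq_zero_of_notMem_tsupport (f := θ), hq0]
      exact fun hθy => hy ⟨γ y, ⟨hθy, h.inv_mem hyB⟩, h.right_inv hyB⟩
    · exact localized_of_notMem hyB A
  rintro ⟨y, A⟩ hp
  by_cases hy : y ∈ ball x₀ r
  · have h1 := hcont (y, A) ⟨⟨hy, hp.1⟩, mem_univ A⟩
    have e : relBall Ω x₀ r ×ˢ (univ : Set (Mat m d)) =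
        closure Ω ×ˢ univ ∩ Prod.fst ⁻¹' ball x₀ r := by
      ext ⟨z, C⟩; simp [relBall, and_comm]
    rw [e] at h1
    exact (continuousWithinAt_inter
      ((isOpen_ball.preimage continuous_fst).mem_nhds hy)).1 h1
  · have hyK : y ∉ K := fun h' => hy (hKB h').1
    have hev : ∀ᶠ p in 𝓝 ((y, A) : Vec d × Mat m d), L p = 0 := by
      filter_upwards [(hKc.isClosed.isOpen_compl.preimage continuous_fst).mem_nhds
        (show (y, A) ∈ Prod.fst ⁻¹' Kᶜ from hyK)] with p hp' using hzero p hp'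
    have hc : ContinuousAt L (y, A) := by
      have : L =ᶠ[𝓝 (y, A)] fun _ => 0 := hev
      exact continuousAt_const.congr this.symm
    exact hc.continuousWithinAt

/-! ### Weak gradients of rescaled functions -/

theorem _root_.MeasureTheory.AEStronglyMeasurable.matComp {α : Type*} [MeasurableSpace α]
    {μ : Measure α} {A : α → Mat m d} {E : α → Vec d →L[ℝ] Vec d}
    (hA : AEStronglyMeasurable A μ) (hE : AEStronglyMeasurable E μ) :
    AEStronglyMeasurable (fun x => FreeBoundary.matComp (A x) (E x)) μ := by
  have h : Continuous (Function.uncurry fun (A : Mat m d) (E : Vec d →L[ℝ] Vec d) =>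
      FreeBoundary.matComp A E) := continuous_fst.matComp continuous_snd
  exact h.comp_aestronglyMeasurable₂ hA hE

theorem _root_.MeasureTheory.AEStronglyMeasurable.outer {α : Type*} [MeasurableSpace α]
    {μ : Measure α} {b : α → Vec m} {a : α → Vec d}
    (hb : AEStronglyMeasurable b μ) (ha : AEStronglyMeasurable a μ) :
    AEStronglyMeasurable (fun x => FreeBoundary.outer (b x) (a x)) μ := by
  have h : Continuous fun p : Vec m × Vec d => FreeBoundary.outer p.1 p.2 :=
    continuous_fst.outer continuous_snd
  exact h.comp_aestronglyMeasurable (hb.prodMk ha)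

/-- The factor `r` in the derivative of `Φ` cancels `r⁻¹`, so the first term is a gradient free of
any scale. The second contains only `u(Φ) - b` and is the one that compactness removes. -/
theorem RegularMap.hasWeakGradient_rescaled {B S : Set (Vec d)} {Φ : Vec d → Vec d} {r : ℝ}
    {D : Vec d → Vec d →L[ℝ] Vec d} (h : RegularMap B S Φ fun x => r • D x) (hr : r ≠ 0)
    (hB : volume B ≠ ∞) (hS : volume S ≠ ∞) {c : ℝ} (hc : ∀ x ∈ B, ‖r • D x‖ ≤ c)
    {u : Vec d → Vec m} {G : Vec d → Mat m d} (hu : HasWeakGradient S u G) {K R : ℝ}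
    (hK0 : 0 ≤ K) (hR0 : 0 ≤ R) (huK : ∀ᵐ x ∂(volume.restrict S), ‖u x‖ ≤ K)
    (hGR : ∀ᵐ x ∂(volume.restrict S), ‖G x‖ ≤ R) (b : Vec m) {θ : Vec d → ℝ}
    (hθ : ContDiff ℝ (⊤ : ℕ∞) θ) (hθs : HasCompactSupport θ) :
    HasWeakGradient B (fun x => θ x • (r⁻¹ • (u (Φ x) - b)))
      (fun x => matComp (G (Φ x)) (θ x • D x) + outer (r⁻¹ • (u (Φ x) - b)) (partials θ x)) := by
  have hBfin : IsFiniteMeasure (volume.restrict B) := isFiniteMeasure_restrict.2 hB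
  have hBm := h.isOpen_source.measurableSet
  have hθ1 : ContDiff ℝ 1 θ := hθ.of_le (by exact_mod_cast le_top)
  obtain ⟨hum, hGm⟩ := hu.aestronglyMeasurable
  have huΦm := h.aestronglyMeasurable_comp hum
  have hGΦm := h.aestronglyMeasurable_comp hGm
  obtain ⟨Cθ, hCθ⟩ := hθs.exists_bound_of_continuous hθ1.continuous
  obtain ⟨Cp, hCp⟩ := (hasCompactSupport_partials hθs).exists_bound_of_continuous
    (continuous_partials hθ1)
  have hDm : AEStronglyMeasurable (fun x => r • D x) (volume.restrict B) :=
    h.continuousOn.aestronglyMeasurable hBm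
  have hDm' : AEStronglyMeasurable D (volume.restrict B) := by
    refine (hDm.const_smul r⁻¹).congr (Eventually.of_forall fun x => ?_)
    simp [inv_smul_smul₀ hr]
  have hwint : IntegrableOn (fun x => r⁻¹ • (u (Φ x) - b)) B := by
    refine Integrable.of_bound ((huΦm.sub aestronglyMeasurable_const).const_smul r⁻¹)
      (‖r⁻¹‖ * (K + ‖b‖)) ?_
    filter_upwards [h.ae_comp huK] with x hx
    rw [norm_smul]
    exact mul_le_mul_of_nonneg_left ((norm_sub_le _ _).trans (by linarith)) (norm_nonneg _)
  have hgint : IntegrableOn (fun x => matComp (G (Φ x)) (D x)) B := by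
    refine Integrable.of_bound (hGΦm.matComp hDm') (R * (‖r⁻¹‖ * c)) ?_
    filter_upwards [h.ae_comp hGR, ae_restrict_mem hBm] with x hx hxB
    refine (norm_matComp_le _ _).trans (mul_le_mul hx ?_ (norm_nonneg _) hR0)
    calc ‖D x‖ = ‖r⁻¹ • (r • D x)‖ := by rw [inv_smul_smul₀ hr]
      _ = ‖r⁻¹‖ * ‖r • D x‖ := norm_smul _ _
      _ ≤ _ := mul_le_mul_of_nonneg_left (hc x hxB) (norm_nonneg _)
  refine HasWeakGradient.of_row ?_ ?_ fun i => ?_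
  · exact hwint.bdd_smul Cθ hθ1.continuous.aestronglyMeasurable (Eventually.of_forall hCθ)
  · refine Integrable.add ?_ ?_
    · have := hgint.bdd_smul Cθ hθ1.continuous.aestronglyMeasurable
        (Eventually.of_forall hCθ)
      refine this.congr (Eventually.of_forall fun x => ?_)
      simp only [matComp_smul]
      rfl
    · refine (hwint.norm.mul_const Cp).mono' (hwint.aestronglyMeasurable.outer
        (continuous_partials hθ1).aestronglyMeasurable) (Eventually.of_forall fun x => ?_)
      rw [norm_outer]
      exact mul_le_mul_of_nonneg_left (hCp x) (norm_nonneg _)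
  · have hui : AEStronglyMeasurable (fun x => u x i) (volume.restrict S) :=
      (EuclideanSpace.proj (𝕜 := ℝ) i).continuous.comp_aestronglyMeasurable hum
    have hGi : AEStronglyMeasurable (fun x => row (G x) i) (volume.restrict S) :=
      (continuous_row i).comp_aestronglyMeasurable hGm
    have h1 := h.hasWeakGrad_comp hS hc (hu.hasWeakGrad i) hui hGi hK0 hR0
      (huK.mono fun x hx => (PiLp.norm_apply_le _ i).trans hx)
      (hGR.mono fun x hx => (norm_row_le _ i).trans hx)
    have hi1 : IntegrableOn (fun x => u (Φ x) i) B := by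
      refine Integrable.of_bound ((EuclideanSpace.proj (𝕜 := ℝ) i).continuous.comp_aestronglyMeasurable
        huΦm) K ?_
      filter_upwards [h.ae_comp huK] with x hx using (PiLp.norm_apply_le _ i).trans hx
    have hi2 : IntegrableOn (fun x => r⁻¹ * (u (Φ x) i - b i)) B :=
      (hi1.sub (integrable_const (b i))).const_mul _
    have hrow : ∀ x, r⁻¹ • (r • D x).adjoint (row (G (Φ x)) i) =
        row (matComp (G (Φ x)) (D x)) i := fun x => by
      rw [← row_matComp, matComp_smul, row_smul, inv_smul_smul₀ hr]
    have hi3 : IntegrableOn (fun x => r⁻¹ • (r • D x).adjoint (row (G (Φ x)) i)) B := by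
      simp only [hrow]
      refine hgint.norm.mono' ((continuous_row i).comp_aestronglyMeasurable
        hgint.aestronglyMeasurable) (Eventually.of_forall fun x => norm_row_le _ i)
    have h2 := (((h1.sub_const hi1 (b i)).const_mul r⁻¹).mul hi2 hi3 hθ)
    have e : (fun x => row (matComp (G (Φ x)) (θ x • D x) +
        outer (r⁻¹ • (u (Φ x) - b)) (partials θ x)) i) = fun x =>
        θ x • r⁻¹ • (r • D x).adjoint (row (G (Φ x)) i) +
          (r⁻¹ * (u (Φ x) i - b i)) • partials θ x := by
      ext1 x
      rw [hrow, row_add, row_outer, matComp_smul, row_smul]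
      simp
    rw [e]
    exact h2

/-! ### Perturbation of the energy -/

/-- After division by `α²` the hypothesis on `T` bounds the integrand by `ε‖X‖² + c‖Y‖²`, whatever
the size of `α`. The first term is small because `X` is bounded in `L²`, the second because `Y → 0`
in `L²`. -/
theorem tendsto_energy_difference {B : Set (Vec d)} (hB : volume B ≠ ∞)
    {T : Mat m d → ℝ} (hT : Continuous T)
    (hTp : ∀ C : ℝ, ∀ ε > 0, ∃ c, 0 ≤ c ∧ ∀ X Y : Mat m d, ‖X‖ ≤ C → ‖Y‖ ≤ C →
      |T (X + Y) - T X| ≤ ε * ‖X‖ ^ 2 + c * ‖Y‖ ^ 2)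
    {α : ℕ → ℝ} (hα : ∀ n, 0 < α n) {X Y : ℕ → Vec d → Mat m d}
    (hX : ∀ n, AEStronglyMeasurable (X n) (volume.restrict B))
    (hY : ∀ n, AEStronglyMeasurable (Y n) (volume.restrict B)) {C : ℝ}
    (hXC : ∀ n, ∀ᵐ x ∂(volume.restrict B), ‖α n • X n x‖ ≤ C)
    (hYC : ∀ n, ∀ᵐ x ∂(volume.restrict B), ‖α n • Y n x‖ ≤ C) {A : ℝ}
    (hXA : ∀ n, ∫ x in B, ‖X n x‖ ^ 2 ≤ A)
    (hY0 : Tendsto (fun n => ∫ x in B, ‖Y n x‖ ^ 2) atTop (𝓝 0)) :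
    Tendsto (fun n => (∫ x in B, T (α n • (X n x + Y n x)) / α n ^ 2) -
      ∫ x in B, T (α n • X n x) / α n ^ 2) atTop (𝓝 0) := by
  have hBfin : IsFiniteMeasure (volume.restrict B) := isFiniteMeasure_restrict.2 hB
  obtain ⟨M, -, hM⟩ := exists_bound_on_closedBall hT (C + C)
  have hint : ∀ n, ∀ Z : Vec d → Mat m d, AEStronglyMeasurable Z (volume.restrict B) →
      (∀ᵐ x ∂(volume.restrict B), ‖α n • Z x‖ ≤ C + C) →
      Integrable (fun x => T (α n • Z x) / α n ^ 2) (volume.restrict B) := by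
    intro n Z hZ hZC
    refine (Integrable.of_bound (hT.comp_aestronglyMeasurable (hZ.const_smul (α n))) M ?_).div_const _
    filter_upwards [hZC] with x hx using hM _ hx
  have hsq : ∀ n, ∀ Z : Vec d → Mat m d, AEStronglyMeasurable Z (volume.restrict B) →
      (∀ᵐ x ∂(volume.restrict B), ‖α n • Z x‖ ≤ C) →
      Integrable (fun x => ‖Z x‖ ^ 2) (volume.restrict B) := by
    intro n Z hZ hZC
    refine Integrable.of_bound (hZ.norm.pow 2) (((α n)⁻¹ * C) ^ 2) ?_
    filter_upwards [hZC] with x hx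
    rw [norm_pow, norm_norm]
    refine pow_le_pow_left₀ (norm_nonneg _) ?_ 2
    rw [norm_smul, Real.norm_of_nonneg (hα n).le] at hx
    rwa [le_inv_mul_iff₀ (hα n)]
  rw [Metric.tendsto_atTop']
  intro ε hε
  have hA0 : 0 ≤ A := (integral_nonneg fun x => sq_nonneg _).trans (hXA 0)
  -- `A + 1` instead of `A` avoids division by zero.
  obtain ⟨c, hc0, hc⟩ := hTp C (ε / (2 * (A + 1))) (by positivity)
  have hev := (hY0.const_mul c).eventually (gt_mem_nhds (show c * 0 < ε / 2 by
    rw [mul_zero]; positivity))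
  obtain ⟨N, hN⟩ := eventually_atTop.1 hev
  refine ⟨N, fun n hn => ?_⟩
  have h2C : ∀ᵐ x ∂(volume.restrict B), ‖α n • (X n x + Y n x)‖ ≤ C + C := by
    filter_upwards [hXC n, hYC n] with x h1 h2
    rw [smul_add]
    exact (norm_add_le _ _).trans (add_le_add h1 h2)
  have hC2 : ∀ᵐ x ∂(volume.restrict B), ‖α n • X n x‖ ≤ C + C := by
    filter_upwards [hXC n] with x h1
    linarith [norm_nonneg (α n • X n x)]
  have i1 := hint n (fun x => X n x + Y n x) ((hX n).add (hY n)) h2C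
  have i2 := hint n _ (hX n) hC2
  rw [Real.dist_eq, sub_zero, ← integral_sub i1 i2, ← Real.norm_eq_abs]
  have hbound : ∀ᵐ x ∂(volume.restrict B),
      ‖T (α n • (X n x + Y n x)) / α n ^ 2 - T (α n • X n x) / α n ^ 2‖ ≤
        ε / (2 * (A + 1)) * ‖X n x‖ ^ 2 + c * ‖Y n x‖ ^ 2 := by
    filter_upwards [hXC n, hYC n] with x h1 h2
    have hα2 : 0 < α n ^ 2 := pow_pos (hα n) 2
    have h3 := hc _ _ h1 h2
    rw [Real.norm_eq_abs, ← sub_div, abs_div, abs_of_pos hα2, div_le_iff₀ hα2, smul_add]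
    refine h3.trans (le_of_eq ?_)
    rw [norm_smul, norm_smul, Real.norm_of_nonneg (hα n).le]
    ring
  refine lt_of_le_of_lt (norm_integral_le_of_norm_le
    (((hsq n _ (hX n) (hXC n)).const_mul _).add ((hsq n _ (hY n) (hYC n)).const_mul _)) hbound) ?_
  simp only [Pi.add_apply]
  rw [integral_add ((hsq n _ (hX n) (hXC n)).const_mul _) ((hsq n _ (hY n) (hYC n)).const_mul _),
    integral_const_mul, integral_const_mul]
  have h4 : ε / (2 * (A + 1)) * ∫ x in B, ‖X n x‖ ^ 2 ≤ ε / 2 := by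
    calc ε / (2 * (A + 1)) * ∫ x in B, ‖X n x‖ ^ 2 ≤ ε / (2 * (A + 1)) * (A + 1) :=
          mul_le_mul_of_nonneg_left ((hXA n).trans (by linarith)) (by positivity)
      _ = ε / 2 := by field_simp
  have h5 := hN n hn.le
  linarith

end FreeBoundary

end

noncomputable section

namespace FreeBoundary

/-! ### Compactness in a boundary chart -/

/-- Weakly null sequences in `L²` are bounded. -/
theorem exists_bound_of_weakly_null {E : Type*} [NormedAddCommGroup E] [InnerProductSpace ℝ E]
    [CompleteSpace E] {X : Type*} [MeasurableSpace X] {τ : Measure X} {v : ℕ → X → E}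
    (hv : ∀ n, MemLp (v n) 2 τ)
    (hw : ∀ φ : X → E, MemLp φ 2 τ → Tendsto (fun n => ∫ x, ⟪φ x, v n x⟫_ℝ ∂τ) atTop (𝓝 0)) :
    ∃ M, ∀ n, ∫ x, ‖v n x‖ ^ 2 ∂τ ≤ M := by
  set u : ℕ → Lp E 2 τ := fun n => (hv n).toLp (v n) with hu
  obtain ⟨C, hC⟩ := banach_steinhaus (g := fun n => innerSL ℝ (u n)) fun φ => by
    have h1 := hw φ (Lp.memLp φ)
    obtain ⟨C, hC⟩ := h1.norm.bddAbove_range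
    refine ⟨C, fun n => ?_⟩
    refine le_trans (le_of_eq ?_) (hC (mem_range_self n))
    rw [innerSL_apply_apply, real_inner_comm, L2.inner_def]
    congr 1
    refine integral_congr_ae ?_
    filter_upwards [(hv n).coeFn_toLp] with x hx
    rw [hx]
  refine ⟨C ^ 2, fun n => ?_⟩
  have h2 : ∫ x, ‖v n x‖ ^ 2 ∂τ = ‖u n‖ ^ 2 := by
    rw [← real_inner_self_eq_norm_sq, L2.inner_def]
    refine integral_congr_ae ?_
    filter_upwards [(hv n).coeFn_toLp] with x hx
    rw [hx, real_inner_self_eq_norm_sq]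
  rw [h2]
  refine pow_le_pow_left₀ (norm_nonneg _) ?_ 2
  have := hC n
  rwa [innerSL_apply_norm] at this

namespace BoundaryChart

variable {Ω : Set (Vec d)} {x₀ ν : Vec d} {r δ : ℝ} {Φ : Vec d → Vec d}
  {D : Vec d → Vec d →L[ℝ] Vec d} {γ : Vec d → Vec d}

theorem exists_inv_det_bound (h : BoundaryChart Ω x₀ ν r δ Φ D γ)
    (hdet : ∀ D : Vec d →L[ℝ] Vec d, ‖D - ContinuousLinearMap.id ℝ (Vec d)‖ ≤ δ → D.det ≠ 0) :
    ∃ c, 0 ≤ c ∧ ∀ x ∈ halfBallFlat ν, |(D x).det|⁻¹ ≤ c := by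
  have : ProperSpace (Vec d →L[ℝ] Vec d) := FiniteDimensional.proper ℝ _
  have hmem : ∀ E : Vec d →L[ℝ] Vec d,
      E ∈ closedBall (ContinuousLinearMap.id ℝ (Vec d)) δ → E.det ≠ 0 := fun E hE =>
    hdet E (by rwa [mem_closedBall, dist_eq_norm] at hE)
  obtain ⟨c, hc⟩ := (isCompact_closedBall (ContinuousLinearMap.id ℝ (Vec d)) δ).exists_bound_of_continuousOn
    (f := fun E : Vec d →L[ℝ] Vec d => |E.det|⁻¹)
    (ContinuousLinearMap.continuous_det.abs.continuousOn.inv₀ fun E hE => abs_ne_zero.2 (hmem E hE))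
  refine ⟨max c 0, le_max_right _ _, fun x hx => le_trans ?_ (le_max_left _ _)⟩
  have := hc (D x) (by rw [mem_closedBall, dist_eq_norm]; exact h.deriv_close x hx)
  exact (le_abs_self _).trans this

theorem pow_mul_integral_comp_le (h : BoundaryChart Ω x₀ ν r δ Φ D γ) {c : ℝ}
    (hc : ∀ x ∈ halfBallFlat ν, |(D x).det|⁻¹ ≤ c) {p : Vec d → ℝ} (hp0 : ∀ y, 0 ≤ p y)
    (hp : IntegrableOn p Ω) (hc0 : 0 ≤ c) :
    r ^ d * ∫ x in halfBall ν, p (Φ x) ≤ c * ∫ y in Ω, p y := by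
  rw [h.pow_mul_integral_eq (fun x => p (Φ x))
    (h' := (relBall Ω x₀ r).indicator fun y => |(D (γ y)).det|⁻¹ * p y)
    (fun y hy => indicator_of_notMem hy _)
    (fun y hy => by rw [indicator_of_mem hy, h.right_inv hy]), ← integral_const_mul]
  refine integral_mono_of_nonneg (Eventually.of_forall fun y => indicator_nonneg (fun y _ => ?_) _)
    (hp.const_mul c) (Eventually.of_forall fun y => ?_)
  · exact mul_nonneg (inv_nonneg.2 (abs_nonneg _)) (hp0 y)
  · by_cases hy : y ∈ relBall Ω x₀ r
    · simp only [indicator_of_mem hy]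
      exact mul_le_mul_of_nonneg_right (hc _ (h.inv_mem hy)) (hp0 y)
    · simp only [indicator_of_notMem hy]
      exact mul_nonneg hc0 (hp0 y)

/-- In the variables of `Ω` the integral over `E` is the pairing of `v n` with a bounded vector
field, namely `|det D|⁻¹` times the indicator of `E` in chart coordinates times a basis vector. -/
theorem tendsto_setIntegral_comp (h : BoundaryChart Ω x₀ ν r δ Φ D γ) (hΩ : volume Ω ≠ ∞) {c : ℝ}
    (hc : ∀ x ∈ halfBallFlat ν, |(D x).det|⁻¹ ≤ c)
    (hdet : ∀ x ∈ halfBallFlat ν, (D x).det ≠ 0) {v : ℕ → Vec d → Vec m}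
    (hw : ∀ φ : Vec d → Vec m, MemLp φ 2 (volume.restrict Ω) →
      Tendsto (fun n => ∫ x in Ω, ⟪φ x, v n x⟫_ℝ) atTop (𝓝 0)) (i : Fin m)
    {E : Set (Vec d)} (hE : E ⊆ halfBall ν) (hEm : MeasurableSet E) :
    Tendsto (fun n => ∫ x in E, v n (Φ x) i) atTop (𝓝 0) := by
  have hfin : IsFiniteMeasure (volume.restrict Ω) := isFiniteMeasure_restrict.2 hΩ
  have hrm : MeasurableSet (relBall Ω x₀ r) :=
    measurableSet_ball.inter isClosed_closure.measurableSet
  set s : Vec d → ℝ := fun y => |(D (γ y)).det|⁻¹ * E.indicator (fun _ => (1 : ℝ)) (γ y) with hs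
  set φ : Vec d → Vec m := (relBall Ω x₀ r).indicator fun y => s y • EuclideanSpace.single i 1
    with hφ
  have hsm : AEStronglyMeasurable s ((volume.restrict Ω).restrict (relBall Ω x₀ r)) := by
    refine AEStronglyMeasurable.mul ?_ ?_
    · refine ContinuousOn.aestronglyMeasurable ?_ hrm
      exact (ContinuousLinearMap.continuous_det.comp_continuousOn h.continuousOn_deriv_inv).abs.inv₀
        fun y hy => abs_ne_zero.2 (hdet _ (h.inv_mem hy))
    · exact ((measurable_const.indicator hEm).comp_aemeasurable
        (h.continuousOn_inv.aemeasurable hrm)).aestronglyMeasurable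
  have hφL : MemLp φ 2 (volume.restrict Ω) := by
    refine MemLp.of_bound ((aestronglyMeasurable_indicator_iff hrm).2
      (hsm.smul_const _)) c (Eventually.of_forall fun y => ?_)
    by_cases hy : y ∈ relBall Ω x₀ r
    · have h1 := hc _ (h.inv_mem hy)
      have h2 : (0 : ℝ) ≤ |(D (γ y)).det|⁻¹ := inv_nonneg.2 (abs_nonneg _)
      simp only [hφ, indicator_of_mem hy, norm_smul, PiLp.norm_single, norm_one, mul_one]
      by_cases hyE : γ y ∈ E
      · simpa [hs, hyE] using h1
      · simpa [hs, hyE] using h2.trans h1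
    -- The origin belongs to the flat face, so the bound at `0` shows `0 ≤ c`.
    · have := hc 0 ⟨by simp, by simp⟩
      simp only [hφ, indicator_of_notMem hy, norm_zero]
      exact (inv_nonneg.2 (abs_nonneg _)).trans this
  have key : ∀ n, ∫ x in E, v n (Φ x) i = (r ^ d)⁻¹ * ∫ y in Ω, ⟪φ y, v n y⟫_ℝ := by
    intro n
    have h1 : ∫ x in E, v n (Φ x) i =
        ∫ x in halfBall ν, E.indicator (fun _ => (1 : ℝ)) x * v n (Φ x) i := by
      rw [← integral_indicator hEm, ← integral_indicator (isOpen_halfBall ν).measurableSet]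
      congr 1
      ext x
      by_cases hx : x ∈ E
      · simp [hx, hE hx]
      · by_cases hx' : x ∈ halfBall ν <;> simp [hx, hx']
    rw [h1, ← h.pow_mul_integral_eq (fun x => E.indicator (fun _ => (1 : ℝ)) x * v n (Φ x) i)
      (h' := fun y => ⟪φ y, v n y⟫_ℝ), inv_mul_cancel_left₀ (pow_pos h.pos d).ne']
    · intro y hy
      simp [hφ, indicator_of_notMem hy]
    · intro y hy
      simp only [hφ, indicator_of_mem hy, real_inner_smul_left, h.right_inv hy, hs]
      rw [EuclideanSpace.inner_single_left]
      simp [mul_assoc]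
  simp only [key]
  simpa using (hw φ hφL).const_mul ((r ^ d)⁻¹)

/-- The oscillation of a weakly null sequence of Sobolev functions in a boundary chart. -/
theorem tendsto_oscillation (h : BoundaryChart Ω x₀ ν r δ Φ D γ) (hΩ : volume Ω ≠ ∞)
    (hν : ‖ν‖ = 1) (hδ : δ ≤ 1)
    (hdet : ∀ D : Vec d →L[ℝ] Vec d, ‖D - ContinuousLinearMap.id ℝ (Vec d)‖ ≤ δ → D.det ≠ 0)
    {v : ℕ → Vec d → Vec m} {G : ℕ → Vec d → Mat m d}
    (hvG : ∀ n, HasWeakGradient Ω (v n) (G n))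
    (hvK : ∀ n, ∃ K : ℝ, 0 ≤ K ∧ ∀ᵐ x ∂(volume.restrict Ω), ‖v n x‖ ≤ K)
    (hGR : ∀ n, ∃ R : ℝ, 0 ≤ R ∧ ∀ᵐ x ∂(volume.restrict Ω), ‖G n x‖ ≤ R)
    {A : ℝ} (hA : ∀ n, ∫ x in Ω, ‖G n x‖ ^ 2 ≤ A) {M : ℝ} (hM : ∀ n, ∫ x in Ω, ‖v n x‖ ^ 2 ≤ M)
    (hw : ∀ φ : Vec d → Vec m, MemLp φ 2 (volume.restrict Ω) →
      Tendsto (fun n => ∫ x in Ω, ⟪φ x, v n x⟫_ℝ) atTop (𝓝 0)) :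
    Tendsto (fun n => ∫ x in halfBall ν, ‖v n (Φ x) - ⨍ z in halfBall ν, v n (Φ z)‖ ^ 2) atTop
      (𝓝 0) := by
  have hfin : IsFiniteMeasure (volume.restrict Ω) := isFiniteMeasure_restrict.2 hΩ
  have hHb : volume (halfBall ν) ≠ ∞ := (isBounded_halfBall ν).measure_lt_top.ne
  have hHfin : IsFiniteMeasure (volume.restrict (halfBall ν)) := isFiniteMeasure_restrict.2 hHb
  have hHm := (isOpen_halfBall ν).measurableSet
  have hrd : 0 < r ^ d := pow_pos h.pos d
  obtain ⟨c, hc0, hc⟩ := h.exists_inv_det_bound hdet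
  have hDr : ∀ x ∈ halfBall ν, ‖r • D x‖ ≤ r * 2 := fun x hx => by
    rw [norm_smul, Real.norm_of_nonneg h.pos.le]
    exact mul_le_mul_of_nonneg_left (h.norm_deriv_le hδ (halfBall_subset_flat ν hx)) h.pos.le
  have hvm := fun n => (hvG n).aestronglyMeasurable.1
  have hGm := fun n => (hvG n).aestronglyMeasurable.2
  have hvΦm : ∀ n, AEStronglyMeasurable (fun x => v n (Φ x)) (volume.restrict (halfBall ν)) :=
    fun n => h.regular.aestronglyMeasurable_comp (hvm n)
  have hGΦm : ∀ n, AEStronglyMeasurable (fun x => G n (Φ x)) (volume.restrict (halfBall ν)) :=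
    fun n => h.regular.aestronglyMeasurable_comp (hGm n)
  have hsqint : ∀ {E : Type} [NormedAddCommGroup E] {X : Set (Vec d)} {p : Vec d → E},
      IsFiniteMeasure (volume.restrict X) → AEStronglyMeasurable p (volume.restrict X) →
      (∃ K : ℝ, 0 ≤ K ∧ ∀ᵐ x ∂(volume.restrict X), ‖p x‖ ≤ K) →
      IntegrableOn (fun x => ‖p x‖ ^ 2) X := by
    rintro E _ X p _ hp ⟨K, _, hK⟩
    refine Integrable.of_bound (hp.norm.pow 2) (K ^ 2) ?_
    filter_upwards [hK] with x hx
    rw [norm_pow, norm_norm]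
    exact pow_le_pow_left₀ (norm_nonneg _) hx 2
  have hvΦK : ∀ n, ∃ K : ℝ, 0 ≤ K ∧ ∀ᵐ x ∂(volume.restrict (halfBall ν)), ‖v n (Φ x)‖ ≤ K :=
    fun n => let ⟨K, h0, hK⟩ := hvK n; ⟨K, h0, h.regular.ae_comp hK⟩
  have hGΦR : ∀ n, ∃ K : ℝ, 0 ≤ K ∧ ∀ᵐ x ∂(volume.restrict (halfBall ν)), ‖G n (Φ x)‖ ≤ K :=
    fun n => let ⟨K, h0, hK⟩ := hGR n; ⟨K, h0, h.regular.ae_comp hK⟩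
  have hvΦM : ∀ n, ∫ x in halfBall ν, ‖v n (Φ x)‖ ^ 2 ≤ (r ^ d)⁻¹ * (c * M) := fun n => by
    rw [le_inv_mul_iff₀ hrd]
    exact (h.pow_mul_integral_comp_le hc (p := fun y => ‖v n y‖ ^ 2) (fun y => sq_nonneg _)
      (hsqint hfin (hvm n) (hvK n)) hc0).trans (mul_le_mul_of_nonneg_left (hM n) hc0)
  have hGΦA : ∀ n, ∫ x in halfBall ν, ‖G n (Φ x)‖ ^ 2 ≤ (r ^ d)⁻¹ * (c * A) := fun n => by
    rw [le_inv_mul_iff₀ hrd]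
    exact (h.pow_mul_integral_comp_le hc (p := fun y => ‖G n y‖ ^ 2) (fun y => sq_nonneg _)
      (hsqint hfin (hGm n) (hGR n)) hc0).trans (mul_le_mul_of_nonneg_left (hA n) hc0)
  have hnull : ∀ i : Fin m, ∀ E ⊆ halfBall ν, MeasurableSet E →
      Tendsto (fun n => ∫ x in E, v n (Φ x) i) atTop (𝓝 0) := fun i E hE hEm =>
    h.tendsto_setIntegral_comp hΩ hc (fun x hx => hdet _ (h.deriv_close x hx)) hw i hE hEm
  have hcm : ∀ n (i : Fin m), AEStronglyMeasurable (fun x => v n (Φ x) i)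
      (volume.restrict (halfBall ν)) := fun n i =>
    (EuclideanSpace.proj (𝕜 := ℝ) i).continuous.comp_aestronglyMeasurable (hvΦm n)
  have hcb : ∀ n (i : Fin m), ∃ K : ℝ, 0 ≤ K ∧ ∀ᵐ x ∂(volume.restrict (halfBall ν)),
      ‖v n (Φ x) i‖ ≤ K := fun n i => by
    obtain ⟨K, h0, hK⟩ := hvΦK n
    exact ⟨K, h0, hK.mono fun x hx => (PiLp.norm_apply_le _ i).trans hx⟩
  have hcsq : ∀ n (i : Fin m), IntegrableOn (fun x => v n (Φ x) i ^ 2) (halfBall ν) := fun n i => by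
    simpa only [Real.norm_eq_abs, sq_abs] using hsqint hHfin (hcm n i) (hcb n i)
  have hrow : ∀ n (i : Fin m) x, x ∈ halfBall ν →
      ‖(r • D x).adjoint (row (G n (Φ x)) i)‖ ≤ r * 2 * ‖G n (Φ x)‖ := fun n i x hx => by
    refine (ContinuousLinearMap.le_opNorm _ _).trans ?_
    rw [LinearIsometryEquiv.norm_map]
    exact mul_le_mul (hDr x hx) (norm_row_le _ i) (norm_nonneg _)
      ((norm_nonneg _).trans (hDr x hx))
  -- Rellich's theorem is applied to each component after pulling back, where the domain is a convex
  -- half-ball. The bounds `A` and `M` on `Ω` turn into bounds uniform in `n` through the Jacobian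
  -- estimate.
  have hcomp : ∀ i : Fin m, Tendsto (fun n => ∫ x in halfBall ν, v n (Φ x) i ^ 2) atTop (𝓝 0) := by
    intro i
    have hgm : ∀ n, AEStronglyMeasurable (fun x => (r • D x).adjoint (row (G n (Φ x)) i))
        (volume.restrict (halfBall ν)) := fun n => by
      have hDm : AEStronglyMeasurable (fun x => r • D x) (volume.restrict (halfBall ν)) :=
        h.regular.continuousOn.aestronglyMeasurable hHm
      have := (continuous_row (m := m) (d := d) i).comp_aestronglyMeasurable
        ((hGΦm n).matComp hDm)
      exact this
    refine rellich (isOpen_halfBall ν) (convex_halfBall ν) (nonempty_halfBall hν)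
      (isBounded_halfBall ν) (g := fun n x => (r • D x).adjoint (row (G n (Φ x)) i))
      (A := (r * 2) ^ 2 * ((r ^ d)⁻¹ * (c * A))) (M := (r ^ d)⁻¹ * (c * M))
      (fun n => ?_) (fun n => hcm n i) hgm (fun n => hcb n i)
      (fun n => ?_) (fun n => ?_) (fun n => ?_) (hnull i)
    · obtain ⟨K, hK0, hK⟩ := hvK n
      obtain ⟨R, hR0, hR⟩ := hGR n
      exact h.regular.hasWeakGrad_comp hΩ hDr ((hvG n).hasWeakGrad i)
        ((EuclideanSpace.proj (𝕜 := ℝ) i).continuous.comp_aestronglyMeasurable (hvm n))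
        ((continuous_row i).comp_aestronglyMeasurable (hGm n)) hK0 hR0
        (hK.mono fun x hx => (PiLp.norm_apply_le _ i).trans hx)
        (hR.mono fun x hx => (norm_row_le _ i).trans hx)
    · obtain ⟨R, hR0, hR⟩ := hGΦR n
      refine ⟨r * 2 * R, by have := h.pos; positivity, ?_⟩
      filter_upwards [hR, ae_restrict_mem hHm] with x hx hxB
      exact (hrow n i x hxB).trans (mul_le_mul_of_nonneg_left hx (by have := h.pos; positivity))
    · refine le_trans ?_ (mul_le_mul_of_nonneg_left (hGΦA n) (sq_nonneg (r * 2)))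
      rw [← integral_const_mul]
      refine integral_mono_of_nonneg (Eventually.of_forall fun x => sq_nonneg _)
        ((hsqint hHfin (hGΦm n) (hGΦR n)).const_mul _) ?_
      filter_upwards [ae_restrict_mem hHm] with x hxB
      simp only [← mul_pow]
      exact pow_le_pow_left₀ (norm_nonneg _) (hrow n i x hxB) 2
    · refine le_trans ?_ (hvΦM n)
      refine integral_mono_of_nonneg (Eventually.of_forall fun x => sq_nonneg _)
        (hsqint hHfin (hvΦm n) (hvΦK n)) (Eventually.of_forall fun x => ?_)
      simp only
      rw [← sq_abs, ← Real.norm_eq_abs]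
      exact pow_le_pow_left₀ (norm_nonneg _) (PiLp.norm_apply_le _ i) 2
  have hsum : Tendsto (fun n => ∫ x in halfBall ν, ‖v n (Φ x)‖ ^ 2) atTop (𝓝 0) := by
    have h1 : ∀ n, ∫ x in halfBall ν, ‖v n (Φ x)‖ ^ 2 =
        ∑ i, ∫ x in halfBall ν, v n (Φ x) i ^ 2 := fun n => by
      rw [← integral_finsetSum _ fun i _ => hcsq n i]
      congr 1
      ext x
      rw [EuclideanSpace.norm_sq_eq]
      simp
    simp only [h1]
    simpa using tendsto_finsetSum Finset.univ fun i _ => hcomp i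
  have hvint : ∀ n, IntegrableOn (fun x => v n (Φ x)) (halfBall ν) := fun n => by
    obtain ⟨K, _, hK⟩ := hvΦK n
    exact Integrable.of_bound (hvΦm n) K hK
  -- The mean values are integrals over the whole half-ball, one of the sets on which weak
  -- convergence is already known.
  have hmean : Tendsto (fun n => ‖⨍ z in halfBall ν, v n (Φ z)‖ ^ 2) atTop (𝓝 0) := by
    have h1 : ∀ n, ‖⨍ z in halfBall ν, v n (Φ z)‖ ^ 2 =
        ∑ i, ((volume.real (halfBall ν))⁻¹ * ∫ z in halfBall ν, v n (Φ z) i) ^ 2 := fun n => by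
      rw [setAverage_eq, EuclideanSpace.norm_sq_eq]
      refine Finset.sum_congr rfl fun i _ => ?_
      have h2 : ∫ z in halfBall ν, v n (Φ z) i = (∫ z in halfBall ν, v n (Φ z)) i :=
        (EuclideanSpace.proj (𝕜 := ℝ) i : Vec m →L[ℝ] ℝ).integral_comp_comm (hvint n)
      rw [PiLp.smul_apply, smul_eq_mul, h2, Real.norm_eq_abs, sq_abs]
    simp only [h1]
    have h3 : ∀ i : Fin m, Tendsto (fun n => ((volume.real (halfBall ν))⁻¹ *
        ∫ z in halfBall ν, v n (Φ z) i) ^ 2) atTop (𝓝 0) := fun i => by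
      simpa using ((hnull i _ subset_rfl hHm).const_mul ((volume.real (halfBall ν))⁻¹)).pow 2
    simpa using tendsto_finsetSum Finset.univ fun i _ => h3 i
  have hub : Tendsto (fun n => 2 * (∫ x in halfBall ν, ‖v n (Φ x)‖ ^ 2) +
      2 * (volume.real (halfBall ν) * ‖⨍ z in halfBall ν, v n (Φ z)‖ ^ 2)) atTop (𝓝 0) := by
    simpa using (hsum.const_mul 2).add ((hmean.const_mul (volume.real (halfBall ν))).const_mul 2)
  refine squeeze_zero (fun n => integral_nonneg fun x => sq_nonneg _) (fun n => ?_) hub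
  have i1 := (hsqint hHfin (hvΦm n) (hvΦK n)).const_mul 2
  have i2 : Integrable (fun _ : Vec d => 2 * ‖⨍ z in halfBall ν, v n (Φ z)‖ ^ 2)
      (volume.restrict (halfBall ν)) := integrable_const _
  have e : 2 * (∫ x in halfBall ν, ‖v n (Φ x)‖ ^ 2) +
      2 * (volume.real (halfBall ν) * ‖⨍ z in halfBall ν, v n (Φ z)‖ ^ 2) =
      ∫ x in halfBall ν, (2 * ‖v n (Φ x)‖ ^ 2 + 2 * ‖⨍ z in halfBall ν, v n (Φ z)‖ ^ 2) := by
    rw [integral_add i1 i2, integral_const_mul, setIntegral_const, smul_eq_mul]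
    ring
  rw [e]
  refine integral_mono_of_nonneg (Eventually.of_forall fun x => sq_nonneg _) (i1.add i2)
    (Eventually.of_forall fun x => ?_)
  have h4 := norm_sub_le (v n (Φ x)) (⨍ z in halfBall ν, v n (Φ z))
  have h5 := norm_nonneg (v n (Φ x) - ⨍ z in halfBall ν, v n (Φ z))
  simp only
  nlinarith [sq_nonneg (‖v n (Φ x)‖ - ‖⨍ z in halfBall ν, v n (Φ z)‖)]

end BoundaryChart

end FreeBoundary

end

noncomputable section

namespace FreeBoundary

/-! ### The limit of the localized energies in a chart -/

/-- The non-quadratic part of the energy density, transported by a linear map. -/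
def transportedRemainder (U : Mat m d → ℝ) (p : ℝ × (Vec d →L[ℝ] Vec d) × Mat m d) : ℝ :=
  |p.2.1.det|⁻¹ * (U (matComp p.2.2 (p.1 • p.2.1)) * ‖matComp p.2.2 (p.1 • p.2.1)‖ ^ 2 / ‖p.2.2‖ ^ 2)

/-- The quadratic part of the energy density, transported by a linear map. -/
def transportedForm (Q : Mat m d → ℝ) (p : ℝ × (Vec d →L[ℝ] Vec d) × Mat m d) : ℝ :=
  |p.2.1.det|⁻¹ * (1 / 2 * Q (matComp p.2.2 (p.1 • p.2.1)))

theorem continuousOn_inv_det :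
    ContinuousOn (fun p : ℝ × (Vec d →L[ℝ] Vec d) × Mat m d => |p.2.1.det|⁻¹)
      {p | p.2.1.det ≠ 0} := by
  refine ContinuousOn.inv₀ ?_ fun p hp => abs_ne_zero.2 hp
  exact (ContinuousLinearMap.continuous_det.comp
    (continuous_fst.comp continuous_snd)).abs.continuousOn

theorem continuousOn_transportedRemainder {U : Mat m d → ℝ} (hU : Continuous U) (hU0 : U 0 = 0) :
    ContinuousOn (transportedRemainder U) {p | p.2.1.det ≠ 0} := by
  refine continuousOn_inv_det.mul (Continuous.continuousOn ?_)
  exact (continuous_transported hU hU0).comp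
    (f := fun p : ℝ × (Vec d →L[ℝ] Vec d) × Mat m d => (p.1 • p.2.1, p.2.2)) (by fun_prop)

theorem continuousOn_transportedForm {Q : Mat m d → ℝ} (hQ : Continuous Q) :
    ContinuousOn (transportedForm Q) {p | p.2.1.det ≠ 0} := by
  refine continuousOn_inv_det.mul (Continuous.continuousOn ?_)
  refine continuous_const.mul (hQ.comp ?_)
  exact (continuous_snd.comp continuous_snd).matComp
    (continuous_fst.smul (continuous_fst.comp continuous_snd))

theorem transportedRemainder_zero {U : Mat m d → ℝ} (hU0 : U 0 = 0) (D : Vec d →L[ℝ] Vec d)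
    (A : Mat m d) : transportedRemainder U (0, D, A) = 0 := by
  simp [transportedRemainder, matComp_smul, hU0]

theorem transportedForm_zero {Q : Mat m d → ℝ} (hQ : ∀ (c : ℝ) A, Q (c • A) = c ^ 2 * Q A)
    (D : Vec d →L[ℝ] Vec d) (A : Mat m d) : transportedForm Q (0, D, A) = 0 := by
  have hQ0 : Q 0 = 0 := by simpa using hQ 0 0
  simp [transportedForm, matComp_smul, hQ0]

theorem det_id_vec : (ContinuousLinearMap.id ℝ (Vec d)).det = 1 := by
  simpa using det_smul_id (d := d) 1

theorem transportedRemainder_id {U : Mat m d → ℝ} (hU0 : U 0 = 0) (A : Mat m d) :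
    transportedRemainder U (1, ContinuousLinearMap.id ℝ (Vec d), A) = U A := by
  by_cases hA : A = 0
  · simp [transportedRemainder, hA, hU0]
  · have : ‖A‖ ^ 2 ≠ 0 := pow_ne_zero _ (norm_ne_zero_iff.2 hA)
    simp [transportedRemainder, det_id_vec, matComp_id, hA]

theorem transportedForm_id (Q : Mat m d → ℝ) (A : Mat m d) :
    transportedForm Q (1, ContinuousLinearMap.id ℝ (Vec d), A) = 1 / 2 * Q A := by
  simp [transportedForm, det_id_vec, matComp_id]

/-- `U` is evaluated at `a • A`, where the magnitude matters, whereas `Q` is homogeneous of degree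
two and sees only the direction. Both terms then carry the weight `‖A‖²` of the generating measures;
at `A = 0` everything vanishes. -/
theorem transported_add {T U Q : Mat m d → ℝ} (hT : ∀ A, T A = U A * ‖A‖ ^ 2 + 1 / 2 * Q A)
    (hQ : ∀ (c : ℝ) A, Q (c • A) = c ^ 2 * Q A) {a : ℝ} (ha : 0 < a) (s : ℝ)
    (D : Vec d →L[ℝ] Vec d) (A : Mat m d) :
    |D.det|⁻¹ * (T (a • matComp A (s • D)) / a ^ 2) =
      transportedRemainder U (s, D, a • A) * ‖A‖ ^ 2 +
        transportedForm Q (s, D, ‖A‖⁻¹ • A) * ‖A‖ ^ 2 := by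
  have hQ0 : Q 0 = 0 := by simpa using hQ 0 0
  by_cases hA : A = 0
  · have : matComp (0 : Mat m d) (s • D) = 0 := by
      have := smul_matComp (0 : Mat m d) (0 : ℝ) (s • D)
      simpa using this
    simp [hA, this, hT, hQ0]
  · have hn : ‖A‖ ≠ 0 := norm_ne_zero_iff.2 hA
    simp only [transportedRemainder, transportedForm, smul_matComp, hT, hQ, norm_smul,
      Real.norm_of_nonneg ha.le]
    field_simp

/-- The change of variables and `transported_add` turn the energy into two integrals over `Ω` with
weight `|G n|²`, whose test functions do not depend on `n`. The first converges by the definition of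
`μ` and the second by that of `λ`. -/
theorem BoundaryChart.tendsto_integral_transported {Ω : Set (Vec d)} {x₀ ν : Vec d} {r δ : ℝ}
    {Φ : Vec d → Vec d} {D : Vec d → Vec d →L[ℝ] Vec d} {γ : Vec d → Vec d}
    (h : BoundaryChart Ω x₀ ν r δ Φ D γ)
    (hdet : ∀ D : Vec d →L[ℝ] Vec d, ‖D - ContinuousLinearMap.id ℝ (Vec d)‖ ≤ δ → D.det ≠ 0)
    (hΩ : IsOpen Ω) (hX : IsCompact (closure Ω)) {T U Q : Mat m d → ℝ} (hU : Continuous U)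
    (hU0 : U 0 = 0) (hQc : Continuous Q) (hQ : ∀ (c : ℝ) A, Q (c • A) = c ^ 2 * Q A)
    (hT : ∀ A, T A = U A * ‖A‖ ^ 2 + 1 / 2 * Q A) {α : ℕ → ℝ} (hα : ∀ n, 0 < α n)
    {G : ℕ → Vec d → Mat m d} (hGm : ∀ n, AEStronglyMeasurable (G n) (volume.restrict Ω))
    (hGi : ∀ n, IntegrableOn (fun x => ‖G n x‖ ^ 2) Ω) {R : ℝ}
    (hR : ∀ n, ∀ᵐ x ∂(volume.restrict Ω), ‖α n • G n x‖ ≤ R)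
    {π : Measure (Vec d)} [IsFiniteMeasure π] {μ lam : Kernel (Vec d) (Mat m d)}
    [IsMarkovKernel μ] [IsMarkovKernel lam] (hgen : Generates Ω α G R π μ lam)
    {θ : Vec d → ℝ} (hθ : Continuous θ) (hθs : HasCompactSupport θ)
    (hθB : tsupport θ ⊆ ball 0 1) :
    Tendsto (fun n => r ^ d *
        ∫ x in halfBall ν, T (α n • matComp (G n (Φ x)) (θ x • D x)) / α n ^ 2) atTop
      (𝓝 ((∫ p in relBall Ω x₀ r ×ˢ univ,
          transportedRemainder U (θ (γ p.1), D (γ p.1), p.2) ∂(π ⊗ₘ μ)) +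
        ∫ p in relBall Ω x₀ r ×ˢ univ,
          transportedForm Q (θ (γ p.1), D (γ p.1), p.2) ∂(π ⊗ₘ lam))) := by
  have hrm : MeasurableSet (relBall Ω x₀ r ×ˢ (univ : Set (Mat m d))) :=
    (measurableSet_ball.inter isClosed_closure.measurableSet).prod MeasurableSet.univ
  set LU := localized (transportedRemainder U) θ (relBall Ω x₀ r) γ fun y => D (γ y) with hLU
  set LQ := localized (transportedForm Q) θ (relBall Ω x₀ r) γ fun y => D (γ y) with hLQ
  have hLUc : ContinuousOn LU (closure Ω ×ˢ univ) :=
    h.continuousOn_localized hdet (continuousOn_transportedRemainder hU hU0)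
      (transportedRemainder_zero hU0) hθ hθs hθB
  have hLQc : ContinuousOn LQ (closure Ω ×ˢ univ) :=
    h.continuousOn_localized hdet (continuousOn_transportedForm hQc)
      (transportedForm_zero hQ) hθ hθs hθB
  have hlamB : ∀ x ∈ closure Ω, lam x (closedBall 0 1)ᶜ = 0 := fun x hx =>
    measure_mono_null (compl_subset_compl.2 sphere_subset_closedBall) (hgen.sphere_carrier x hx)
  have hunit : ∀ n, ∀ᵐ x ∂(volume.restrict Ω), ‖‖G n x‖⁻¹ • G n x‖ ≤ 1 := fun n =>
    Eventually.of_forall fun x => by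
      rw [norm_smul, norm_inv, norm_norm]
      exact inv_mul_le_one
  have l1 := tendsto_integral_test hΩ hX hgen.carrier hgen.ball_carrier hgen.tendsto_M hLUc
  have l2 := tendsto_integral_test hΩ hX hgen.carrier hlamB hgen.tendsto_Λ hLQc
  have e1 : ∫ z, LU z ∂(π ⊗ₘ μ) = ∫ p in relBall Ω x₀ r ×ˢ univ,
      transportedRemainder U (θ (γ p.1), D (γ p.1), p.2) ∂(π ⊗ₘ μ) := integral_indicator hrm
  have e2 : ∫ z, LQ z ∂(π ⊗ₘ lam) = ∫ p in relBall Ω x₀ r ×ˢ univ,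
      transportedForm Q (θ (γ p.1), D (γ p.1), p.2) ∂(π ⊗ₘ lam) := integral_indicator hrm
  rw [← e1, ← e2]
  refine (l1.add l2).congr fun n => ?_
  have i1 := integrable_test_mul hΩ hX hLUc ((hGm n).const_smul (α n)) (hR n) (hGi n)
  have i2 := integrable_test_mul hΩ hX hLQc
    ((hGm n).norm.aemeasurable.inv.aestronglyMeasurable.smul (hGm n)) (hunit n) (hGi n)
  refine (integral_add i1 i2).symm.trans (Eq.symm ?_)
  refine h.pow_mul_integral_eq _ (fun y hy => ?_) fun y hy => ?_
  · simp only [Pi.smul_apply, Pi.smul_apply', hLU, hLQ, localized_of_notMem hy, zero_mul, add_zero]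
  · simp only [Pi.smul_apply, hLU, hLQ, localized_of_mem hy, h.right_inv hy]
    exact (transported_add hT hQ (hα n) _ _ _).symm

end FreeBoundary

end

noncomputable section

namespace FreeBoundary

/-! ### Localized energies of the blown-up sequence -/

theorem norm_setAverage_le {E : Type*} [NormedAddCommGroup E] [NormedSpace ℝ E] {B : Set (Vec d)}
    (hB : volume B ≠ ∞) {f : Vec d → E} {K : ℝ} (hK0 : 0 ≤ K)
    (hK : ∀ᵐ x ∂(volume.restrict B), ‖f x‖ ≤ K) : ‖⨍ x in B, f x‖ ≤ K := by
  have h1 : ‖∫ x in B, f x‖ ≤ K * volume.real B :=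
    norm_setIntegral_le_of_norm_le_const_ae hB.lt_top hK
  rw [setAverage_eq, norm_smul, norm_inv, Real.norm_of_nonneg measureReal_nonneg]
  rcases eq_or_lt_of_le (measureReal_nonneg (μ := volume) (s := B)) with h0 | h0
  · rw [← h0]; simpa using hK0
  · rwa [inv_mul_le_iff₀ h0, mul_comm]

theorem integrable_norm_sq_of_bound {X E : Type*} [MeasurableSpace X] [NormedAddCommGroup E]
    {τ : Measure X} [IsFiniteMeasure τ] {p : X → E} (hp : AEStronglyMeasurable p τ) {K : ℝ}
    (hK : ∀ᵐ x ∂τ, ‖p x‖ ≤ K) : Integrable (fun x => ‖p x‖ ^ 2) τ := by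
  refine Integrable.of_bound (hp.norm.pow 2) (K ^ 2) ?_
  filter_upwards [hK] with x hx
  rw [norm_pow, norm_norm]
  exact pow_le_pow_left₀ (norm_nonneg _) hx 2

/-- The gradient of `ζ n` is `X n + Y n`, the transported gradient plus the term with `∇θ`. The
oscillation estimate sends `Y n` to zero in `L²`, so the energy has the same limit as that of `X n`
alone. Membership in `W^{1,∞}` follows from bounds of order `(α n)⁻¹`, which need not be uniform in
`n`. -/
theorem BoundaryChart.memW1p_and_tendsto {Ω : Set (Vec d)} {x₀ ν : Vec d} {r δ : ℝ}
    {Φ : Vec d → Vec d} {D : Vec d → Vec d →L[ℝ] Vec d} {γ : Vec d → Vec d}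
    (h : BoundaryChart Ω x₀ ν r δ Φ D γ) (hν : ‖ν‖ = 1) (hδ : δ ≤ 1)
    (hdet : ∀ D : Vec d →L[ℝ] Vec d, ‖D - ContinuousLinearMap.id ℝ (Vec d)‖ ≤ δ → D.det ≠ 0)
    (hΩ : IsOpen Ω) (hX : IsCompact (closure Ω)) {T U Q : Mat m d → ℝ} (hTc : Continuous T)
    (hU : Continuous U)
    (hU0 : U 0 = 0) (hQc : Continuous Q) (hQ : ∀ (c : ℝ) A, Q (c • A) = c ^ 2 * Q A)
    (hT : ∀ A, T A = U A * ‖A‖ ^ 2 + 1 / 2 * Q A)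
    (hTp : ∀ C : ℝ, ∀ ε > 0, ∃ c, 0 ≤ c ∧ ∀ X Y : Mat m d, ‖X‖ ≤ C → ‖Y‖ ≤ C →
      |T (X + Y) - T X| ≤ ε * ‖X‖ ^ 2 + c * ‖Y‖ ^ 2)
    {α : ℕ → ℝ} (hα : ∀ n, 0 < α n) {v : ℕ → Vec d → Vec m} (hv : WeaklyNullW12 Ω v)
    {K R : ℝ} (hK : ∀ n, ∀ᵐ x ∂(volume.restrict Ω), ‖α n • v n x‖ ≤ K)
    (hR : ∀ n, ∀ᵐ x ∂(volume.restrict Ω), ‖α n • weakGradient Ω (v n) x‖ ≤ R)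
    {π : Measure (Vec d)} [IsFiniteMeasure π] {μ lam : Kernel (Vec d) (Mat m d)}
    [IsMarkovKernel μ] [IsMarkovKernel lam]
    (hgen : Generates Ω α (fun n => weakGradient Ω (v n)) R π μ lam)
    {θ : Vec d → ℝ} (hθ : ContDiff ℝ (⊤ : ℕ∞) θ) (hθs : HasCompactSupport θ)
    (hθB : tsupport θ ⊆ ball 0 1) {ζ : ℕ → Vec d → Vec m}
    (hζ : ∀ n x, ζ n x = θ x • (r⁻¹ • (v n (Φ x) - ⨍ z in halfBall ν, v n (Φ z)))) :
    (∀ n, MemW1p ⊤ (halfBall ν) (ζ n)) ∧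
    Tendsto (fun n => r ^ d *
        ∫ x in halfBall ν, T (α n • weakGradient (halfBall ν) (ζ n) x) / α n ^ 2) atTop
      (𝓝 ((∫ p in relBall Ω x₀ r ×ˢ univ,
          transportedRemainder U (θ (γ p.1), D (γ p.1), p.2) ∂(π ⊗ₘ μ)) +
        ∫ p in relBall Ω x₀ r ×ˢ univ,
          transportedForm Q (θ (γ p.1), D (γ p.1), p.2) ∂(π ⊗ₘ lam))) := by
  have hΩv : volume Ω ≠ ∞ := ((measure_mono subset_closure).trans_lt hX.measure_lt_top).ne
  have hΩfin : IsFiniteMeasure (volume.restrict Ω) := isFiniteMeasure_restrict.2 hΩv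
  set B := halfBall ν with hBdef
  have hBo : IsOpen B := isOpen_halfBall ν
  have hBm : MeasurableSet B := hBo.measurableSet
  have hBv : volume B ≠ ∞ := (isBounded_halfBall ν).measure_lt_top.ne
  have hBfin : IsFiniteMeasure (volume.restrict B) := isFiniteMeasure_restrict.2 hBv
  have hrd : 0 < r ^ d := pow_pos h.pos d
  set G : ℕ → Vec d → Mat m d := fun n => weakGradient Ω (v n) with hG
  have hvG : ∀ n, HasWeakGradient Ω (v n) (G n) := fun n =>
    hasWeakGradient_weakGradient (hv.mem n).exists_gradient
  -- a common bound for `α v` and `α ∇v`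
  set N := max (max K R) 0 with hN
  have hN0 : 0 ≤ N := le_max_right _ _
  have hKN : ∀ n, ∀ᵐ x ∂(volume.restrict Ω), ‖α n • v n x‖ ≤ N := fun n =>
    (hK n).mono fun x hx => hx.trans ((le_max_left _ _).trans (le_max_left _ _))
  have hRN : ∀ n, ∀ᵐ x ∂(volume.restrict Ω), ‖α n • G n x‖ ≤ N := fun n =>
    (hR n).mono fun x hx => hx.trans ((le_max_right _ _).trans (le_max_left _ _))
  have hdiv : ∀ {E : Type} [NormedAddCommGroup E] [NormedSpace ℝ E] (n) {a : E},
      ‖α n • a‖ ≤ N → ‖a‖ ≤ (α n)⁻¹ * N := by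
    intro E _ _ n a ha
    rwa [le_inv_mul_iff₀ (hα n), ← Real.norm_of_nonneg (hα n).le, ← norm_smul]
  have hvb : ∀ n, ∀ᵐ x ∂(volume.restrict Ω), ‖v n x‖ ≤ (α n)⁻¹ * N := fun n =>
    (hKN n).mono fun x hx => hdiv n hx
  have hGb : ∀ n, ∀ᵐ x ∂(volume.restrict Ω), ‖G n x‖ ≤ (α n)⁻¹ * N := fun n =>
    (hRN n).mono fun x hx => hdiv n hx
  have hb0 : ∀ n, 0 ≤ (α n)⁻¹ * N := fun n => mul_nonneg (inv_nonneg.2 (hα n).le) hN0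
  have hvm := fun n => (hvG n).aestronglyMeasurable.1
  have hGm := fun n => (hvG n).aestronglyMeasurable.2
  have hGi : ∀ n, IntegrableOn (fun x => ‖G n x‖ ^ 2) Ω := fun n =>
    integrable_norm_sq_of_bound (hGm n) (hGb n)
  -- The test function `1` in the generating property makes the Dirichlet integrals convergent,
  -- hence bounded.
  obtain ⟨A, hA⟩ : ∃ A, ∀ n, ∫ x in Ω, ‖G n x‖ ^ 2 ≤ A := by
    have h1 := hgen.tendsto_M (fun _ => 1) continuous_const
    simp only [one_mul] at h1
    obtain ⟨A, hA⟩ := h1.bddAbove_range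
    exact ⟨A, fun n => hA (mem_range_self n)⟩
  obtain ⟨M, hM⟩ := exists_bound_of_weakly_null (fun n => (hv.mem n).memLp) hv.weak
  set b : ℕ → Vec m := fun n => ⨍ z in B, v n (Φ z) with hb
  have hosc : Tendsto (fun n => ∫ x in B, ‖v n (Φ x) - b n‖ ^ 2) atTop (𝓝 0) :=
    h.tendsto_oscillation hΩv hν hδ hdet hvG (fun n => ⟨_, hb0 n, hvb n⟩)
      (fun n => ⟨_, hb0 n, hGb n⟩) hA hM hv.weak
  obtain ⟨c, hc0, hc⟩ := h.exists_inv_det_bound hdet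
  have hDr : ∀ x ∈ B, ‖r • D x‖ ≤ r * 2 := fun x hx => by
    rw [norm_smul, Real.norm_of_nonneg h.pos.le]
    exact mul_le_mul_of_nonneg_left (h.norm_deriv_le hδ (halfBall_subset_flat ν hx)) h.pos.le
  set X : ℕ → Vec d → Mat m d := fun n x => matComp (G n (Φ x)) (θ x • D x) with hXdef
  set Y : ℕ → Vec d → Mat m d := fun n x => outer (r⁻¹ • (v n (Φ x) - b n)) (partials θ x)
    with hYdef
  have hζG : ∀ n, HasWeakGradient B (ζ n) (fun x => X n x + Y n x) := fun n => by
    rw [show ζ n = fun x => θ x • (r⁻¹ • (v n (Φ x) - b n)) from funext (hζ n)]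
    exact h.regular.hasWeakGradient_rescaled h.pos.ne' hBv hΩv hDr (hvG n) (hb0 n) (hb0 n)
      (hvb n) (hGb n) (b n) hθ hθs
  have hθ1 : ContDiff ℝ 1 θ := hθ.of_le (by exact_mod_cast le_top)
  obtain ⟨Cθ, hCθ⟩ := hθs.exists_bound_of_continuous hθ1.continuous
  obtain ⟨Cp, hCp⟩ := (hasCompactSupport_partials hθs).exists_bound_of_continuous
    (continuous_partials hθ1)
  have hCθ0 : 0 ≤ Cθ := (norm_nonneg _).trans (hCθ 0)
  have hCp0 : 0 ≤ Cp := (norm_nonneg _).trans (hCp 0)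
  have hr0 : 0 ≤ r⁻¹ := inv_nonneg.2 h.pos.le
  have hvΦ : ∀ n, ∀ᵐ x ∂(volume.restrict B), ‖v n (Φ x)‖ ≤ (α n)⁻¹ * N := fun n =>
    h.regular.ae_comp (hvb n)
  have hGΦ : ∀ n, ∀ᵐ x ∂(volume.restrict B), ‖G n (Φ x)‖ ≤ (α n)⁻¹ * N := fun n =>
    h.regular.ae_comp (hGb n)
  have hbb : ∀ n, ‖b n‖ ≤ (α n)⁻¹ * N := fun n => norm_setAverage_le hBv (hb0 n) (hvΦ n)
  have hob : ∀ n, ∀ᵐ x ∂(volume.restrict B), ‖v n (Φ x) - b n‖ ≤ (α n)⁻¹ * N + (α n)⁻¹ * N :=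
    fun n => (hvΦ n).mono fun x hx => (norm_sub_le _ _).trans (add_le_add hx (hbb n))
  have hXle : ∀ n, ∀ x ∈ B, ‖X n x‖ ≤ ‖G n (Φ x)‖ * (Cθ * 2) := fun n x hx => by
    refine (norm_matComp_le _ _).trans (mul_le_mul_of_nonneg_left ?_ (norm_nonneg _))
    rw [norm_smul]
    exact mul_le_mul (hCθ x) (h.norm_deriv_le hδ (halfBall_subset_flat ν hx)) (norm_nonneg _) hCθ0
  have hYle : ∀ n x, ‖Y n x‖ ≤ r⁻¹ * Cp * ‖v n (Φ x) - b n‖ := fun n x => by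
    simp only [hYdef, norm_outer, norm_smul, Real.norm_of_nonneg hr0]
    calc r⁻¹ * ‖v n (Φ x) - b n‖ * ‖partials θ x‖ ≤ r⁻¹ * ‖v n (Φ x) - b n‖ * Cp :=
          mul_le_mul_of_nonneg_left (hCp x) (mul_nonneg hr0 (norm_nonneg _))
      _ = _ := by ring
  have hXb : ∀ n, ∀ᵐ x ∂(volume.restrict B), ‖X n x‖ ≤ (α n)⁻¹ * (N * (Cθ * 2)) := fun n => by
    filter_upwards [hGΦ n, ae_restrict_mem hBm] with x hx hxB
    refine (hXle n x hxB).trans ?_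
    rw [← mul_assoc (α n)⁻¹]
    exact mul_le_mul_of_nonneg_right hx (mul_nonneg hCθ0 zero_le_two)
  have hYb : ∀ n, ∀ᵐ x ∂(volume.restrict B), ‖Y n x‖ ≤ (α n)⁻¹ * (r⁻¹ * Cp * (N + N)) := fun n => by
    filter_upwards [hob n] with x h1
    refine (hYle n x).trans ?_
    calc r⁻¹ * Cp * ‖v n (Φ x) - b n‖ ≤ r⁻¹ * Cp * ((α n)⁻¹ * N + (α n)⁻¹ * N) :=
          mul_le_mul_of_nonneg_left h1 (mul_nonneg hr0 hCp0)
      _ = _ := by ring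
  have hvΦm : ∀ n, AEStronglyMeasurable (fun x => v n (Φ x)) (volume.restrict B) := fun n =>
    h.regular.aestronglyMeasurable_comp (hvm n)
  have hGΦm : ∀ n, AEStronglyMeasurable (fun x => G n (Φ x)) (volume.restrict B) := fun n =>
    h.regular.aestronglyMeasurable_comp (hGm n)
  have hXm : ∀ n, AEStronglyMeasurable (X n) (volume.restrict B) := fun n => by
    refine (hGΦm n).matComp (hθ1.continuous.aestronglyMeasurable.smul ?_)
    exact (h.continuousOn_deriv.mono (halfBall_subset_flat ν)).aestronglyMeasurable hBm
  have hoscm : ∀ n, AEStronglyMeasurable (fun x => v n (Φ x) - b n) (volume.restrict B) := fun n =>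
    (hvΦm n).sub aestronglyMeasurable_const
  have hYm : ∀ n, AEStronglyMeasurable (Y n) (volume.restrict B) := fun n =>
    AEStronglyMeasurable.outer ((hoscm n).const_smul r⁻¹)
      (continuous_partials hθ1).aestronglyMeasurable
  refine ⟨fun n => ?_, ?_⟩
  · refine memW1p_top_of_bound hBo (hζG n) (K := Cθ * (r⁻¹ * ((α n)⁻¹ * N + (α n)⁻¹ * N)))
      (R := (α n)⁻¹ * (N * (Cθ * 2)) + (α n)⁻¹ * (r⁻¹ * Cp * (N + N))) ?_ ?_
    · filter_upwards [hob n] with x h1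
      rw [hζ, norm_smul, norm_smul, Real.norm_of_nonneg hr0]
      exact mul_le_mul (hCθ x) (mul_le_mul_of_nonneg_left h1 hr0) (by positivity) hCθ0
    · filter_upwards [hXb n, hYb n] with x h1 h2 using (norm_add_le _ _).trans (add_le_add h1 h2)
  have hαb : ∀ {C : ℝ} {Z : Vec d → Mat m d} (n), (∀ᵐ x ∂(volume.restrict B),
      ‖Z x‖ ≤ (α n)⁻¹ * C) → ∀ᵐ x ∂(volume.restrict B), ‖α n • Z x‖ ≤ C := by
    intro C Z n hZ
    filter_upwards [hZ] with x hx
    rwa [norm_smul, Real.norm_of_nonneg (hα n).le, ← le_inv_mul_iff₀ (hα n)]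
  have hXA : ∀ n, ∫ x in B, ‖X n x‖ ^ 2 ≤ (Cθ * 2) ^ 2 * ((r ^ d)⁻¹ * (c * A)) := fun n => by
    have h1 : ∫ x in B, ‖G n (Φ x)‖ ^ 2 ≤ (r ^ d)⁻¹ * (c * A) := by
      rw [le_inv_mul_iff₀ hrd]
      exact (h.pow_mul_integral_comp_le hc (p := fun y => ‖G n y‖ ^ 2) (fun y => sq_nonneg _)
        (hGi n) hc0).trans (mul_le_mul_of_nonneg_left (hA n) hc0)
    refine le_trans ?_ (mul_le_mul_of_nonneg_left h1 (sq_nonneg (Cθ * 2)))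
    rw [← integral_const_mul]
    refine integral_mono_of_nonneg (Eventually.of_forall fun x => sq_nonneg _)
      ((integrable_norm_sq_of_bound (hGΦm n) (hGΦ n)).const_mul _) ?_
    filter_upwards [ae_restrict_mem hBm] with x hx
    rw [← mul_pow, mul_comm (Cθ * 2)]
    exact pow_le_pow_left₀ (norm_nonneg _) (hXle n x hx) 2
  have hY0 : Tendsto (fun n => ∫ x in B, ‖Y n x‖ ^ 2) atTop (𝓝 0) := by
    have h1 := hosc.const_mul ((r⁻¹ * Cp) ^ 2)
    rw [mul_zero] at h1
    refine squeeze_zero (fun n => integral_nonneg fun x => sq_nonneg _) (fun n => ?_) h1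
    rw [← integral_const_mul]
    refine integral_mono_of_nonneg (Eventually.of_forall fun x => sq_nonneg _)
      ((integrable_norm_sq_of_bound (hoscm n) (hob n)).const_mul _)
      (Eventually.of_forall fun x => ?_)
    simp only
    rw [← mul_pow]
    exact pow_le_pow_left₀ (norm_nonneg _) (hYle n x) 2
  set C := max (N * (Cθ * 2)) (r⁻¹ * Cp * (N + N)) with hC
  have hdiff := tendsto_energy_difference hBv hTc hTp hα hXm hYm (C := C)
    (fun n => (hαb n (hXb n)).mono fun x hx => hx.trans (le_max_left _ _))
    (fun n => (hαb n (hYb n)).mono fun x hx => hx.trans (le_max_right _ _)) hXA hY0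
  have hlim := h.tendsto_integral_transported hdet hΩ hX hU hU0 hQc hQ hT hα hGm hGi hR hgen
    hθ1.continuous hθs hθB
  have := (hdiff.const_mul (r ^ d)).add hlim
  rw [mul_zero, zero_add] at this
  refine this.congr fun n => ?_
  have hwg : ∫ x in B, T (α n • weakGradient B (ζ n) x) / α n ^ 2 =
      ∫ x in B, T (α n • (X n x + Y n x)) / α n ^ 2 := by
    refine integral_congr_ae ?_
    filter_upwards [(hasWeakGradient_weakGradient ⟨_, hζG n⟩).ae_eq hBo (hζG n)] with x hx
    rw [hx]
  rw [hwg]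
  ring

end FreeBoundary

end

/-! ### The three successive limits at a Lebesgue point. -/

theorem theorem8p2 {m d : ℕ}
    -- the domain, its outer unit normal, and the two parts of its boundary
    (Ω : Set (Vec d)) (hΩ : IsBoundedC1Domain Ω)
    (ν : Vec d → Vec d) (hν : ∀ x ∈ frontier Ω, IsOuterUnitNormal Ω x (ν x))
    (Γ₁ Γ₂ : Set (Vec d)) (hΓ₁ : ∃ O : Set (Vec d), IsOpen O ∧ Γ₁ = frontier Ω ∩ O)
    (hΓ₂ : Γ₂ = frontier Ω \ closure Γ₁)
    -- the map `y` with gradient `F`, and the Lagrangian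
    (y : Vec d → Vec m) (F : Vec d → Mat m d) (hy : IsC1UpToBoundary Ω y F)
    (W : Vec d → Mat m d → ℝ) (hW : IsAdmissibleLagrangian Ω F W)
    -- the sequences `α_n > 0` and `v_n ⇀ 0`, with `α_n v_n` bounded in `W^{1,∞}`
    (α : ℕ → ℝ) (hα : ∀ n, 0 < α n)
    (v : ℕ → Vec d → Vec m) (hv : WeaklyNullW12 Ω v)
    (K R : ℝ) (hK : ∀ n, ∀ᵐ x ∂(volume.restrict Ω), ‖α n • v n x‖ ≤ K)
    (hR : ∀ n, ∀ᵐ x ∂(volume.restrict Ω), ‖α n • weakGradient Ω (v n) x‖ ≤ R)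
    -- the measures generated by the pair `(α_n, v_n)`
    (π : Measure (Vec d)) [IsFiniteMeasure π]
    (μ lam : Kernel (Vec d) (Mat m d)) [IsMarkovKernel μ] [IsMarkovKernel lam]
    (hgen : Generates Ω α (fun n => weakGradient Ω (v n)) R π μ lam) :
    ∀ᵐ x₀ ∂π, x₀ ∈ Γ₂ →
      ∀ f g : ℝ → Vec d → Vec d, IsStraightening Ω x₀ (ν x₀) f g →
      ∀ θ : ℕ → Vec d → ℝ, IsCutoffSequence θ →
      ∀ ζ : ℝ → ℕ → ℕ → Vec d → Vec m,
        (∀ r k n x, ζ r k n x = θ k x • rescaled x₀ (ν x₀) (f r) r (v n) x) →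
        (∀ᶠ r in 𝓝[>] (0 : ℝ), ∀ k n, MemW1p ⊤ (halfBall (ν x₀)) (ζ r k n)) ∧
        HasIteratedLimit
          (fun r k n => r ^ d / π.real (relBall Ω x₀ r) *
            ∫ x in halfBall (ν x₀),
              scaledLag W F x₀ (α n) (weakGradient (halfBall (ν x₀)) (ζ r k n) x))
          (actionLimit W F R x₀ (μ x₀) (lam x₀)) := by

  have hX : IsCompact (closure Ω) := hΩ.isBounded.isCompact_closure
  have hlamB : ∀ x ∈ closure Ω, lam x (closedBall 0 1)ᶜ = 0 := fun x hx =>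
    measure_mono_null (compl_subset_compl.2 sphere_subset_closedBall) (hgen.sphere_carrier x hx)
  -- The null set is fixed by `π`, `μ` and `λ` alone, before any straightening or cut-off is
  -- introduced.
  filter_upwards [ae_tendsto_average_kernel hgen.carrier hgen.ball_carrier,
    ae_tendsto_average_kernel hgen.carrier hlamB, ae_mem_of_measure_compl hgen.carrier]
    with x₀ hμ hlam hx₀ hxΓ f g hfg θ hθ ζ hζ
  obtain ⟨hpos, hμ⟩ := hμ
  have hlam := hlam.2
  have hν1 : ‖ν x₀‖ = 1 := (hν x₀ (by rw [hΓ₂] at hxΓ; exact hxΓ.1)).1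
  set U := remainder W F x₀ with hU
  set Q := quadForm W F x₀ with hQ
  have hUc : Continuous U := hW.continuous_remainder hx₀
  have hU0 : U 0 = 0 := remainder_zero x₀
  have hQc : Continuous Q := continuous_quadForm x₀
  have hQs : ∀ (c : ℝ) A, Q (c • A) = c ^ 2 * Q A := quadForm_smul x₀
  obtain ⟨δ, hδ0, hδ1, hdet⟩ := exists_det_ne_zero (d := d)
  have hchart := hfg.eventually_boundaryChart hΩ hν1 hδ0 hdet
  have hstep := hchart.mono fun r hr (k : ℕ) =>
    hr.memW1p_and_tendsto hν1 hδ1 hdet hΩ.isOpen hX (hW.continuous_reduced hx₀) hUc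
      hU0 hQc hQs (reduced_eq x₀) (fun C ε hε => hW.exists_perturbation_bound hx₀ C hε) hα hv hK hR
      hgen (hθ.contDiff k) (hθ.hasCompactSupport k) (hθ.tsupport_subset k) (ζ := ζ r k)
      (fun n x => hζ r k n x)
  refine ⟨hstep.mono fun r h k => (h k).1, ?_⟩
  set qU := transportedRemainder U with hqU
  set qQ := transportedForm Q with hqQ
  have hqUc := continuousOn_transportedRemainder hUc hU0
  have hqQc := continuousOn_transportedForm hQc
  set P : ℝ → Vec d → Vec d →L[ℝ] Vec d := fun r z =>
    fderivWithin ℝ (f r) (halfBallFlat (ν x₀)) (g r (r⁻¹ • (z - x₀))) with hP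
  -- The limit in `n` retains the cut-off `θ k` in chart coordinates; the limit in `k` replaces it
  -- by `1`.
  refine ⟨fun r k => (π.real (relBall Ω x₀ r))⁻¹ *
    ((∫ p in relBall Ω x₀ r ×ˢ univ, qU (θ k (g r (r⁻¹ • (p.1 - x₀))), P r p.1, p.2) ∂(π ⊗ₘ μ)) +
      ∫ p in relBall Ω x₀ r ×ˢ univ,
        qQ (θ k (g r (r⁻¹ • (p.1 - x₀))), P r p.1, p.2) ∂(π ⊗ₘ lam)),
    fun r => (π.real (relBall Ω x₀ r))⁻¹ *
    ((∫ p in relBall Ω x₀ r ×ˢ univ, qU (1, P r p.1, p.2) ∂(π ⊗ₘ μ)) +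
      ∫ p in relBall Ω x₀ r ×ˢ univ, qQ (1, P r p.1, p.2) ∂(π ⊗ₘ lam)), ?_, ?_, ?_⟩
  · filter_upwards [hstep] with r hr k
    refine ((hr k).2.const_mul ((π.real (relBall Ω x₀ r))⁻¹)).congr fun n => ?_
    rw [← mul_assoc, ← div_eq_inv_mul]
    rfl
  · filter_upwards [hchart] with r hr
    have : ProperSpace (Vec d →L[ℝ] Vec d) := FiniteDimensional.proper ℝ _
    have hdet' : ∀ D ∈ closedBall (ContinuousLinearMap.id ℝ (Vec d)) δ, D.det ≠ 0 := fun D hD =>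
      hdet D (by rwa [mem_closedBall, dist_eq_norm] at hD)
    have hrm : MeasurableSet (relBall Ω x₀ r) :=
      measurableSet_ball.inter isClosed_closure.measurableSet
    have hPB : ∀ z ∈ relBall Ω x₀ r,
        P r z ∈ closedBall (ContinuousLinearMap.id ℝ (Vec d)) δ := fun z hz => by
      rw [mem_closedBall, dist_eq_norm]
      exact hr.deriv_close _ (hr.inv_mem hz)
    exact ((tendsto_integral_cutoff isClosed_closure hgen.carrier hgen.ball_carrier hqUc
      (isCompact_closedBall _ _) hdet' hrm hr.continuousOn_inv (fun z hz => (hr.inv_mem hz).1)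
      hr.continuousOn_deriv_inv hPB hθ).add
      (tendsto_integral_cutoff isClosed_closure hgen.carrier hlamB hqQc
      (isCompact_closedBall _ _) hdet' hrm hr.continuousOn_inv (fun z hz => (hr.inv_mem hz).1)
      hr.continuousOn_deriv_inv hPB hθ)).const_mul _
  · have hPc : ∀ᶠ r in 𝓝[>] (0 : ℝ), ContinuousOn (P r) (ball x₀ r ∩ closure Ω) :=
      hchart.mono fun r hr => hr.continuousOn_deriv_inv
    have hPid : ∀ ε > 0, ∀ᶠ r in 𝓝[>] (0 : ℝ), ∀ z ∈ ball x₀ r ∩ closure Ω,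
        ‖P r z - ContinuousLinearMap.id ℝ (Vec d)‖ ≤ ε := fun ε hε => by
      have hm : min ε δ ≤ δ := min_le_right _ _
      -- Building the chart again with tolerance `min ε δ` yields convergence of the derivative to
      -- the identity; the determinant condition is kept because the tolerance is at most `δ`.
      filter_upwards [hfg.eventually_boundaryChart hΩ hν1 (lt_min hε hδ0)
        fun D hD => hdet D (hD.trans hm)] with r hr z hz
      exact (hr.deriv_close _ (hr.inv_mem hz)).trans (min_le_left _ _)
    have hι : Continuous fun p : (Vec d →L[ℝ] Vec d) × Mat m d => ((1 : ℝ), p.1, p.2) := by fun_prop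
    have l1 := tendsto_average_transported isClosed_closure hgen.carrier hgen.ball_carrier
      (q := fun p => qU (1, p.1, p.2))
      (hqUc.comp hι.continuousOn fun p hp => hp) hpos hμ hPc hPid
    have l2 := tendsto_average_transported isClosed_closure hgen.carrier hlamB
      (q := fun p => qQ (1, p.1, p.2))
      (hqQc.comp hι.continuousOn fun p hp => hp) hpos hlam hPc hPid
    -- At the identity the transported densities reduce to `U` and `½ (L A, A)`, and the
    -- restrictions to ball and sphere are harmless because the measures at `x₀` are carried by
    -- them.
    have e : actionLimit W F R x₀ (μ x₀) (lam x₀) =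
        (∫ A, qU (1, ContinuousLinearMap.id ℝ (Vec d), A) ∂(μ x₀)) +
          ∫ A, qQ (1, ContinuousLinearMap.id ℝ (Vec d), A) ∂(lam x₀) := by
      simp only [hqU, hqQ, transportedRemainder_id hU0, transportedForm_id, integral_const_mul]
      rw [actionLimit, Measure.restrict_eq_self_of_ae_mem
          (ae_mem_of_measure_compl (hgen.ball_carrier x₀ hx₀)),
        Measure.restrict_eq_self_of_ae_mem
          (ae_mem_of_measure_compl (hgen.sphere_carrier x₀ hx₀))]
    rw [e]
    exact (l1.add l2).congr fun r => (mul_add _ _ _).symm
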